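/- Fix an integer $n\ge 1$ and $\beta>0$. Let $\mathcal J$ be a random $n\times n$ Jacobi matrix from the Gaussian $\beta$-ensemble, i.e. the real symmetric tridiagonal matrix with diagonal entries $b_1,\dots,b_n\in\mathbb R$ and off-diagonal entries $a_1,\dots,a_{n-1}>0$ whose joint distribution has density proportional to $$\prod_{j=1}^{n-1}a_j^{\beta(n-j)-1}\exp\Big(-\sum_{j=1}^{n-1}a_j^2-\tfrac12\sum_{j=1}^n b_j^2\Big).$$ Let $l>0$ be a random variable independent of $\mathcal J$ with absolutely continuous distribution $d\nu=F(x)\,dx$. For $z\in\mathbb C$ let $\operatorname{Arg}_{[0,\pi)}z$ be $\operatorname{Arg}z$ if $\operatorname{Im}z>0$, $0$ if $z\in\mathbb R$, and $\pi+\operatorname{Arg}z$ if $\operatorname{Im}z<0$, where $\operatorname{Arg}z\in(-\pi,\pi]$ is the principal argument. Let $$D=\Big\{(z_j)_{j=1}^n\in(\mathbb C\setminus\mathbb R)^n:\ \sum_{j=1}^n\operatorname{Arg}_{[0,\pi)}z_j<\tfrac{\pi}{2},\ \ \tan\Big(\sum_{j=1}^n\operatorname{Arg}_{[0,\pi)}z_j\Big)\in\operatorname{supp}\nu\Big\}.$$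 Let $z_1,\dots,z_n$ be the eigenvalues, counted with algebraic multiplicity, of $\mathcal J_{l,\times}=(I_n+i\,l\,e_1e_1^*)\mathcal J$. Then almost surely $(z_1,\dots,z_n)\in D$ and $l=\tan\big(\sum_j\operatorname{Arg}_{[0,\pi)}z_j\big)$. Moreover the unordered $n$-tuple $\{z_1,\dots,z_n\}$ is distributed as the unordered version of a random vector in $\mathbb C^n$ which has, with respect to Lebesgue measure $d^2z_1\cdots d^2z_n$, the (permutation-invariant) probability density equal to $0$ outside $D$ and, on $D$, equal to $$\frac1{C_{\beta,n}}\,e^{-\frac12\left((\sum_{j}\operatorname{Re}z_j)^2-\sum_{j\ne k}\operatorname{Re}(z_jz_k)\right)}\,\frac1{|\operatorname{Re}(\prod_{j}z_j)|^{\beta/2}}\prod_{j,k=1}^n|z_j-\bar z_k|^{\beta/2-1}\prod_{1\le j<k\le n}|z_j-z_k|^2\;\,t^{\,1-\beta n/2}F(t),$$ where $t=\tan\big(\sum_{j=1}^n\operatorname{Arg}_{[0,\pi)}z_j\big)$ and $$C_{\beta,n}=2^{n(\beta/2-1)}\,(2\pi)^{n/2}\prod_{j=1}^n\frac{\Gamma(1+\beta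 j/2)}{\Gamma(1+\beta/2)}\cdot\frac{\Gamma(\beta/2)^n}{\Gamma(\beta n/2)}.$$ -/

import Mathlib

open MeasureTheory ProbabilityTheory
open scoped BigOperators ENNReal

noncomputable section

namespace MultPert

/-- The `n × n` real tridiagonal (Jacobi) matrix with diagonal entries `b 0, …, b (n-1)` and
off-diagonal entries `a 0, …, a (n-2)`. -/
def jacobiMatrix {n : ℕ} (a : Fin (n - 1) → ℝ) (b : Fin n → ℝ) : Matrix (Fin n) (Fin n) ℝ :=
  Matrix.of fun i j =>
    if i = j then b i
    else if h : i.1 + 1 = j.1 then a ⟨i.1, by omega⟩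
    else if h : j.1 + 1 = i.1 then a ⟨j.1, by omega⟩
    else 0

/-- Matrices carry the product (entrywise) Borel σ-algebra. -/
instance matrixMeasurableSpace (n : ℕ) : MeasurableSpace (Matrix (Fin n) (Fin n) ℝ) :=
  inferInstanceAs (MeasurableSpace (Fin n → Fin n → ℝ))

/-- The unnormalized weight
`∏_{j=1}^{n-1} a_j^{β(n-j)-1} exp(-∑ a_j² - ½ ∑ b_j²)` on Jacobi coefficients
(the index `j` below runs from `0`, so that it stands for the `(j+1)`-st coefficient). -/
def coefficientWeight (β : ℝ) (n : ℕ) (x : (Fin (n - 1) → ℝ) × (Fin n → ℝ)) : ℝ :=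
  (∏ j : Fin (n - 1), x.1 j ^ (β * ((n : ℝ) - ((j.1 : ℝ) + 1)) - 1)) *
    Real.exp (-(∑ j, x.1 j ^ 2) - (1 / 2) * ∑ j, x.2 j ^ 2)

/-- The measure with density `coefficientWeight` on `{a_j > 0, b_j ∈ ℝ}`. -/
def coefficientMeasure (β : ℝ) (n : ℕ) : Measure ((Fin (n - 1) → ℝ) × (Fin n → ℝ)) :=
  (volume.restrict {x | ∀ j, 0 < x.1 j}).withDensity
    fun x => ENNReal.ofReal (coefficientWeight β n x)

/-- The Gaussian `β`-ensemble: the law of the random Jacobi matrix whose coefficients have joint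
distribution proportional to `coefficientWeight` (normalized to total mass one). -/
def gaussianBetaEnsemble (β : ℝ) (n : ℕ) : Measure (Matrix (Fin n) (Fin n) ℝ) :=
  ((coefficientMeasure β n Set.univ)⁻¹ • coefficientMeasure β n).map
    fun x => jacobiMatrix x.1 x.2

/-- The multiplicative perturbation `(I + i l e₁ e₁^*) J`. -/
def multPerturbation {n : ℕ} [NeZero n] (J : Matrix (Fin n) (Fin n) ℝ) (l : ℝ) :
    Matrix (Fin n) (Fin n) ℂ :=
  (1 + (Complex.I * (l : ℂ)) • Matrix.single (0 : Fin n) (0 : Fin n) (1 : ℂ)) *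
    J.map (fun x : ℝ => (x : ℂ))

/-- The unordered `n`-tuple underlying an ordered one. -/
def toConfig {n : ℕ} (z : Fin n → ℂ) : Sym ℂ n :=
  ⟨Finset.univ.val.map z, by simp⟩

/-- Unordered `n`-tuples carry the quotient σ-algebra: a set of configurations is measurable iff
the (permutation invariant) set of its enumerations is a Borel set of `ℂⁿ`. -/
instance configMeasurableSpace (n : ℕ) : MeasurableSpace (Sym ℂ n) :=
  MeasurableSpace.map (toConfig (n := n)) inferInstance

/-- The eigenvalues of a complex matrix, with algebraic multiplicity, as an unordered tuple. -/
def eigenvalues {n : ℕ} (A : Matrix (Fin n) (Fin n) ℂ) : Sym ℂ n :=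
  ⟨A.charpoly.roots, by
    rw [IsAlgClosed.card_roots_eq_natDegree, Matrix.charpoly_natDegree_eq_dim, Fintype.card_fin]⟩

/-- The argument modulo `π`, with values in `[0, π)`. -/
def argModPi (z : ℂ) : ℝ :=
  if 0 < z.im then Complex.arg z
  else if z.im = 0 then 0
  else Real.pi + Complex.arg z

/-- `∑_j Arg_{[0,π)} z_j`. -/
def argSum {n : ℕ} (z : Fin n → ℂ) : ℝ := ∑ j, argModPi (z j)

/-- The possible eigenvalue configurations: `z ∈ (ℂ ∖ ℝ)ⁿ` with `∑ Arg_{[0,π)} z_j < π / 2` and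
`tan (∑ Arg_{[0,π)} z_j) ∈ supp ν`. -/
def configurations (n : ℕ) (ν : Measure ℝ) : Set (Fin n → ℂ) :=
  {z | (∀ j, (z j).im ≠ 0) ∧ argSum z < Real.pi / 2 ∧ Real.tan (argSum z) ∈ ν.support}

/-- `g_{β,n}`. -/
def gConst (β : ℝ) (n : ℕ) : ℝ :=
  (2 * Real.pi) ^ ((n : ℝ) / 2) *
    ∏ j ∈ Finset.Icc 1 n, Real.Gamma (1 + β * (j : ℝ) / 2) / Real.Gamma (1 + β / 2)

/-- `c_{β,n}`. -/
def cConst (β : ℝ) (n : ℕ) : ℝ :=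
  Real.Gamma (β / 2) ^ n / Real.Gamma (β * (n : ℝ) / 2)

/-- `C_{β,n} = g_{β,n} c_{β,n} 2^{n(β/2-1)}`. -/
def normConst (β : ℝ) (n : ℕ) : ℝ :=
  gConst β n * cConst β n * (2 : ℝ) ^ ((n : ℝ) * (β / 2 - 1))

/-- The joint density of the eigenvalues, with respect to Lebesgue measure `d²z_1 ⋯ d²z_n`. -/
def jointDensity (β : ℝ) (n : ℕ) (F : ℝ → ℝ) (z : Fin n → ℂ) : ℝ :=
  (normConst β n)⁻¹ *
    Real.exp (-(1 / 2) * ((∑ j, (z j).re) ^ 2 -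
      ∑ j, ∑ k ∈ Finset.univ.filter (fun k => k ≠ j), (z j * z k).re)) *
    (1 / |(∏ j, z j).re| ^ (β / 2)) *
    (∏ j, ∏ k, ‖z j - (starRingEnd ℂ) (z k)‖ ^ (β / 2 - 1)) *
    (∏ j, ∏ k ∈ Finset.univ.filter (fun k => j < k), ‖z j - z k‖ ^ 2) *
    (Real.tan (argSum z) ^ (1 - β * (n : ℝ) / 2) * F (Real.tan (argSum z)))

end MultPert

end

/-!
Let `p` be the characteristic polynomial of `J` and `c` that of `J` without its first row and
column. The characteristic polynomial of `(I + i l e₁e₁*) J` is `p + i l (p - X c)`, so the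
eigenvalues remember the pair `(p, c)` together with `l`, which is the ratio of the imaginary and
real parts of the constant coefficient. The pairs that arise from Jacobi matrices are those whose
roots interlace: the Euclidean algorithm `p = (X - b₁) c - a₁² d` recovers the matrix one entry
at a time, and as a change of variables it has a product of powers of the `a j` as its Jacobian.

For nonreal `z j` the real part of `∏ j, (x - z j)` vanishes on the real line where the phase
`∑ j, Arg_{[0,π)} (z j - x)` is an odd multiple of `π / 2`. That `∑ j, Arg_{[0,π)} (z j) < π / 2`
means that all zeros of the real part are real and simple and that the phase increases with `|x|` at
each of them, which is interlacing; the tangent of this sum is then `l`.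

The law of the eigenvalues follows by three changes of variables: `(a, b)` to `(p, c)`,
`(p, c, l)` to the coefficients of `p + i l (p - X c)`, and these coefficients to their roots, where
the Jacobian is `∏_{j < k} ‖z j - z k‖ ^ 2`. In the density, `∑ j, b j ^ 2 + 2 ∑ j, a j ^ 2` is the
power sum of the squared roots of `p`, hence quadratic in the first two coefficients, and the
powers of the `a j` combine into the resultant of `p` and `c`, which is
`∏ j, ∏ k, ‖z j - conj (z k)‖` up to powers of `2`, `l` and `p 0`.
-/

noncomputable section

namespace MultPert

open Polynomial

/-! ### Interlacing pairs of real polynomials -/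

lemma exists_eq_nodal {q : ℝ[X]} (hq : q.Monic) (hreal : ∀ x : ℂ, aeval x q = 0 → x.im = 0)
    (hsimple : ∀ x : ℝ, q.eval x = 0 → (derivative q).eval x ≠ 0) :
    ∃ s : Finset ℝ, q = Lagrange.nodal s id := by
  have hsplits : q.Splits := by
    refine Splits.of_splits_map (algebraMap ℝ ℂ) (IsAlgClosed.splits _) fun x hx => ?_
    rw [mem_roots (hq.map _).ne_zero, IsRoot, eval_map_algebraMap] at hx
    exact ⟨x.re, Complex.ext (by simp) (by simp [hreal x hx])⟩
  have hnodup : q.roots.Nodup := by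
    refine Multiset.nodup_iff_count_le_one.2 fun x => ?_
    rw [count_roots]
    by_contra! hx
    rw [one_lt_rootMultiplicity_iff_isRoot hq.ne_zero] at hx
    exact hsimple x hx.1 hx.2
  refine ⟨⟨q.roots, hnodup⟩, ?_⟩
  rw [Lagrange.nodal_eq]
  exact hsplits.eq_prod_roots_of_monic hq

lemma eq_nodal_of_roots {R : Type*} [CommRing R] [IsDomain R] {q : R[X]} (hq : q.Monic)
    {s : Finset R} (hs : s.card = q.natDegree) (h : ∀ x ∈ s, q.eval x = 0) :
    q = Lagrange.nodal s id := by
  have hroots : s.val = q.roots := by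
    refine Multiset.eq_of_le_of_card_le ?_ (q.card_roots'.trans hs.ge)
    exact (Multiset.le_iff_subset s.nodup).2 fun x hx => (mem_roots hq.ne_zero).2 (h x hx)
  rw [Lagrange.nodal_eq, ← prod_multiset_X_sub_C_of_monic_of_roots_card_eq hq (hroots ▸ hs),
    ← hroots]
  rfl

lemma eval_derivative_nodal_id {R : Type*} [CommRing R] [DecidableEq R] {s : Finset R} {x : R}
    (hx : x ∈ s) :
    (derivative (Lagrange.nodal s id)).eval x = (Lagrange.nodal (s.erase x) id).eval x :=
  Lagrange.eval_nodal_derivative_eval_node_eq (v := id) hx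

lemma eval_nodal_id_ne_zero {R : Type*} [CommRing R] [IsDomain R] {s : Finset R} {x : R}
    (hx : x ∉ s) : (Lagrange.nodal s id).eval x ≠ 0 :=
  Lagrange.eval_nodal_not_at_node fun _ hy => (ne_of_mem_of_not_mem hy hx).symm

/-- `p` is monic of degree `m + 1` with distinct real roots, `c` is monic of degree `m`, and the
residues of `c / p` are positive; equivalently, the roots of `c` separate those of `p`. -/
structure Interlaces (m : ℕ) (p c : ℝ[X]) : Prop where
  natDegree_left : p.natDegree = m + 1
  monic_right : c.Monic
  natDegree_right : c.natDegree = m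
  exists_eq_nodal : ∃ s : Finset ℝ, p = Lagrange.nodal s id ∧
    ∀ x ∈ s, 0 < c.eval x * (derivative p).eval x

namespace Interlaces

variable {m : ℕ} {p c : ℝ[X]}

lemma monic_left (h : Interlaces m p c) : p.Monic := by
  obtain ⟨s, rfl, -⟩ := h.exists_eq_nodal
  exact Lagrange.nodal_monic

lemma of_im_eq_zero_of_residue_pos (hp : p.Monic) (hpd : p.natDegree = m + 1) (hc : c.Monic)
    (hcd : c.natDegree = m) (hreal : ∀ x : ℂ, aeval x p = 0 → x.im = 0)
    (hres : ∀ x : ℝ, p.eval x = 0 → 0 < c.eval x * (derivative p).eval x) :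
    Interlaces m p c := by
  obtain ⟨s, hs⟩ := MultPert.exists_eq_nodal hp hreal
    fun x hx => right_ne_zero_of_mul (hres x hx).ne'
  exact ⟨hpd, hc, hcd, s, hs, fun x hx => hres x (hs ▸ Lagrange.eval_nodal_at_node (v := id) hx)⟩

lemma partial_fractions (h : Interlaces m p c) :
    ∃ (s : Finset ℝ) (w : ℝ → ℝ), s.Nonempty ∧ (∀ x ∈ s, 0 < w x) ∧ p = Lagrange.nodal s id ∧
      c = ∑ x ∈ s, C (w x) * Lagrange.nodal (s.erase x) id := by
  obtain ⟨s, hp, hres⟩ := h.exists_eq_nodal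
  have hcard : s.card = m + 1 := by rw [← h.natDegree_left, hp, Lagrange.natDegree_nodal]
  have hweight : ∀ x ∈ s, 0 < c.eval x / (derivative p).eval x := fun x hx =>
    div_pos_iff.2 (mul_pos_iff.1 (hres x hx))
  refine ⟨s, fun x => c.eval x / (derivative p).eval x,
    Finset.card_pos.1 (hcard ▸ m.succ_pos), hweight, hp, ?_⟩
  refine Polynomial.eq_of_degrees_lt_of_eval_finset_eq s ?_ ?_ fun x hx => ?_
  · rw [degree_eq_natDegree h.monic_right.ne_zero, h.natDegree_right, hcard]
    exact_mod_cast m.lt_succ_self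
  · refine lt_of_le_of_lt (degree_sum_le _ _) ((Finset.sup_lt_iff (by simp)).2 fun x hx => ?_)
    rw [degree_C_mul (hweight x hx).ne', Lagrange.degree_nodal, Finset.card_erase_of_mem hx, hcard]
    exact_mod_cast m.lt_succ_self
  · rw [eval_finsetSum, Finset.sum_eq_single_of_mem x hx]
    · rw [eval_mul, eval_C, ← eval_derivative_nodal_id hx, ← hp,
        div_mul_cancel₀ _ (right_ne_zero_of_mul (hres x hx).ne')]
    · intro y _ hyx
      have := Lagrange.eval_nodal_at_node (v := id) (Finset.mem_erase.2 ⟨hyx.symm, hx⟩)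
      rw [id_eq] at this
      rw [eval_mul, this, mul_zero]

lemma wronskian_pos (h : Interlaces m p c) (x : ℝ) :
    0 < (derivative p).eval x * c.eval x - p.eval x * (derivative c).eval x := by
  obtain ⟨s, w, hne, hw, hp, hc⟩ := h.partial_fractions
  have wronskian_eq_sum : (derivative p).eval x * c.eval x - p.eval x * (derivative c).eval x =
      ∑ y ∈ s, w y * ((Lagrange.nodal (s.erase y) id).eval x) ^ 2 := by
    rw [hc, derivative_sum, eval_finsetSum, eval_finsetSum, Finset.mul_sum, Finset.mul_sum,
      ← Finset.sum_sub_distrib]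
    refine Finset.sum_congr rfl fun y hy => ?_
    rw [hp, Lagrange.nodal_eq_mul_nodal_erase hy]
    simp only [id_eq, derivative_mul, derivative_sub, derivative_X, derivative_C, eval_add,
      eval_mul, eval_sub, eval_one, eval_zero, eval_X, eval_C]
    ring
  have exists_eval_ne_zero : ∃ y ∈ s, (Lagrange.nodal (s.erase y) id).eval x ≠ 0 := by
    by_cases hx : x ∈ s
    · exact ⟨x, hx, eval_nodal_id_ne_zero (Finset.notMem_erase x s)⟩
    · obtain ⟨y, hy⟩ := hne
      exact ⟨y, hy, eval_nodal_id_ne_zero fun hx' => hx (Finset.mem_of_mem_erase hx')⟩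
  obtain ⟨y, hy, hxy⟩ := exists_eval_ne_zero
  rw [wronskian_eq_sum]
  exact Finset.sum_pos' (fun y hy => mul_nonneg (hw y hy).le (sq_nonneg _))
    ⟨y, hy, mul_pos (hw y hy) (by positivity)⟩

/-- `p / c` is a Herglotz function: its imaginary part has the sign of that of its argument. -/
lemma im_mul_conj_pos (h : Interlaces m p c) {x : ℂ} (hx : x.im ≠ 0) :
    0 < (aeval x p * (starRingEnd ℂ) (aeval x c)).im * x.im := by
  obtain ⟨s, w, hne, hw, hp, hc⟩ := h.partial_fractions
  have mul_conj_eq_sum : aeval x p * (starRingEnd ℂ) (aeval x c) = ∑ y ∈ s,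
      (x - y) * ((w y * Complex.normSq (aeval x (Lagrange.nodal (s.erase y) id)) : ℝ) : ℂ) := by
    rw [hc, map_sum, map_sum, Finset.mul_sum]
    refine Finset.sum_congr rfl fun y hy => ?_
    rw [hp, Lagrange.nodal_eq_mul_nodal_erase hy, Complex.ofReal_mul, ← Complex.mul_conj]
    simp only [id_eq, map_mul, map_sub, aeval_X, aeval_C, Complex.coe_algebraMap,
      Complex.conj_ofReal]
    ring
  rw [mul_conj_eq_sum, Complex.im_sum, Finset.sum_mul]
  refine Finset.sum_pos (fun y hy => ?_) hne
  rw [Complex.im_mul_ofReal, Complex.sub_im, Complex.ofReal_im, sub_zero, mul_right_comm]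
  refine mul_pos (mul_self_pos.2 hx) (mul_pos (hw y hy) (Complex.normSq_pos.2 ?_))
  rw [Lagrange.nodal_eq, map_prod, Finset.prod_ne_zero_iff]
  intro z _ hz
  exact hx (by simpa using congrArg Complex.im hz)

lemma im_eq_zero_of_aeval_right_eq_zero (h : Interlaces m p c) {x : ℂ} (hx : aeval x c = 0) :
    x.im = 0 := by
  by_contra hne
  simpa [hx] using h.im_mul_conj_pos hne

end Interlaces

lemma interlaces_zero_iff {p c : ℝ[X]} :
    Interlaces 0 p c ↔ p.Monic ∧ p.natDegree = 1 ∧ c = 1 := by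
  constructor
  · exact fun h =>
      ⟨h.monic_left, h.natDegree_left, h.monic_right.natDegree_eq_zero.1 h.natDegree_right⟩
  · rintro ⟨hp, hdeg, rfl⟩
    have hp' : p = Lagrange.nodal {-p.coeff 0} id := by
      rw [Lagrange.nodal_eq, Finset.prod_singleton, id_eq, C_neg, sub_neg_eq_add]
      conv_lhs => rw [hp.as_sum, hdeg]
      simp
    refine ⟨hdeg, monic_one, natDegree_one, _, hp', fun x _ => ?_⟩
    rw [hp', Lagrange.nodal_eq, Finset.prod_singleton]
    simp

section EuclideanStep

variable {R : Type*} [CommRing R] {m : ℕ} {p c d : R[X]}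

lemma degree_C_mul_lt_degree_X_sub_C_mul [Nontrivial R] (hc : c.Monic) (hdeg : d.degree < c.degree)
    (b s : R) : (C s * d).degree < ((X - C b) * c).degree :=
  calc (C s * d).degree ≤ d.degree := by rw [← smul_eq_C_mul]; exact degree_smul_le s d
    _ < c.degree := hdeg
    _ ≤ ((X - C b) * c).degree := by
      rw [hc.degree_mul, degree_X_sub_C]
      exact le_add_of_nonneg_left zero_le_one

lemma natDegree_X_sub_C_mul_sub [Nontrivial R] (hc : c.Monic) (hdeg : d.degree < c.degree)
    (b s : R) : ((X - C b) * c - C s * d).natDegree = c.natDegree + 1 := by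
  rw [natDegree_eq_natDegree
    (degree_sub_eq_left_of_degree_lt (degree_C_mul_lt_degree_X_sub_C_mul hc hdeg b s)),
    (monic_X_sub_C b).natDegree_mul hc, natDegree_X_sub_C, add_comm]

lemma degree_X_sub_C_mul_sub_lt (hp : p.Monic) (hpd : p.natDegree = m + 2) (hc : c.Monic)
    (hcd : c.natDegree = m + 1) :
    ((X - C (c.coeff m - p.coeff (m + 1))) * c - p).degree < ((m + 1 : ℕ) : WithBot ℕ) := by
  have hcm : c.coeff (m + 1) = 1 := hcd ▸ hc.coeff_natDegree
  have hpm : p.coeff (m + 2) = 1 := hpd ▸ hp.coeff_natDegree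
  have hc_eq_zero : ∀ k, m + 2 ≤ k → c.coeff k = 0 := fun k hk =>
    coeff_eq_zero_of_natDegree_lt (hcd.trans_lt (by omega))
  rw [degree_lt_iff_coeff_zero]
  intro k hk
  obtain ⟨j, rfl⟩ : ∃ j, k = j + 1 := ⟨k - 1, by omega⟩
  rw [coeff_sub, sub_mul, coeff_sub, coeff_X_mul, coeff_C_mul]
  obtain rfl | rfl | hj : j = m ∨ j = m + 1 ∨ m + 2 ≤ j := by omega
  · rw [hcm]; ring
  · rw [hcm, hpm, hc_eq_zero _ le_rfl]; ring
  · have hpj : p.coeff (j + 1) = 0 := coeff_eq_zero_of_natDegree_lt (hpd.trans_lt (by omega))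
    rw [hc_eq_zero _ hj, hc_eq_zero _ (Nat.le_succ_of_le hj), hpj]
    ring

end EuclideanStep

lemma coeff_pos_of_eval_mul_derivative_nodal_pos {m : ℕ} {t : Finset ℝ} (ht : t.card = m + 1)
    {r : ℝ[X]} (hr : r.degree < (m + 1 : ℕ))
    (hpos : ∀ x ∈ t, 0 < r.eval x * (derivative (Lagrange.nodal t id)).eval x) :
    0 < r.coeff m := by
  have hcoeff := Lagrange.coeff_eq_sum (s := t) (v := (id : ℝ → ℝ)) (P := r)
    Function.injective_id.injOn (by rw [ht]; exact hr)
  rw [ht, Nat.add_sub_cancel] at hcoeff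
  rw [hcoeff]
  refine Finset.sum_pos (fun x hx => ?_) (Finset.card_pos.1 (by omega))
  rw [← Lagrange.eval_nodal (v := id) (x := id x), id_eq, ← eval_derivative_nodal_id hx]
  exact div_pos_iff.2 (mul_pos_iff.1 (hpos x hx))

namespace Interlaces

variable {m : ℕ} {p c d : ℝ[X]}

lemma mul_sub (h : Interlaces m c d) (b : ℝ) {s : ℝ} (hs : 0 < s) :
    Interlaces (m + 1) ((X - C b) * c - C s * d) c := by
  have hdeg : d.degree < c.degree := by
    rw [degree_eq_natDegree h.monic_left.ne_zero, degree_eq_natDegree h.monic_right.ne_zero,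
      h.natDegree_left, h.natDegree_right]
    exact_mod_cast m.lt_succ_self
  have hmonic : ((X - C b) * c - C s * d).Monic :=
    ((monic_X_sub_C b).mul h.monic_left).sub_of_left
      (degree_C_mul_lt_degree_X_sub_C_mul h.monic_left hdeg b s)
  have hnatDegree := natDegree_X_sub_C_mul_sub h.monic_left hdeg b s
  rw [h.natDegree_left] at hnatDegree
  refine .of_im_eq_zero_of_residue_pos hmonic hnatDegree h.monic_left h.natDegree_left
    (fun x hx => ?_) fun x hx => ?_
  · by_contra him
    have hkey : ((aeval x ((X - C b) * c - C s * d)) * (starRingEnd ℂ) (aeval x c)).im * x.im =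
        x.im * x.im * Complex.normSq (aeval x c) +
          s * ((aeval x c * (starRingEnd ℂ) (aeval x d)).im * x.im) := by
      simp [Complex.normSq_apply]
      ring
    rw [hx, zero_mul, Complex.zero_im, zero_mul] at hkey
    have := mul_nonneg (mul_self_nonneg x.im) (Complex.normSq_nonneg (aeval x c))
    linarith [mul_pos hs (h.im_mul_conj_pos him)]
  · have hkey : c.eval x * (derivative ((X - C b) * c - C s * d)).eval x =
        (c.eval x) ^ 2 + s * ((derivative c).eval x * d.eval x -
          c.eval x * (derivative d).eval x) +
        ((X - C b) * c - C s * d).eval x * (derivative c).eval x := by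
      simp [derivative_mul]
      ring
    rw [hkey, hx]
    linarith [mul_pos hs (h.wronskian_pos x), sq_nonneg (c.eval x)]

lemma euclid (h : Interlaces (m + 1) p c) :
    ∃ (b s : ℝ) (d : ℝ[X]), 0 < s ∧ p = (X - C b) * c - C s * d ∧ Interlaces m c d := by
  set b : ℝ := c.coeff m - p.coeff (m + 1)
  set r : ℝ[X] := (X - C b) * c - p with hr
  have hrdeg : r.degree < (m + 1 : ℕ) :=
    degree_X_sub_C_mul_sub_lt h.monic_left h.natDegree_left h.monic_right h.natDegree_right
  have hres : ∀ x : ℝ, c.eval x = 0 → 0 < r.eval x * (derivative c).eval x := by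
    intro x hx
    have := h.wronskian_pos x
    rw [hx, mul_zero, zero_sub] at this
    rwa [hr, eval_sub, eval_mul, hx, mul_zero, zero_sub, neg_mul]
  have hs : 0 < r.coeff m := by
    obtain ⟨t, rfl⟩ := MultPert.exists_eq_nodal h.monic_right
      (fun x => h.im_eq_zero_of_aeval_right_eq_zero)
      fun x hx => right_ne_zero_of_mul (hres x hx).ne'
    refine coeff_pos_of_eval_mul_derivative_nodal_pos ?_ hrdeg
      fun x hx => hres x (Lagrange.eval_nodal_at_node (v := id) hx)
    rw [← h.natDegree_right, Lagrange.natDegree_nodal]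
  have hrnd : r.natDegree = m := by
    have hr0 : r ≠ 0 := fun hr0 => hs.ne' (by rw [hr0, coeff_zero])
    have := (natDegree_lt_iff_degree_lt hr0).2 hrdeg
    exact le_antisymm (by omega) (le_natDegree_of_ne_zero hs.ne')
  refine ⟨b, r.coeff m, C (r.coeff m)⁻¹ * r, hs, ?_, ?_⟩
  · rw [← mul_assoc, ← C_mul, mul_inv_cancel₀ hs.ne', C_1, one_mul, hr]
    ring
  · refine .of_im_eq_zero_of_residue_pos h.monic_right h.natDegree_right
      (monic_C_mul_of_mul_leadingCoeff_eq_one ?_) ?_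
      (fun x => h.im_eq_zero_of_aeval_right_eq_zero) fun x hx => ?_
    · rw [leadingCoeff, hrnd, inv_mul_cancel₀ hs.ne']
    · rw [natDegree_C_mul (inv_ne_zero hs.ne'), hrnd]
    · rw [eval_mul, eval_C, mul_assoc]
      exact mul_pos (inv_pos.2 hs) (hres x hx)

end Interlaces

/-! ### Characteristic polynomials of Jacobi matrices -/

/-- The characteristic polynomials of a Jacobi matrix and of the matrix obtained by deleting its
first row and column, defined through the three-term recurrence. -/
def jacobiPolys : (m : ℕ) → (Fin m → ℝ) → (Fin (m + 1) → ℝ) → ℝ[X] × ℝ[X]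
  | 0, _, b => (X - C (b 0), 1)
  | m + 1, a, b =>
    ((X - C (b 0)) * (jacobiPolys m (Fin.tail a) (Fin.tail b)).1 -
      C (a 0 ^ 2) * (jacobiPolys m (Fin.tail a) (Fin.tail b)).2,
      (jacobiPolys m (Fin.tail a) (Fin.tail b)).1)

lemma monic_jacobiPolys (m : ℕ) (a : Fin m → ℝ) (b : Fin (m + 1) → ℝ) :
    ((jacobiPolys m a b).1.Monic ∧ (jacobiPolys m a b).1.natDegree = m + 1) ∧
      (jacobiPolys m a b).2.Monic ∧ (jacobiPolys m a b).2.natDegree = m := by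
  induction m with
  | zero => exact ⟨⟨monic_X_sub_C _, natDegree_X_sub_C _⟩, monic_one, natDegree_one⟩
  | succ m ih =>
    obtain ⟨⟨hc, hcd⟩, -, hdd⟩ := ih (Fin.tail a) (Fin.tail b)
    have hdeg : (jacobiPolys m (Fin.tail a) (Fin.tail b)).2.degree <
        (jacobiPolys m (Fin.tail a) (Fin.tail b)).1.degree :=
      degree_lt_degree (by omega)
    refine ⟨⟨((monic_X_sub_C _).mul hc).sub_of_left
      (degree_C_mul_lt_degree_X_sub_C_mul hc hdeg _ _), ?_⟩, hc, hcd⟩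
    rw [jacobiPolys, natDegree_X_sub_C_mul_sub hc hdeg, hcd]

lemma Interlaces.exists_jacobiPolys {m : ℕ} {p c : ℝ[X]} (h : Interlaces m p c) :
    ∃ (a : Fin m → ℝ) (b : Fin (m + 1) → ℝ), (∀ j, 0 < a j) ∧ jacobiPolys m a b = (p, c) := by
  induction m generalizing p c with
  | zero =>
    obtain ⟨hp, hdeg, rfl⟩ := interlaces_zero_iff.1 h
    refine ⟨Fin.elim0, fun _ => -p.coeff 0, fun j => j.elim0, Prod.ext ?_ rfl⟩
    conv_rhs => rw [hp.as_sum, hdeg]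
    simp [jacobiPolys]
  | succ m ih =>
    obtain ⟨b, s, d, hs, rfl, hcd⟩ := h.euclid
    obtain ⟨a', b', ha', hab⟩ := ih hcd
    refine ⟨Fin.cons (Real.sqrt s) a', Fin.cons b b',
      Fin.cases (Real.sqrt_pos.2 hs) ha', ?_⟩
    simp only [jacobiPolys, Fin.tail_cons, Fin.cons_zero, hab, Real.sq_sqrt hs.le]

lemma charmatrix_submatrix {R ι κ : Type*} [CommRing R] [Fintype ι] [DecidableEq ι] [Fintype κ]
    [DecidableEq κ] (M : Matrix ι ι R) {f : κ → ι} (hf : Function.Injective f) :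
    M.charmatrix.submatrix f f = (M.submatrix f f).charmatrix := by
  ext i j : 2
  simp only [Matrix.submatrix_apply, Matrix.charmatrix_apply, Matrix.diagonal_apply, hf.eq_iff]

lemma det_eq_of_tridiagonal_corner {R : Type*} [CommRing R] {m : ℕ}
    (M : Matrix (Fin (m + 2)) (Fin (m + 2)) R) (hrow : ∀ j : Fin m, M 0 j.succ.succ = 0)
    (hcol : ∀ j : Fin m, M j.succ.succ 0 = 0) :
    M.det = M 0 0 * (M.submatrix Fin.succ Fin.succ).det -
      M 0 1 * M 1 0 * ((M.submatrix Fin.succ Fin.succ).submatrix Fin.succ Fin.succ).det := by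
  have hcorner : (M.submatrix Fin.succ (Fin.succAbove 1)).det =
      M 1 0 * ((M.submatrix Fin.succ Fin.succ).submatrix Fin.succ Fin.succ).det := by
    have hminor : (M.submatrix Fin.succ (Fin.succAbove 1)).submatrix Fin.succ Fin.succ =
        (M.submatrix Fin.succ Fin.succ).submatrix Fin.succ Fin.succ := by
      ext i j
      simp only [Matrix.submatrix_apply]
      rw [← Fin.succ_zero_eq_one, Fin.succ_succAbove_succ, Fin.succAbove_zero]
    rw [Matrix.det_succ_column_zero, Fin.sum_univ_succ, Finset.sum_eq_zero]
    · rw [Fin.succAbove_zero, hminor]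
      simp
    · intro j _
      simp [hcol]
  rw [Matrix.det_succ_row_zero, Fin.sum_univ_succ, Fin.sum_univ_succ, Fin.succAbove_zero,
    Fin.succ_zero_eq_one, hcorner, Finset.sum_eq_zero fun j _ => by rw [hrow, mul_zero, zero_mul]]
  simp only [Fin.val_zero, Fin.val_one]
  ring

lemma submatrix_succ_jacobiMatrix {m : ℕ} (a : Fin (m + 1) → ℝ) (b : Fin (m + 2) → ℝ) :
    (jacobiMatrix (n := m + 2) a b).submatrix Fin.succ Fin.succ =
      jacobiMatrix (n := m + 1) (Fin.tail a) (Fin.tail b) := by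
  ext i j
  simp only [Matrix.submatrix_apply, jacobiMatrix, Matrix.of_apply, Fin.succ_inj, Fin.val_succ,
    add_left_inj]
  rfl

lemma charpoly_jacobiMatrix (m : ℕ) (a : Fin m → ℝ) (b : Fin (m + 1) → ℝ) :
    (jacobiMatrix (n := m + 1) a b).charpoly = (jacobiPolys m a b).1 ∧
      ((jacobiMatrix (n := m + 1) a b).submatrix Fin.succ Fin.succ).charpoly =
        (jacobiPolys m a b).2 := by
  induction m with
  | zero => exact ⟨by simp [jacobiPolys, Matrix.charpoly, jacobiMatrix], Matrix.charpoly_isEmpty⟩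
  | succ m ih =>
    obtain ⟨ihp, ihc⟩ := ih (Fin.tail a) (Fin.tail b)
    have hp := det_eq_of_tridiagonal_corner (jacobiMatrix (n := m + 2) a b).charmatrix
      (fun j => by simp [jacobiMatrix, Fin.ext_iff]) (fun j => by simp [jacobiMatrix, Fin.ext_iff])
    simp only [charmatrix_submatrix _ (Fin.succ_injective _), submatrix_succ_jacobiMatrix,
      ← Matrix.charpoly.eq_1, ihp, ihc] at hp
    refine ⟨hp.trans ?_, by rw [submatrix_succ_jacobiMatrix, ihp]; rfl⟩
    simp [jacobiPolys, jacobiMatrix, sq]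

lemma multPerturbation_apply {n : ℕ} [NeZero n] (J : Matrix (Fin n) (Fin n) ℝ) (l : ℝ)
    (i j : Fin n) :
    multPerturbation J l i j = (if i = 0 then 1 + Complex.I * (l : ℂ) else 1) * (J i j : ℂ) := by
  rw [multPerturbation, Matrix.add_mul, Matrix.one_mul, Matrix.smul_mul, Matrix.add_apply,
    Matrix.smul_apply, smul_eq_mul]
  split_ifs with hi
  · subst hi
    rw [Matrix.single_mul_apply_same, Matrix.map_apply]
    ring
  · rw [Matrix.single_mul_apply_of_ne _ _ _ _ _ hi, Matrix.map_apply]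
    ring

lemma charpoly_multPerturbation {m : ℕ} (J : Matrix (Fin (m + 1)) (Fin (m + 1)) ℝ) (l : ℝ) :
    (multPerturbation J l).charpoly =
      C (1 + Complex.I * (l : ℂ)) * J.charpoly.map (algebraMap ℝ ℂ) -
        C (Complex.I * (l : ℂ)) * X *
          (J.submatrix Fin.succ Fin.succ).charpoly.map (algebraMap ℝ ℂ) := by
  set A : Matrix (Fin (m + 1)) (Fin (m + 1)) ℂ := J.map (algebraMap ℝ ℂ) with hA
  have hrow : (multPerturbation J l).charmatrix = A.charmatrix.updateRow 0
      (C (1 + Complex.I * (l : ℂ)) • A.charmatrix 0 +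
        (-(C (Complex.I * (l : ℂ)) * X)) • Pi.single 0 1) := by
    refine Matrix.ext fun i j => ?_
    rw [Matrix.charmatrix_apply, multPerturbation_apply]
    obtain rfl | ⟨i, rfl⟩ := Fin.eq_zero_or_eq_succ i
    · obtain rfl | ⟨j, rfl⟩ := Fin.eq_zero_or_eq_succ j
      · simp [hA]
        ring
      · simp [hA, (Fin.succ_ne_zero j).symm]
    · simp [hA, Matrix.charmatrix_apply, Fin.succ_ne_zero]
  have hminor : (A.charmatrix.updateRow 0 (Pi.single 0 1)).det =
      (A.submatrix Fin.succ Fin.succ).charpoly := by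
    rw [← Matrix.adjugate_apply, Matrix.adjugate_fin_succ_eq_det_submatrix]
    simp [charmatrix_submatrix _ (Fin.succ_injective _), Matrix.charpoly]
  rw [← Matrix.charpoly_map, ← Matrix.charpoly_map, ← Matrix.submatrix_map, ← hA, Matrix.charpoly,
    hrow, Matrix.det_updateRow_add, Matrix.det_updateRow_smul, Matrix.det_updateRow_smul,
    Matrix.updateRow_eq_self, hminor, Matrix.charpoly.eq_1 A]
  ring

/-! ### Second coefficients -/

section RootSquareSum

variable {R : Type*} [CommRing R] {n : ℕ} {p c d : R[X]}

/-- The sum of the squares of the roots of a monic polynomial of degree `n`, in terms of its two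
highest nontrivial coefficients. The factor `X ^ 2` avoids truncated subtraction in the indices
`n - 1` and `n - 2`. -/
def rootSquareSum (n : ℕ) (p : R[X]) : R :=
  (X ^ 2 * p).coeff (n + 1) ^ 2 - 2 * (X ^ 2 * p).coeff n

lemma coeff_X_sq_mul_of_monic (hp : p.Monic) (hn : p.natDegree = n) :
    (X ^ 2 * p).coeff (n + 2) = 1 := by
  rw [coeff_X_pow_mul, ← hn]
  exact hp

lemma coeff_X_sq_mul_X_sub_C_mul (hc : c.Monic) (hn : c.natDegree = n) (b : R) :
    (X ^ 2 * ((X - C b) * c)).coeff (n + 2) = (X ^ 2 * c).coeff (n + 1) - b := by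
  rw [show X ^ 2 * ((X - C b) * c) = X * (X ^ 2 * c) - C b * (X ^ 2 * c) by ring, coeff_sub,
    coeff_X_mul, coeff_C_mul, coeff_X_sq_mul_of_monic hc hn, mul_one]

lemma rootSquareSum_X_sub_C_mul (hc : c.Monic) (hn : c.natDegree = n) (b : R) :
    rootSquareSum (n + 1) ((X - C b) * c) = rootSquareSum n c + b ^ 2 := by
  have hcoeff : (X ^ 2 * ((X - C b) * c)).coeff (n + 1) =
      (X ^ 2 * c).coeff n - b * (X ^ 2 * c).coeff (n + 1) := by
    rw [show X ^ 2 * ((X - C b) * c) = X * (X ^ 2 * c) - C b * (X ^ 2 * c) by ring, coeff_sub,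
      coeff_X_mul, coeff_C_mul]
  rw [rootSquareSum, rootSquareSum, coeff_X_sq_mul_X_sub_C_mul hc hn, hcoeff]
  ring

lemma rootSquareSum_sub_C_mul (hd : d.Monic) (hn : d.natDegree = n) (s : R) :
    rootSquareSum (n + 2) (p - C s * d) = rootSquareSum (n + 2) p + 2 * s := by
  have htop : (X ^ 2 * d).coeff (n + 3) = 0 := by
    rw [coeff_X_pow_mul, coeff_eq_zero_of_natDegree_lt (by omega)]
  rw [rootSquareSum, rootSquareSum, mul_sub, mul_left_comm, coeff_sub, coeff_sub, coeff_C_mul,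
    coeff_C_mul, coeff_X_sq_mul_of_monic hd hn, htop]
  ring

lemma rootSquareSum_one : rootSquareSum 0 (1 : R[X]) = 0 := by
  simp [rootSquareSum, coeff_X_pow]

lemma coeff_X_sq_mul_prod_X_sub_C [Nontrivial R] {ι : Type*} (s : Finset ι) (z : ι → R) :
    (X ^ 2 * ∏ j ∈ s, (X - C (z j))).coeff (s.card + 1) = -∑ j ∈ s, z j := by
  induction s using Finset.cons_induction with
  | empty => simp [coeff_X_pow]
  | cons i s hi ih =>
    rw [Finset.prod_cons, Finset.card_cons, Finset.sum_cons, coeff_X_sq_mul_X_sub_C_mul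
      (monic_prod_X_sub_C _ _) (natDegree_finsetProd_X_sub_C_eq_card s z), ih]
    ring

lemma rootSquareSum_prod_X_sub_C [Nontrivial R] {ι : Type*} (s : Finset ι) (z : ι → R) :
    rootSquareSum s.card (∏ j ∈ s, (X - C (z j))) = ∑ j ∈ s, z j ^ 2 := by
  induction s using Finset.cons_induction with
  | empty => simp [rootSquareSum_one]
  | cons i s hi ih =>
    rw [Finset.prod_cons, Finset.card_cons, Finset.sum_cons, rootSquareSum_X_sub_C_mul
      (monic_prod_X_sub_C _ _) (natDegree_finsetProd_X_sub_C_eq_card s z), ih, add_comm]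

lemma rootSquareSum_jacobiPolys (m : ℕ) (a : Fin m → ℝ) (b : Fin (m + 1) → ℝ) :
    rootSquareSum (m + 1) (jacobiPolys m a b).1 = 2 * ∑ j, a j ^ 2 + ∑ j, b j ^ 2 := by
  induction m with
  | zero =>
    simpa [jacobiPolys, rootSquareSum_one] using
      rootSquareSum_X_sub_C_mul (n := 0) (monic_one (R := ℝ)) natDegree_one (b 0)
  | succ m ih =>
    obtain ⟨⟨hc, hcd⟩, hd, hdd⟩ := monic_jacobiPolys m (Fin.tail a) (Fin.tail b)
    rw [jacobiPolys, rootSquareSum_sub_C_mul hd hdd, rootSquareSum_X_sub_C_mul hc hcd, ih,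
      Fin.sum_univ_succ fun j => a j ^ 2, Fin.sum_univ_succ fun j => b j ^ 2]
    simp only [Fin.tail]
    ring

end RootSquareSum

/-! ### The phase of a complex polynomial along the real line -/

lemma argModPi_eq {z : ℂ} (hz : z.im ≠ 0) :
    argModPi z = Real.pi / 2 - Real.arctan (z.re / z.im) := by
  have htan : Real.tan (Real.pi / 2 - z.arg) = z.re / z.im := by
    rw [Real.tan_pi_div_two_sub, Complex.tan_arg, inv_div]
  rcases lt_or_gt_of_ne hz with him | him
  · have harg : z.arg < 0 := Complex.arg_neg_iff.2 him
    have harg' := Complex.neg_pi_lt_arg z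
    rw [Real.arctan_eq_of_tan_eq (x := Real.pi / 2 - z.arg - Real.pi)
      (by rw [Real.tan_sub_pi, htan]) ⟨by linarith, by linarith⟩, argModPi,
      if_neg him.not_gt, if_neg hz]
    ring
  · have harg : 0 < z.arg := (Complex.arg_nonneg_iff.2 him.le).lt_of_ne' fun h =>
      hz (Complex.arg_eq_zero_iff.1 h).2
    have harg' : z.arg < Real.pi := Complex.arg_lt_pi_iff.2 (Or.inr hz)
    rw [Real.arctan_eq_of_tan_eq htan ⟨by linarith, by linarith⟩, argModPi, if_pos him]
    ring

lemma argModPi_pos {z : ℂ} (hz : z.im ≠ 0) : 0 < argModPi z := by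
  rw [argModPi_eq hz]
  linarith [Real.arctan_lt_pi_div_two (z.re / z.im)]

lemma argModPi_neg {z : ℂ} (hz : z.im ≠ 0) : argModPi (-z) = argModPi z := by
  rw [argModPi_eq hz, argModPi_eq (by simpa using hz), Complex.neg_re, Complex.neg_im,
    neg_div_neg_eq]

lemma exists_eq_mul_exp_argModPi {z : ℂ} (hz : z.im ≠ 0) :
    ∃ r : ℝ, r ≠ 0 ∧ z = r * Complex.exp (argModPi z * Complex.I) := by
  have hnorm : ‖z‖ ≠ 0 := norm_ne_zero_iff.2 fun h => hz (by rw [h, Complex.zero_im])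
  rcases lt_or_gt_of_ne hz with him | him
  · refine ⟨-‖z‖, neg_ne_zero.2 hnorm, ?_⟩
    rw [argModPi, if_neg him.not_gt, if_neg hz, Complex.ofReal_add, add_mul, Complex.exp_add,
      Complex.exp_pi_mul_I, neg_one_mul, Complex.ofReal_neg, neg_mul_neg,
      Complex.norm_mul_exp_arg_mul_I]
  · refine ⟨‖z‖, hnorm, ?_⟩
    rw [argModPi, if_pos him, Complex.norm_mul_exp_arg_mul_I]

section Phase

variable {n : ℕ} {z : Fin n → ℂ}

lemma exists_prod_eq_mul_exp_argSum (hz : ∀ j, (z j).im ≠ 0) :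
    ∃ r : ℝ, r ≠ 0 ∧ ∏ j, z j = r * Complex.exp (argSum z * Complex.I) := by
  choose r hr hrz using fun j => exists_eq_mul_exp_argModPi (hz j)
  refine ⟨∏ j, r j, Finset.prod_ne_zero_iff.2 fun j _ => hr j, ?_⟩
  rw [argSum, Complex.ofReal_sum, Finset.sum_mul, Complex.exp_sum, Complex.ofReal_prod,
    ← Finset.prod_mul_distrib]
  exact Finset.prod_congr rfl fun j _ => hrz j

lemma argSum_pos [NeZero n] (hz : ∀ j, (z j).im ≠ 0) : 0 < argSum z :=
  Finset.sum_pos (fun j _ => argModPi_pos (hz j)) Finset.univ_nonempty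

lemma argSum_neg (hz : ∀ j, (z j).im ≠ 0) : argSum (-z) = argSum z :=
  Finset.sum_congr rfl fun j _ => argModPi_neg (hz j)

/-- The sum of the arguments modulo `π` of the points `z j`, seen from the real point `x`. -/
def phase (z : Fin n → ℂ) (x : ℝ) : ℝ := argSum fun j => z j - x

/-- The derivative of `phase`. -/
def phaseDeriv (z : Fin n → ℂ) (x : ℝ) : ℝ := ∑ j, (z j).im / ‖z j - x‖ ^ 2

/-- The number of points in the upper half-plane. -/
def upperCard (z : Fin n → ℂ) : ℕ := (Finset.univ.filter fun j => 0 < (z j).im).card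

lemma phase_zero (z : Fin n → ℂ) : phase z 0 = argSum z := by
  simp [phase]

lemma phase_neg (hz : ∀ j, (z j).im ≠ 0) (x : ℝ) : phase (-z) x = phase z (-x) := by
  have hfun : (fun j => (-z) j - x) = -fun j => z j - (-x : ℝ) := by
    ext1 j
    rw [Pi.neg_apply, Pi.neg_apply, Complex.ofReal_neg]
    ring
  rw [phase, hfun, argSum_neg (by simpa using hz), phase]

lemma phase_pos [NeZero n] (hz : ∀ j, (z j).im ≠ 0) (x : ℝ) : 0 < phase z x :=
  argSum_pos (by simpa using hz)

lemma phaseDeriv_neg (z : Fin n → ℂ) (x : ℝ) : phaseDeriv (-z) x = -phaseDeriv z (-x) := by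
  rw [phaseDeriv, phaseDeriv, ← Finset.sum_neg_distrib]
  refine Finset.sum_congr rfl fun j _ => ?_
  rw [Pi.neg_apply, Complex.neg_im, neg_div, ← norm_neg, neg_sub, sub_neg_eq_add, add_comm,
    Complex.ofReal_neg, sub_neg_eq_add]

lemma upperCard_add_upperCard_neg (hz : ∀ j, (z j).im ≠ 0) :
    upperCard z + upperCard (-z) = n := by
  have hneg : upperCard (-z) = (Finset.univ.filter fun j => ¬ 0 < (z j).im).card := by
    rw [upperCard]
    congr 2
    ext j
    rw [Pi.neg_apply, Complex.neg_im, neg_pos, not_lt, le_iff_lt_or_eq, or_iff_left (hz j)]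
  rw [hneg, upperCard, Finset.card_filter_add_card_filter_not, Finset.card_univ, Fintype.card_fin]

lemma phase_eq (hz : ∀ j, (z j).im ≠ 0) :
    phase z = fun x => ∑ j, (Real.pi / 2 - Real.arctan (((z j).re - x) / (z j).im)) := by
  ext x
  rw [phase, argSum]
  refine Finset.sum_congr rfl fun j _ => ?_
  rw [argModPi_eq (by simpa using hz j)]
  simp

lemma hasDerivAt_phase (hz : ∀ j, (z j).im ≠ 0) (x : ℝ) :
    HasDerivAt (phase z) (phaseDeriv z x) x := by
  rw [phase_eq hz, phaseDeriv]
  refine HasDerivAt.fun_sum fun j _ => ?_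
  have hj := hz j
  have hdiv : HasDerivAt (fun x : ℝ => ((z j).re - x) / (z j).im) (-1 / (z j).im) x :=
    ((hasDerivAt_id x).const_sub _).div_const _
  convert! hdiv.arctan.const_sub (Real.pi / 2) using 1
  have hnorm : ‖z j - x‖ ^ 2 = ((z j).re - x) ^ 2 + (z j).im ^ 2 := by
    rw [← Complex.normSq_eq_norm_sq, Complex.normSq_apply]
    simp [sq]
  have hone : 1 + (((z j).re - x) / (z j).im) ^ 2 =
      (((z j).re - x) ^ 2 + (z j).im ^ 2) / (z j).im ^ 2 := by
    rw [div_pow, one_add_div (pow_ne_zero 2 hj), add_comm]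
  rw [hnorm, hone]
  field_simp

lemma continuous_phase (hz : ∀ j, (z j).im ≠ 0) : Continuous (phase z) :=
  continuous_iff_continuousAt.2 fun x => (hasDerivAt_phase hz x).continuousAt

lemma tendsto_phase_atTop (hz : ∀ j, (z j).im ≠ 0) :
    Filter.Tendsto (phase z) Filter.atTop (nhds (upperCard z * Real.pi)) := by
  have hlim : (upperCard z : ℝ) * Real.pi =
      ∑ j, (Real.pi / 2 - if 0 < (z j).im then -(Real.pi / 2) else Real.pi / 2) := by
    rw [upperCard, Finset.card_filter, Nat.cast_sum, Finset.sum_mul]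
    refine Finset.sum_congr rfl fun j _ => ?_
    split_ifs <;> simp
  rw [phase_eq hz, hlim]
  refine tendsto_finsetSum _ fun j _ => Filter.Tendsto.const_sub _ ?_
  have hnum : Filter.Tendsto (fun x : ℝ => (z j).re - x) Filter.atTop Filter.atBot :=
    Filter.tendsto_atBot_add_const_left _ _ Filter.tendsto_neg_atTop_atBot
  split_ifs with him
  · exact (Real.tendsto_arctan_atBot.mono_right nhdsWithin_le_nhds).comp (hnum.atBot_div_const him)
  · refine (Real.tendsto_arctan_atTop.mono_right nhdsWithin_le_nhds).comp ?_
    simp only [div_eq_mul_inv]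
    exact hnum.atBot_mul_const_of_neg (inv_lt_zero.2 ((not_lt.1 him).lt_of_ne (hz j)))

end Phase

lemma eventually_lt_of_hasDerivAt_pos {f : ℝ → ℝ} {f' x : ℝ} (h : HasDerivAt f f' x)
    (hf : 0 < f') : ∀ᶠ y in nhdsWithin x (Set.Iio x), f y < f x := by
  have hslope : ∀ᶠ y in nhdsWithin x (Set.Iio x), 0 < slope f x y :=
    ((hasDerivAt_iff_tendsto_slope.1 h).eventually (lt_mem_nhds hf)).filter_mono
      (nhdsWithin_mono _ fun y hy => ne_of_lt hy)
  filter_upwards [hslope, self_mem_nhdsWithin] with y hy hyx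
  rw [slope_def_field] at hy
  by_contra! hle
  exact hy.not_ge (div_nonpos_of_nonneg_of_nonpos (sub_nonneg.2 hle) (sub_nonpos.2 hyx.le))

lemma lt_of_upcrossing {f f' : ℝ → ℝ} (hf : ∀ x, HasDerivAt f (f' x) x) {a v : ℝ} (ha : v ≤ f a)
    (h : ∀ x, a ≤ x → f x = v → 0 < f' x) {x : ℝ} (hx : a < x) : v < f x := by
  have hle : ∀ y, a ≤ y → v ≤ f y := fun y hy =>
    image_le_of_deriv_right_lt_deriv_boundary' (f := fun _ => v) (f' := fun _ => 0)
      (B := f) (B' := f') continuousOn_const (fun _ _ => hasDerivWithinAt_const _ _ _) ha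
      (fun t _ => (hf t).continuousAt.continuousWithinAt)
      (fun t _ => (hf t).hasDerivWithinAt) (fun t ht htv => h t ht.1 htv.symm)
      (Set.right_mem_Icc.2 hy)
  refine lt_of_le_of_ne (hle x hx.le) fun hv => ?_
  obtain ⟨y, hyx, hy⟩ := ((eventually_lt_of_hasDerivAt_pos (hf x) (h x hx.le hv.symm)).and
    (Ioo_mem_nhdsLT hx)).exists
  linarith [hle y hy.1.le]

section LevelCrossings

variable {n : ℕ} {z : Fin n → ℂ}

/- On `(0, ∞)` each level `(2 i + 1) π / 2` is crossed at most once, and only levels between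
`phase z 0` and the limit `upperCard z * π` are crossed. -/
lemma card_le_of_upcrossing_pos (hz : ∀ j, (z j).im ≠ 0) (hsum : Real.pi / 2 < argSum z)
    (hup : ∀ x, 0 < x → Real.cos (phase z x) = 0 → 0 < phaseDeriv z x)
    {s : Finset ℝ} (hs : ∀ x ∈ s, 0 < x ∧ Real.cos (phase z x) = 0) :
    s.card ≤ upperCard z - 1 := by
  have hpi := Real.pi_pos
  have hlevel : ∀ x ∈ s, ∃ i : ℤ, phase z x = (2 * i + 1) * Real.pi / 2 :=
    fun x hx => Real.cos_eq_zero_iff.1 (hs x hx).2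
  choose! i hi using hlevel
  have hcross : ∀ x ∈ s, ∀ y, x < y → phase z x < phase z y := fun x hx y hxy =>
    lt_of_upcrossing (hasDerivAt_phase hz) le_rfl
      (fun t ht htx => hup t ((hs x hx).1.trans_le ht) (by rw [htx, (hs x hx).2])) hxy
  have hlower : ∀ x ∈ s, 1 ≤ i x := by
    intro x hx
    have hgt : Real.pi / 2 < phase z x :=
      lt_of_upcrossing (hasDerivAt_phase hz) (a := 0) (by rw [phase_zero]; exact hsum.le)
        (fun t ht htv => hup t (ht.lt_of_ne fun h0 => hsum.ne' (by rw [← phase_zero, h0, htv]))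
          (by rw [htv, Real.cos_pi_div_two])) (hs x hx).1
    rw [hi x hx] at hgt
    have : (0 : ℝ) < i x := by nlinarith
    exact_mod_cast this
  have hupper : ∀ x ∈ s, i x < upperCard z := by
    intro x hx
    have hle := ge_of_tendsto (tendsto_phase_atTop hz)
      ((Filter.eventually_gt_atTop x).mono fun y hxy => (hcross x hx y hxy).le)
    rw [hi x hx] at hle
    have : (i x : ℝ) < upperCard z := by nlinarith
    exact_mod_cast this
  have hcard := Finset.card_le_card_of_injOn (t := Finset.Ico 1 (upperCard z : ℤ)) i
    (fun x hx => Finset.mem_coe.2 (Finset.mem_Ico.2 ⟨hlower x hx, hupper x hx⟩)) ?_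
  · rw [Int.card_Ico] at hcard
    omega
  · intro x hx y hy hxy
    have heq : phase z x = phase z y := by rw [hi x hx, hi y hy, hxy]
    rcases lt_trichotomy x y with hlt | rfl | hlt
    · exact absurd heq (hcross x hx y hlt).ne
    · rfl
    · exact absurd heq (hcross y hy x hlt).ne'

lemma card_lt_of_upcrossing [NeZero n] (hz : ∀ j, (z j).im ≠ 0) (hsum : Real.pi / 2 < argSum z)
    (hup : ∀ x, x ≠ 0 → Real.cos (phase z x) = 0 → 0 < phaseDeriv z x * x)
    {s : Finset ℝ} (hs : ∀ x ∈ s, x ≠ 0 ∧ Real.cos (phase z x) = 0) : s.card < n := by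
  have hpos : (s.filter fun x => 0 < x).card ≤ upperCard z - 1 :=
    card_le_of_upcrossing_pos hz hsum
      (fun x hx hcos => (pos_iff_pos_of_mul_pos (hup x hx.ne' hcos)).2 hx)
      fun x hx => ⟨(Finset.mem_filter.1 hx).2, (hs x (Finset.mem_filter.1 hx).1).2⟩
  have hneg : ((s.filter fun x => ¬ 0 < x).image Neg.neg).card ≤ upperCard (-z) - 1 := by
    refine card_le_of_upcrossing_pos (by simpa using hz) (by rwa [argSum_neg hz]) ?_ ?_
    · intro x hx hcos
      rw [phase_neg hz] at hcos
      have hmul := hup (-x) (neg_ne_zero.2 hx.ne') hcos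
      rw [mul_neg, ← neg_mul, ← phaseDeriv_neg] at hmul
      exact (pos_iff_pos_of_mul_pos hmul).2 hx
    · intro x hx
      obtain ⟨y, hy, rfl⟩ := Finset.mem_image.1 hx
      obtain ⟨hys, hy0⟩ := Finset.mem_filter.1 hy
      rw [phase_neg hz, neg_neg]
      exact ⟨neg_pos.2 ((not_lt.1 hy0).lt_of_ne (hs y hys).1), (hs y hys).2⟩
  rw [Finset.card_image_of_injective _ neg_injective] at hneg
  have hsplit := Finset.card_filter_add_card_filter_not (s := s) fun x => 0 < x
  have hn := upperCard_add_upperCard_neg hz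
  have := NeZero.pos n
  omega

lemma exists_phase_eq (hz : ∀ j, (z j).im ≠ 0) (hsum : argSum z < Real.pi / 2) {k : ℕ}
    (hk : k < upperCard z) : ∃ x, 0 < x ∧ phase z x = (2 * k + 1) * Real.pi / 2 := by
  have hpi := Real.pi_pos
  have hk' : (k : ℝ) + 1 ≤ upperCard z := by exact_mod_cast hk
  have hlim : (2 * k + 1) * Real.pi / 2 < upperCard z * Real.pi := by nlinarith
  have hzero : phase z 0 < (2 * k + 1) * Real.pi / 2 := by
    rw [phase_zero]
    nlinarith [(Nat.cast_nonneg k : (0 : ℝ) ≤ k)]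
  obtain ⟨y, hy, hy0⟩ := (((tendsto_phase_atTop hz).eventually (lt_mem_nhds hlim)).and
    (Filter.eventually_gt_atTop 0)).exists
  obtain ⟨x, hx, hxv⟩ := intermediate_value_Ioo hy0.le (continuous_phase hz).continuousOn
    ⟨hzero, hy⟩
  exact ⟨x, hx.1, hxv⟩

lemma exists_finset_pos_cos_phase_eq_zero (hz : ∀ j, (z j).im ≠ 0)
    (hsum : argSum z < Real.pi / 2) : ∃ s : Finset ℝ, s.card = upperCard z ∧
      (∀ x ∈ s, 0 < x ∧ Real.cos (phase z x) = 0) ∧ Set.InjOn (phase z) s := by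
  choose x hx0 hx using fun k : Fin (upperCard z) => exists_phase_eq hz hsum k.2
  have hinj : Function.Injective fun k => phase z (x k) := by
    intro k k' hkk
    simp only [hx] at hkk
    have : ((k : ℕ) : ℝ) = (k' : ℕ) := by nlinarith [Real.pi_pos]
    exact Fin.ext (by exact_mod_cast this)
  refine ⟨Finset.univ.image x, ?_, ?_, ?_⟩
  · rw [Finset.card_image_of_injective _ (Function.Injective.of_comp (f := phase z) hinj),
      Finset.card_univ, Fintype.card_fin]
  · refine Finset.forall_mem_image.2 fun k _ => ⟨hx0 k, ?_⟩
    rw [hx]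
    exact Real.cos_eq_zero_iff.2 ⟨k, by push_cast; rfl⟩
  · rw [Finset.coe_image]
    rintro _ ⟨k, -, rfl⟩ _ ⟨k', -, rfl⟩ h
    rw [hinj h]

lemma exists_finset_cos_phase_eq_zero (hz : ∀ j, (z j).im ≠ 0) (hsum : argSum z < Real.pi / 2) :
    ∃ s : Finset ℝ, s.card = n ∧ (∀ x ∈ s, x ≠ 0 ∧ Real.cos (phase z x) = 0) ∧
      ∀ x ∈ s, ∀ y ∈ s, 0 < x * y → phase z x = phase z y → x = y := by
  obtain ⟨s, hscard, hs, hsinj⟩ := exists_finset_pos_cos_phase_eq_zero hz hsum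
  obtain ⟨t, htcard, ht, htinj⟩ := exists_finset_pos_cos_phase_eq_zero (z := -z) (by simpa using hz)
    (by rwa [argSum_neg hz])
  simp only [phase_neg hz] at ht
  refine ⟨s ∪ t.image Neg.neg, ?_, ?_, ?_⟩
  · rw [Finset.card_union_of_disjoint, Finset.card_image_of_injective _ neg_injective, hscard,
      htcard, upperCard_add_upperCard_neg hz]
    refine Finset.disjoint_left.2 fun x hxs hxt => ?_
    obtain ⟨y, hy, rfl⟩ := Finset.mem_image.1 hxt
    linarith [(hs _ hxs).1, (ht y hy).1]
  · refine Finset.forall_mem_union.2 ⟨fun x hx => ⟨(hs x hx).1.ne', (hs x hx).2⟩,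
      Finset.forall_mem_image.2 fun x hx => ⟨neg_ne_zero.2 (ht x hx).1.ne', (ht x hx).2⟩⟩
  · refine Finset.forall_mem_union.2 ⟨fun x hx => Finset.forall_mem_union.2 ⟨fun y hy _ hxy =>
      hsinj hx hy hxy, Finset.forall_mem_image.2 fun y hy hxy => ?_⟩,
      Finset.forall_mem_image.2 fun x hx => Finset.forall_mem_union.2 ⟨fun y hy hxy => ?_,
        Finset.forall_mem_image.2 fun y hy _ hxy => ?_⟩⟩
    · nlinarith [(hs x hx).1, (ht y hy).1]
    · nlinarith [(hs y hy).1, (ht x hx).1]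
    · rw [htinj hx hy (by rw [phase_neg hz, phase_neg hz, hxy])]

lemma phaseDeriv_nonneg_of_pos [NeZero n] (hz : ∀ j, (z j).im ≠ 0) (hsum : argSum z < Real.pi / 2)
    {x : ℝ} (hx : 0 < x) (hcos : Real.cos (phase z x) = 0)
    (huniq : ∀ y, 0 < y → phase z y = phase z x → y = x) : 0 ≤ phaseDeriv z x := by
  have hzero : phase z 0 < phase z x := by
    have hpos := phase_pos hz x
    rw [phase_zero]
    by_contra! hle
    exact (Real.cos_pos_of_mem_Ioo ⟨by linarith, hle.trans_lt hsum⟩).ne' hcos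
  by_contra! hneg
  obtain ⟨y, hy, hy0, hyx⟩ := ((eventually_lt_of_hasDerivAt_pos (hasDerivAt_phase hz x).neg
    (neg_pos.2 hneg)).and (Ioo_mem_nhdsLT hx)).exists
  obtain ⟨t, ht, htx⟩ := intermediate_value_Ioo hy0.le (continuous_phase hz).continuousOn
    ⟨hzero, neg_lt_neg_iff.1 hy⟩
  linarith [huniq t ht.1 htx, ht.2]

lemma phaseDeriv_mul_nonneg [NeZero n] (hz : ∀ j, (z j).im ≠ 0) (hsum : argSum z < Real.pi / 2)
    {x : ℝ} (hx : x ≠ 0) (hcos : Real.cos (phase z x) = 0)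
    (huniq : ∀ y, 0 < x * y → phase z x = phase z y → x = y) : 0 ≤ phaseDeriv z x * x := by
  rcases lt_or_gt_of_ne hx with hneg | hpos
  · have := phaseDeriv_nonneg_of_pos (z := -z) (x := -x) (by simpa using hz)
      (by rwa [argSum_neg hz]) (neg_pos.2 hneg) (by rwa [phase_neg hz, neg_neg])
      fun y hy hyx => by
        rw [phase_neg hz, phase_neg hz, neg_neg] at hyx
        rw [huniq (-y) (mul_pos_of_neg_of_neg hneg (neg_neg_of_pos hy)) hyx.symm, neg_neg]
    rw [phaseDeriv_neg, neg_neg, neg_nonneg] at this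
    exact mul_nonneg_of_nonpos_of_nonpos this hneg.le
  · exact mul_nonneg (phaseDeriv_nonneg_of_pos hz hsum hpos hcos fun y hy hyx =>
      (huniq y (mul_pos hpos hy) hyx.symm).symm) hpos.le

end LevelCrossings

/-! ### Eigenvalues of the perturbation and interlacing -/

lemma eval_map_algebraMap_ofReal (p : ℝ[X]) (x : ℝ) :
    (p.map (algebraMap ℝ ℂ)).eval (x : ℂ) = (p.eval x : ℝ) := by
  rw [eval_map_algebraMap, ← Complex.coe_algebraMap, aeval_algebraMap_apply, coe_aeval_eq_eval]

section RealAndImaginaryParts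

variable {n : ℕ} {z : Fin n → ℂ} {p h : ℝ[X]}
  (hχ : ∏ j, (X - C (z j)) = p.map (algebraMap ℝ ℂ) + C Complex.I * h.map (algebraMap ℝ ℂ))

include hχ

lemma prod_sub_eq (x : ℝ) :
    ∏ j, (x - z j) = ((p.eval x : ℝ) : ℂ) + Complex.I * ((h.eval x : ℝ) : ℂ) := by
  have := congrArg (eval (x : ℂ)) hχ
  rw [eval_prod, eval_add, eval_mul, eval_map_algebraMap_ofReal, eval_map_algebraMap_ofReal] at this
  simpa using this

lemma exists_polar (hz : ∀ j, (z j).im ≠ 0) (x : ℝ) :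
    ∃ r : ℝ, r ≠ 0 ∧ p.eval x = r * Real.cos (phase z x) ∧ h.eval x = r * Real.sin (phase z x) := by
  have hzx : ∀ j, (z j - x).im ≠ 0 := by simpa using hz
  obtain ⟨r, hr, hrz⟩ := exists_prod_eq_mul_exp_argSum (z := -fun j => z j - x) (by simpa using hz)
  have hpolar : ((p.eval x : ℝ) : ℂ) + Complex.I * ((h.eval x : ℝ) : ℂ) =
      r * Complex.exp (phase z x * Complex.I) := by
    rw [phase, ← argSum_neg hzx, ← hrz, ← prod_sub_eq hχ]
    exact Finset.prod_congr rfl fun j _ => (neg_sub _ _).symm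
  exact ⟨r, hr, by simpa [Complex.exp_ofReal_mul_I_re] using congrArg Complex.re hpolar,
    by simpa [Complex.exp_ofReal_mul_I_im] using congrArg Complex.im hpolar⟩

lemma cos_phase_eq_zero_iff (hz : ∀ j, (z j).im ≠ 0) (x : ℝ) :
    Real.cos (phase z x) = 0 ↔ p.eval x = 0 := by
  obtain ⟨r, hr, hrp, -⟩ := exists_polar hχ hz x
  rw [hrp, mul_eq_zero, or_iff_right hr]

lemma eval_ne_zero_of_eval_eq_zero (hz : ∀ j, (z j).im ≠ 0) {x : ℝ} (hp : p.eval x = 0) :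
    h.eval x ≠ 0 := by
  intro hh
  have hprod := prod_sub_eq hχ x
  rw [hp, hh, Complex.ofReal_zero, mul_zero, add_zero, Finset.prod_eq_zero_iff] at hprod
  obtain ⟨j, -, hj⟩ := hprod
  exact hz j (by simp [← sub_eq_zero.1 hj])

lemma eval_zero_eq_tan_mul (hz : ∀ j, (z j).im ≠ 0) (hcos : Real.cos (argSum z) ≠ 0) :
    h.eval 0 = Real.tan (argSum z) * p.eval 0 := by
  obtain ⟨r, -, hrp, hrh⟩ := exists_polar hχ hz 0
  rw [phase_zero] at hrp hrh
  rw [hrp, hrh, mul_left_comm, Real.tan_mul_cos hcos]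

/- The phase derivative is the imaginary part of the logarithmic derivative of
`∏ j, (X - C (z j)) = p + i h`. -/
lemma wronskian_eq (hz : ∀ j, (z j).im ≠ 0) (x : ℝ) :
    (derivative h).eval x * p.eval x - (derivative p).eval x * h.eval x =
      ((p.eval x) ^ 2 + (h.eval x) ^ 2) * phaseDeriv z x := by
  have hne : ∀ j, (x : ℂ) - z j ≠ 0 := fun j hj => hz j (by simpa using congrArg Complex.im hj)
  have hprod := prod_sub_eq hχ x
  have hderiv : ∑ j, ∏ k ∈ Finset.univ.erase j, ((x : ℂ) - z k) =
      (((derivative p).eval x : ℝ) : ℂ) + Complex.I * (((derivative h).eval x : ℝ) : ℂ) := by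
    have := congrArg (fun f => eval (x : ℂ) (derivative f)) hχ
    simpa only [derivative_prod_finset, derivative_sub, derivative_X, derivative_C, sub_zero,
      mul_one, derivative_add, derivative_mul, zero_mul, zero_add, derivative_map, eval_add,
      eval_mul, eval_C, eval_map_algebraMap_ofReal, eval_finsetSum, eval_prod, eval_sub,
      eval_X] using this
  have hlog : phaseDeriv z x = ((∑ j, ∏ k ∈ Finset.univ.erase j, ((x : ℂ) - z k)) /
      ∏ j, ((x : ℂ) - z j)).im := by
    rw [Finset.sum_div, Complex.im_sum, phaseDeriv]
    refine Finset.sum_congr rfl fun j _ => ?_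
    rw [← Finset.mul_prod_erase _ _ (Finset.mem_univ j), div_mul_cancel_right₀
      (Finset.prod_ne_zero_iff.2 fun k _ => hne k), Complex.inv_im, norm_sub_rev,
      Complex.normSq_eq_norm_sq]
    simp
  have hsq : (p.eval x) ^ 2 + (h.eval x) ^ 2 ≠ 0 := by
    intro h0
    obtain ⟨hp, hh⟩ : p.eval x = 0 ∧ h.eval x = 0 := by constructor <;> nlinarith
    exact eval_ne_zero_of_eval_eq_zero hχ hz hp hh
  rw [hlog, hderiv, hprod, Complex.div_im]
  have hnormSq : Complex.normSq (((p.eval x : ℝ) : ℂ) + Complex.I * ((h.eval x : ℝ) : ℂ)) =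
      (p.eval x) ^ 2 + (h.eval x) ^ 2 := by
    rw [mul_comm, Complex.normSq_add_mul_I]
  rw [hnormSq]
  simp only [Complex.add_im, Complex.ofReal_im, Complex.mul_im, Complex.I_re, mul_zero,
    Complex.I_im, Complex.ofReal_re, one_mul, zero_add, Complex.add_re, Complex.mul_re, zero_mul,
    sub_self, add_zero]
  field_simp

end RealAndImaginaryParts

lemma upcrossing_of_interlaces {m : ℕ} {p c : ℝ[X]} (hI : Interlaces m p c) {l : ℝ} (hl : 0 < l)
    {z : Fin (m + 1) → ℂ}
    (hχ : ∏ j, (X - C (z j)) = p.map (algebraMap ℝ ℂ) +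
      C Complex.I * (C l * (p - X * c)).map (algebraMap ℝ ℂ))
    (hz : ∀ j, (z j).im ≠ 0) {x : ℝ} (hx : x ≠ 0) (hpx : p.eval x = 0) :
    0 < phaseDeriv z x * x := by
  have hphase := wronskian_eq hχ hz x
  have hcp : 0 < (derivative p).eval x * c.eval x := by simpa [hpx] using hI.wronskian_pos x
  have heq : (l * x * c.eval x) ^ 2 * (phaseDeriv z x * x) =
      l * x ^ 2 * ((derivative p).eval x * c.eval x) := by
    simp only [eval_mul, eval_sub, eval_C, eval_X, hpx] at hphase
    linear_combination (-x) * hphase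
  exact pos_of_mul_pos_right (heq ▸ mul_pos (by positivity) hcp) (sq_nonneg _)

lemma im_ne_zero_of_interlaces {m n : ℕ} {p c : ℝ[X]} (hI : Interlaces m p c)
    (hp0 : p.eval 0 ≠ 0) {l : ℝ} (hl : l ≠ 0) {z : Fin n → ℂ}
    (hχ : ∏ j, (X - C (z j)) = p.map (algebraMap ℝ ℂ) +
      C Complex.I * (C l * (p - X * c)).map (algebraMap ℝ ℂ)) (j : Fin n) : (z j).im ≠ 0 := by
  intro hj
  have hre : ((z j).re : ℂ) = z j := Complex.ext rfl (by rw [Complex.ofReal_im, hj])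
  have hprod := prod_sub_eq hχ (z j).re
  rw [Finset.prod_eq_zero (Finset.mem_univ j) (by rw [hre, sub_self])] at hprod
  have hpx : p.eval (z j).re = 0 := by simpa using (congrArg Complex.re hprod).symm
  have hx : (z j).re ≠ 0 := fun h0 => hp0 (h0 ▸ hpx)
  have hcx : c.eval (z j).re = 0 := by simpa [hpx, hl, hx] using congrArg Complex.im hprod
  simpa [hpx, hcx] using hI.wronskian_pos (z j).re

lemma configuration_of_interlaces {m : ℕ} {p c : ℝ[X]} (hI : Interlaces m p c)
    (hp0 : p.eval 0 ≠ 0) {l : ℝ} (hl : 0 < l) {z : Fin (m + 1) → ℂ}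
    (hχ : ∏ j, (X - C (z j)) = p.map (algebraMap ℝ ℂ) +
      C Complex.I * (C l * (p - X * c)).map (algebraMap ℝ ℂ)) :
    (∀ j, (z j).im ≠ 0) ∧ argSum z < Real.pi / 2 ∧ Real.tan (argSum z) = l := by
  have hz := im_ne_zero_of_interlaces hI hp0 hl.ne' hχ
  have hcos : Real.cos (argSum z) ≠ 0 := by
    rw [← phase_zero]
    exact fun h0 => hp0 ((cos_phase_eq_zero_iff hχ hz 0).1 h0)
  refine ⟨hz, ?_, ?_⟩
  · by_contra! hge
    have hgt : Real.pi / 2 < argSum z :=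
      hge.lt_of_ne fun h0 => hcos (by rw [← h0, Real.cos_pi_div_two])
    obtain ⟨s, hs, -⟩ := hI.exists_eq_nodal
    have hroot : ∀ x ∈ s, p.eval x = 0 := fun x hx => by
      rw [hs]
      exact Lagrange.eval_nodal_at_node (v := id) hx
    have hcard := card_lt_of_upcrossing hz hgt (s := s)
      (fun x hx h0 =>
        upcrossing_of_interlaces hI hl hχ hz hx ((cos_phase_eq_zero_iff hχ hz x).1 h0))
      fun x hx => ⟨fun h0 => hp0 (h0 ▸ hroot x hx), (cos_phase_eq_zero_iff hχ hz x).2 (hroot x hx)⟩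
    rw [← Lagrange.natDegree_nodal (R := ℝ) (s := s) (v := id), ← hs, hI.natDegree_left] at hcard
    exact hcard.false
  · have htan := eval_zero_eq_tan_mul hχ hz hcos
    simp only [eval_mul, eval_sub, eval_C, eval_X, zero_mul, sub_zero] at htan
    exact (mul_right_cancel₀ hp0 htan).symm

lemma exists_companion {K : Type*} [Field K] {m : ℕ} {p h : K[X]} {l : K} (hl : l ≠ 0)
    (hp : p.Monic) (hpd : p.natDegree = m + 1) (hh : h.natDegree < m + 1)
    (h0 : h.eval 0 = l * p.eval 0) :
    ∃ c : K[X], c.Monic ∧ c.natDegree = m ∧ h = C l * (p - X * c) := by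
  set q : K[X] := p - C l⁻¹ * h with hq
  have hX : X * q.divX = q := by
    have hq0 : q.coeff 0 = 0 := by
      rw [coeff_zero_eq_eval_zero, hq, eval_sub, eval_mul, eval_C, h0, inv_mul_cancel_left₀ hl,
        sub_self]
    have := X_mul_divX_add q
    rwa [hq0, C_0, add_zero] at this
  have hlt : (C l⁻¹ * h).natDegree < p.natDegree := by
    rwa [natDegree_C_mul (inv_ne_zero hl), hpd]
  have hqd : q.natDegree = m + 1 := by rw [hq, natDegree_sub_eq_left_of_natDegree_lt hlt, hpd]
  have hcd : q.divX.natDegree = m := by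
    rw [natDegree_divX_eq_natDegree_tsub_one, hqd, Nat.add_sub_cancel]
  refine ⟨q.divX, ?_, hcd, ?_⟩
  · have hqm : q.Monic := hp.sub_of_left (degree_lt_degree hlt)
    rw [Monic, leadingCoeff, hcd, coeff_divX, ← hqd]
    exact hqm
  · rw [hX, hq, sub_sub_cancel, ← mul_assoc, ← C_mul, mul_inv_cancel₀ hl, C_1, one_mul]

lemma exists_interlaces_of_configuration {m : ℕ} {z : Fin (m + 1) → ℂ}
    (hz : ∀ j, (z j).im ≠ 0) (hsum : argSum z < Real.pi / 2) {p h : ℝ[X]}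
    (hp : p.Monic) (hpd : p.natDegree = m + 1) (hh : h.natDegree < m + 1)
    (hχ : ∏ j, (X - C (z j)) = p.map (algebraMap ℝ ℂ) + C Complex.I * h.map (algebraMap ℝ ℂ)) :
    0 < Real.tan (argSum z) ∧ p.eval 0 ≠ 0 ∧
      ∃ c, Interlaces m p c ∧ h = C (Real.tan (argSum z)) * (p - X * c) := by
  have hpos := argSum_pos hz
  have hcos : Real.cos (argSum z) ≠ 0 := (Real.cos_pos_of_mem_Ioo ⟨by linarith, hsum⟩).ne'
  have hl : 0 < Real.tan (argSum z) := Real.tan_pos_of_pos_of_lt_pi_div_two hpos hsum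
  have hp0 : p.eval 0 ≠ 0 := by
    rwa [← phase_zero, Ne, cos_phase_eq_zero_iff hχ hz] at hcos
  obtain ⟨c, hcm, hcd, hhc⟩ :=
    exists_companion hl.ne' hp hpd hh (eval_zero_eq_tan_mul hχ hz hcos)
  obtain ⟨s, hscard, hs, hsinj⟩ := exists_finset_cos_phase_eq_zero hz hsum
  have hroot : ∀ x ∈ s, p.eval x = 0 := fun x hx =>
    (cos_phase_eq_zero_iff hχ hz x).1 (hs x hx).2
  have hnodal : p = Lagrange.nodal s id := eq_nodal_of_roots hp (by rw [hscard, hpd]) hroot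
  have hmem : ∀ x, Real.cos (phase z x) = 0 → x ∈ s := fun x hx => by
    rw [cos_phase_eq_zero_iff hχ hz, hnodal, Lagrange.eval_nodal, Finset.prod_eq_zero_iff] at hx
    obtain ⟨y, hy, hxy⟩ := hx
    rwa [sub_eq_zero.1 hxy]
  have hcross : ∀ x ∈ s, 0 ≤ phaseDeriv z x * x := fun x hx =>
    phaseDeriv_mul_nonneg hz hsum (hs x hx).1 (hs x hx).2 fun y hxy hphase =>
      hsinj x hx y (hmem y (hphase ▸ (hs x hx).2)) hxy hphase
  refine ⟨hl, hp0, c, ⟨hpd, hcm, hcd, s, hnodal, fun x hx => ?_⟩, hhc⟩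
  have hpx := hroot x hx
  have hhx : h.eval x ≠ 0 := eval_ne_zero_of_eval_eq_zero hχ hz hpx
  have hhcx : h.eval x = -(Real.tan (argSum z) * x * c.eval x) := by
    rw [hhc, eval_mul, eval_sub, eval_mul, eval_C, eval_X, hpx]
    ring
  have hcx : c.eval x ≠ 0 := fun h0 => hhx (by rw [hhcx, h0, mul_zero, neg_zero])
  have hp'x : (derivative p).eval x ≠ 0 := by
    rw [hnodal, eval_derivative_nodal_id hx]
    exact eval_nodal_id_ne_zero (Finset.notMem_erase x s)
  have heq : Real.tan (argSum z) * x ^ 2 * (c.eval x * (derivative p).eval x) =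
      h.eval x ^ 2 * (phaseDeriv z x * x) := by
    have hphase := wronskian_eq hχ hz x
    rw [hpx] at hphase
    linear_combination x * hphase + x * (derivative p).eval x * hhcx
  refine (mul_ne_zero hcx hp'x).symm.lt_of_le (nonneg_of_mul_nonneg_right (heq ▸
    mul_nonneg (sq_nonneg _) (hcross x hx)) (mul_pos hl (sq_pos_of_ne_zero (hs x hx).1)))

/-! ### Monic polynomials and their coefficient vectors -/

section MonicPoly

variable {R : Type*} [CommRing R] {n : ℕ}

/-- The monic polynomial of degree `n` with lower coefficients `v`. -/
def monicPoly (v : Fin n → R) : R[X] := X ^ n + ∑ i, C (v i) * X ^ (i : ℕ)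

/-- The coefficients of `p` of degree less than `n`. -/
def coeffVec (n : ℕ) (p : R[X]) : Fin n → R := fun i => p.coeff i

lemma monic_monicPoly (v : Fin n → R) : (monicPoly v).Monic :=
  monic_X_pow_add (degree_sum_fin_lt v)

lemma natDegree_monicPoly [Nontrivial R] (v : Fin n → R) : (monicPoly v).natDegree = n := by
  refine natDegree_eq_of_degree_eq_some ?_
  rw [monicPoly, degree_add_eq_left_of_degree_lt, degree_X_pow]
  rw [degree_X_pow]
  exact degree_sum_fin_lt v

lemma coeff_monicPoly (v : Fin n → R) (k : ℕ) :
    (monicPoly v).coeff k = if h : k < n then v ⟨k, h⟩ else if k = n then 1 else 0 := by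
  rw [monicPoly, coeff_add, coeff_X_pow, finsetSum_coeff]
  simp only [coeff_C_mul_X_pow]
  by_cases h : k < n
  · rw [dif_pos h, if_neg h.ne, zero_add, Finset.sum_eq_single (⟨k, h⟩ : Fin n), if_pos rfl]
    · exact fun i _ hi => if_neg fun hk => hi (Fin.ext hk.symm)
    · exact fun hk => absurd (Finset.mem_univ _) hk
  · rw [dif_neg h, Finset.sum_eq_zero, add_zero]
    exact fun i _ => if_neg fun hk : k = i => h (hk.trans_lt i.2)

lemma coeffVec_monicPoly (v : Fin n → R) : coeffVec n (monicPoly v) = v := by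
  ext i
  rw [coeffVec, coeff_monicPoly, dif_pos i.2]

lemma monicPoly_coeffVec {p : R[X]} (hp : p.Monic) (hn : p.natDegree = n) :
    monicPoly (coeffVec n p) = p := by
  subst hn
  ext k
  rw [coeff_monicPoly]
  split_ifs with hlt heq
  · rfl
  · rw [heq, hp.coeff_natDegree]
  · exact (coeff_eq_zero_of_natDegree_lt (by omega)).symm

lemma measurable_coeff_monicPoly [MeasurableSpace R] (k : ℕ) :
    Measurable fun v : Fin n → R => (monicPoly v).coeff k := by
  simp only [coeff_monicPoly]
  split_ifs
  · exact measurable_pi_apply _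
  · exact measurable_const
  · exact measurable_const

end MonicPoly

/-! ### Lebesgue integrals over vectors -/

section FinVectors

variable {α : Type*} [MeasureSpace α] [SigmaFinite (volume : Measure α)] {m : ℕ}

lemma lintegral_insertNth (i : Fin (m + 1)) {f : (Fin (m + 1) → α) → ℝ≥0∞} (hf : Measurable f) :
    ∫⁻ v, f v = ∫⁻ x, ∫⁻ w : Fin m → α, f (i.insertNth x w) := by
  have h := (volume_preserving_piFinSuccAbove (fun _ : Fin (m + 1) => α) i).symm
  rw [← h.lintegral_comp_emb (MeasurableEquiv.measurableEmbedding _), Measure.volume_eq_prod,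
    lintegral_prod]
  · rfl
  · exact (hf.comp (MeasurableEquiv.measurable _)).aemeasurable

lemma lintegral_fin_cons {f : (Fin (m + 1) → α) → ℝ≥0∞} (hf : Measurable f) :
    ∫⁻ v, f v = ∫⁻ x, ∫⁻ w : Fin m → α, f (Fin.cons x w) := by
  simpa using lintegral_insertNth 0 hf

lemma lintegral_fin_snoc {f : (Fin (m + 1) → α) → ℝ≥0∞} (hf : Measurable f) :
    ∫⁻ v, f v = ∫⁻ x, ∫⁻ w : Fin m → α, f (Fin.snoc (α := fun _ => α) w x) := by
  simpa [Fin.insertNth_last'] using lintegral_insertNth (Fin.last m) hf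

end FinVectors

section FinVectorsMeasurability

variable {α : Type*} [MeasurableSpace α] {m : ℕ}

lemma measurable_fin_insertNth (i : Fin (m + 1)) :
    Measurable fun q : α × (Fin m → α) => (i.insertNth q.1 q.2 : Fin (m + 1) → α) :=
  (MeasurableEquiv.piFinSuccAbove (fun _ => α) i).symm.measurable

lemma measurable_fin_cons :
    Measurable fun q : α × (Fin m → α) => (Fin.cons q.1 q.2 : Fin (m + 1) → α) := by
  simpa using measurable_fin_insertNth 0

lemma measurable_fin_snoc_left (x : α) :
    Measurable fun w : Fin m → α => (Fin.snoc w x : Fin (m + 1) → α) := by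
  have h : Measurable fun q : α × (Fin m → α) => (Fin.snoc q.2 q.1 : Fin (m + 1) → α) := by
    simpa [Fin.insertNth_last'] using measurable_fin_insertNth (Fin.last m)
  exact h.comp measurable_prodMk_left

end FinVectorsMeasurability

lemma lintegral_eq_mul_lintegral_smul {E : Type*} [NormedAddCommGroup E] [NormedSpace ℝ E]
    [MeasurableSpace E] [BorelSpace E] [FiniteDimensional ℝ E] (μ : Measure E)
    [μ.IsAddHaarMeasure] (f : E → ℝ≥0∞) {s : ℝ} (hs : s ≠ 0) :
    ∫⁻ x, f x ∂μ = ENNReal.ofReal (|s| ^ Module.finrank ℝ E) * ∫⁻ x, f (s • x) ∂μ := by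
  have hmap : ∫⁻ x, f (s • x) ∂μ = ∫⁻ x, f x ∂μ.map (s • ·) :=
    (lintegral_map_equiv f (MeasurableEquiv.smul₀ s hs)).symm
  rw [hmap, Measure.map_addHaar_smul μ hs, lintegral_smul_measure, smul_eq_mul, ← mul_assoc,
    ← ENNReal.ofReal_mul (by positivity), abs_inv, abs_pow, mul_inv_cancel₀ (by positivity),
    ENNReal.ofReal_one, one_mul]

lemma setLIntegral_Ioi_eq_setLIntegral_sq (f : ℝ → ℝ≥0∞) :
    ∫⁻ x in Set.Ioi 0, f x = ∫⁻ x in Set.Ioi 0, ENNReal.ofReal (2 * x) * f (x ^ 2) := by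
  have himg : (fun x : ℝ => x ^ 2) '' Set.Ioi 0 = Set.Ioi 0 := by
    refine Set.Subset.antisymm (Set.image_subset_iff.2 fun x hx =>
      Set.mem_preimage.2 (pow_pos (Set.mem_Ioi.1 hx) 2 : 0 < x ^ 2)) fun y hy => ?_
    exact ⟨√y, Real.sqrt_pos.2 hy, Real.sq_sqrt (le_of_lt hy)⟩
  have hinj : Set.InjOn (fun x : ℝ => x ^ 2) (Set.Ioi 0) := fun x hx y hy =>
    (pow_left_inj₀ (le_of_lt hx) (le_of_lt hy) two_ne_zero).1
  rw [← himg, lintegral_image_eq_lintegral_abs_deriv_mul measurableSet_Ioi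
    (fun x _ => (hasDerivAt_pow 2 x).hasDerivWithinAt) hinj, himg]
  refine setLIntegral_congr_fun measurableSet_Ioi fun x hx => ?_
  simp only [Nat.cast_ofNat, Nat.add_one_sub_one, pow_one,
    abs_of_pos (mul_pos two_pos (Set.mem_Ioi.1 hx))]

lemma lintegral_cone {m : ℕ} {f : (Fin (m + 1) → ℝ) → ℝ≥0∞} (hf : Measurable f) :
    ∫⁻ u in {u | 0 < u (Fin.last m)}, f u =
      ∫⁻ s in Set.Ioi (0 : ℝ), ENNReal.ofReal (s ^ m) *
        ∫⁻ d : Fin m → ℝ, f (Fin.snoc (α := fun _ => ℝ) (s • d) s) := by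
  have hS : MeasurableSet {u : Fin (m + 1) → ℝ | 0 < u (Fin.last m)} :=
    measurableSet_lt measurable_const (measurable_pi_apply _)
  rw [← lintegral_indicator hS, lintegral_fin_snoc (hf.indicator hS),
    ← lintegral_indicator measurableSet_Ioi]
  refine lintegral_congr fun s => ?_
  simp only [Set.indicator, Set.mem_ofPred_eq, Fin.snoc_last, Set.mem_Ioi]
  split_ifs with hs
  · rw [lintegral_eq_mul_lintegral_smul volume (fun w => f (Fin.snoc (α := fun _ => ℝ) w s)) hs.ne',
      abs_of_pos hs, Module.finrank_fin_fun]
  · exact lintegral_zero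

section Slices

variable {α β : Type*} [MeasurableSpace α] [MeasurableSpace β]

lemma setLIntegral_prod_slices (μ : Measure α) (ν : Measure β) [SFinite ν] {S : Set (α × β)}
    (hS : MeasurableSet S) {f : α × β → ℝ≥0∞} (hf : Measurable f) :
    ∫⁻ z in S, f z ∂μ.prod ν = ∫⁻ x, ∫⁻ y in Prod.mk x ⁻¹' S, f (x, y) ∂ν ∂μ := by
  rw [← lintegral_indicator hS, lintegral_prod _ (hf.indicator hS).aemeasurable]
  exact lintegral_congr fun x => lintegral_indicator (measurable_prodMk_left hS) fun y => f (x, y)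

lemma setLIntegral_prod_slices_symm (μ : Measure α) (ν : Measure β) [SFinite μ] [SFinite ν]
    {S : Set (α × β)} (hS : MeasurableSet S) {f : α × β → ℝ≥0∞} (hf : Measurable f) :
    ∫⁻ z in S, f z ∂μ.prod ν = ∫⁻ y, ∫⁻ x in (fun x => (x, y)) ⁻¹' S, f (x, y) ∂μ ∂ν := by
  rw [← lintegral_indicator hS, lintegral_prod_symm _ (hf.indicator hS).aemeasurable]
  exact lintegral_congr fun y => lintegral_indicator (measurable_prodMk_right hS) fun x => f (x, y)

lemma lintegral_rotate {γ : Type*} [MeasurableSpace γ] (μ : Measure α) (ν : Measure β)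
    (ρ : Measure γ) [SFinite μ] [SFinite ν] [SFinite ρ] {f : α × β × γ → ℝ≥0∞}
    (hf : Measurable f) :
    ∫⁻ x, ∫⁻ y, ∫⁻ z, f (x, y, z) ∂ρ ∂ν ∂μ = ∫⁻ z, ∫⁻ y, ∫⁻ x, f (x, y, z) ∂μ ∂ν ∂ρ := by
  have hzx : Measurable fun q : (β × α) × γ => f (q.1.2, q.1.1, q.2) := hf.comp (by fun_prop)
  have hxz : Measurable fun q : (β × γ) × α => f (q.2, q.1.1, q.1.2) := hf.comp (by fun_prop)
  calc ∫⁻ x, ∫⁻ y, ∫⁻ z, f (x, y, z) ∂ρ ∂ν ∂μ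
      = ∫⁻ y, ∫⁻ x, ∫⁻ z, f (x, y, z) ∂ρ ∂μ ∂ν := lintegral_lintegral_swap
        (f := fun x y => ∫⁻ z, f (x, y, z) ∂ρ)
        (hzx.lintegral_prod_right'.comp measurable_swap).aemeasurable
    _ = ∫⁻ y, ∫⁻ z, ∫⁻ x, f (x, y, z) ∂μ ∂ρ ∂ν := lintegral_congr fun y =>
        lintegral_lintegral_swap (f := fun x z => f (x, y, z))
          (hf.comp (by fun_prop : Measurable fun q : α × γ => (q.1, y, q.2))).aemeasurable
    _ = ∫⁻ z, ∫⁻ y, ∫⁻ x, f (x, y, z) ∂μ ∂ν ∂ρ := lintegral_lintegral_swap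
        (f := fun y z => ∫⁻ x, f (x, y, z) ∂μ) hxz.lintegral_prod_right'.aemeasurable

end Slices

lemma lintegral_prod_fin_cons {α : Type*} [MeasureSpace α] [SigmaFinite (volume : Measure α)]
    {m n : ℕ} {f : (Fin (m + 1) → α) × (Fin (n + 1) → α) → ℝ≥0∞} (hf : Measurable f) :
    ∫⁻ x, f x = ∫⁻ a, ∫⁻ b, ∫⁻ x : (Fin m → α) × (Fin n → α),
      f (Fin.cons a x.1, Fin.cons b x.2) := by
  have hcons : Measurable fun q : (α × (Fin m → α)) × (α × (Fin n → α)) =>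
      f (Fin.cons q.1.1 q.1.2, Fin.cons q.2.1 q.2.2) :=
    hf.comp ((measurable_fin_cons.comp measurable_fst).prodMk
      (measurable_fin_cons.comp measurable_snd))
  rw [Measure.volume_eq_prod, lintegral_prod _ hf.aemeasurable,
    lintegral_fin_cons hf.lintegral_prod_right']
  refine lintegral_congr fun a => ?_
  have hab : Measurable fun q : ((Fin m → α) × α) × (Fin n → α) =>
      f (Fin.cons a q.1.1, Fin.cons q.1.2 q.2) :=
    hcons.comp (by fun_prop : Measurable fun q : ((Fin m → α) × α) × (Fin n → α) =>
      ((a, q.1.1), (q.1.2, q.2)))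
  calc ∫⁻ v : Fin m → α, ∫⁻ w, f (Fin.cons a v, w)
      = ∫⁻ v : Fin m → α, ∫⁻ b, ∫⁻ w : Fin n → α, f (Fin.cons a v, Fin.cons b w) :=
        lintegral_congr fun v => lintegral_fin_cons (f := fun w => f (Fin.cons a v, w))
          (hf.comp measurable_prodMk_left)
    _ = ∫⁻ b, ∫⁻ v : Fin m → α, ∫⁻ w : Fin n → α, f (Fin.cons a v, Fin.cons b w) :=
        lintegral_lintegral_swap hab.lintegral_prod_right'.aemeasurable
    _ = _ := lintegral_congr fun b => (lintegral_prod _ (hcons.comp (by fun_prop :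
        Measurable fun x : (Fin m → α) × (Fin n → α) => ((a, x.1), (b, x.2)))).aemeasurable).symm

/-! ### One step of the Euclidean algorithm in coordinates -/

/-- Coefficient vectors of a pair of monic polynomials of degrees `m + 1` and `m`. -/
abbrev PairCoeffs (m : ℕ) : Type := (Fin (m + 1) → ℝ) × (Fin m → ℝ)

section EuclidStep

variable {m : ℕ}

/-- One step of the Euclidean algorithm, run backwards: the pair `(c, d)` becomes
`((X - b) c - s d, c)`. -/
def euclidStep (b s : ℝ) (y : PairCoeffs m) : PairCoeffs (m + 1) :=
  (coeffVec (m + 2) ((X - C b) * monicPoly y.1 - C s * monicPoly y.2), y.1)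

/-- The remainder of the division of `p` by `c`, with the sign that makes its leading coefficient
positive for an interlacing pair; the quotient `X - b` is read off the second coefficients. -/
def euclidRem (y : PairCoeffs (m + 1)) : ℝ[X] :=
  (X - C (y.2 (Fin.last m) - y.1 (Fin.last (m + 1)))) * monicPoly y.2 - monicPoly y.1

/-- The coefficient of degree `m` of the remainder, which is its leading coefficient when it does
not vanish. -/
def euclidLead (y : PairCoeffs (m + 1)) : ℝ := (euclidRem y).coeff m

/-- One step of the Euclidean algorithm: the pair of `c` and the normalized remainder. -/
def euclidNext (y : PairCoeffs (m + 1)) : PairCoeffs m :=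
  (y.2, fun i => (euclidRem y).coeff i / euclidLead y)

lemma coeff_X_sub_C_mul' {R : Type*} [CommRing R] (b : R) (c : R[X]) (k : ℕ) :
    ((X - C b) * c).coeff k = (if k = 0 then 0 else c.coeff (k - 1)) - b * c.coeff k := by
  rw [sub_mul, coeff_sub, coeff_C_mul]
  cases k with
  | zero => simp
  | succ k => simp

lemma measurable_coeff_X_sub_C_mul {k : ℕ} :
    Measurable fun q : ℝ × (Fin m → ℝ) => ((X - C q.1) * monicPoly q.2).coeff k := by
  have hcoeff : ∀ k, Measurable fun q : ℝ × (Fin m → ℝ) => (monicPoly q.2).coeff k :=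
    fun k => (measurable_coeff_monicPoly k).comp measurable_snd
  simp only [coeff_X_sub_C_mul']
  split_ifs
  · exact measurable_const.sub (measurable_fst.mul (hcoeff k))
  · exact (hcoeff _).sub (measurable_fst.mul (hcoeff k))

lemma measurable_coeff_euclidRem (k : ℕ) :
    Measurable fun y : PairCoeffs (m + 1) => (euclidRem y).coeff k := by
  have hquot : Measurable fun y : PairCoeffs (m + 1) =>
      (y.2 (Fin.last m) - y.1 (Fin.last (m + 1)), y.2) := by fun_prop
  simp only [euclidRem, coeff_sub]
  exact (measurable_coeff_X_sub_C_mul.comp hquot).sub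
    ((measurable_coeff_monicPoly k).comp measurable_fst)

lemma measurable_euclidLead : Measurable (euclidLead (m := m)) :=
  measurable_coeff_euclidRem m

lemma measurable_euclidNext : Measurable (euclidNext (m := m)) :=
  measurable_snd.prodMk (measurable_pi_iff.2 fun _ =>
    (measurable_coeff_euclidRem _).div measurable_euclidLead)

@[fun_prop]
lemma measurable_euclidStep {α : Type*} [MeasurableSpace α] {b s : α → ℝ} {y : α → PairCoeffs m}
    (hb : Measurable b) (hs : Measurable s) (hy : Measurable y) :
    Measurable fun x => euclidStep (b x) (s x) (y x) := by
  refine Measurable.prodMk (measurable_pi_iff.2 fun i => ?_) hy.fst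
  simp only [coeffVec, coeff_sub, coeff_C_mul]
  exact (measurable_coeff_X_sub_C_mul.comp (hb.prodMk hy.fst)).sub
    (hs.mul ((measurable_coeff_monicPoly _).comp hy.snd))

lemma monicPoly_euclidStep (b s : ℝ) (y : PairCoeffs m) :
    monicPoly (euclidStep b s y).1 = (X - C b) * monicPoly y.1 - C s * monicPoly y.2 := by
  have hmonic := (monic_X_sub_C b).mul (monic_monicPoly y.1)
  have hdeg : ((X - C b) * monicPoly y.1).natDegree = m + 2 := by
    rw [(monic_X_sub_C b).natDegree_mul (monic_monicPoly y.1), natDegree_X_sub_C,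
      natDegree_monicPoly, add_comm]
  have hlt : (C s * monicPoly y.2).natDegree < ((X - C b) * monicPoly y.1).natDegree := by
    refine (natDegree_C_mul_le _ _).trans_lt ?_
    rw [natDegree_monicPoly, hdeg]
    omega
  have hdeg' : ((X - C b) * monicPoly y.1 - C s * monicPoly y.2).natDegree = m + 2 := by
    rw [natDegree_sub_eq_left_of_natDegree_lt hlt, hdeg]
  rw [euclidStep, monicPoly_coeffVec (hmonic.sub_of_left (degree_lt_degree hlt)) hdeg']

lemma coeff_X_sub_C_mul_monicPoly (b : ℝ) (c : Fin (m + 1) → ℝ) :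
    ((X - C b) * monicPoly c).coeff (m + 1) = c (Fin.last m) - b := by
  rw [coeff_X_sub_C_mul', if_neg (Nat.succ_ne_zero m), coeff_monicPoly, coeff_monicPoly,
    dif_pos (by omega), dif_neg (by omega), if_pos rfl, mul_one]
  rfl

lemma euclidStep_fst_eq_snoc (b s : ℝ) (c : Fin (m + 1) → ℝ) (d : Fin m → ℝ) :
    (euclidStep b s (c, d)).1 =
      Fin.snoc (α := fun _ => ℝ) (coeffVec (m + 1) ((X - C b) * monicPoly c) -
        Fin.snoc (α := fun _ => ℝ) (s • d) s) (c (Fin.last m) - b) := by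
  ext i
  simp only [euclidStep, coeffVec, coeff_sub, coeff_C_mul]
  refine Fin.lastCases ?_ (fun i => ?_) i
  · rw [Fin.snoc_last, Fin.val_last, coeff_X_sub_C_mul_monicPoly, coeff_monicPoly,
      dif_neg (by omega), if_neg (by omega), mul_zero, sub_zero]
  · rw [Fin.snoc_castSucc, Pi.sub_apply, Fin.val_castSucc]
    congr 1
    refine Fin.lastCases ?_ (fun i => ?_) i <;> simp [coeff_monicPoly]

lemma euclidLead_snoc (b : ℝ) (c u : Fin (m + 1) → ℝ) :
    euclidLead (Fin.snoc (α := fun _ => ℝ) (coeffVec (m + 1) ((X - C b) * monicPoly c) - u)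
      (c (Fin.last m) - b), c) = u (Fin.last m) := by
  rw [euclidLead, euclidRem]
  dsimp only
  rw [Fin.snoc_last, sub_sub_cancel, coeff_sub, coeff_monicPoly,
    dif_pos (by omega)]
  have : (⟨m, by omega⟩ : Fin (m + 2)) = (Fin.last m).castSucc := rfl
  rw [this, Fin.snoc_castSucc]
  simp [coeffVec]

lemma euclidRem_euclidStep (b s : ℝ) (y : PairCoeffs m) :
    euclidRem (euclidStep b s y) = C s * monicPoly y.2 := by
  have hlast : (euclidStep b s y).1 (Fin.last (m + 1)) = y.1 (Fin.last m) - b := by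
    rw [euclidStep_fst_eq_snoc b s y.1 y.2, Fin.snoc_last]
  rw [euclidRem, monicPoly_euclidStep, hlast]
  simp only [euclidStep, sub_sub_cancel]

lemma euclidLead_euclidStep (b s : ℝ) (y : PairCoeffs m) : euclidLead (euclidStep b s y) = s := by
  simp [euclidLead, euclidRem_euclidStep, coeff_monicPoly]

lemma euclidNext_euclidStep (b : ℝ) {s : ℝ} (hs : s ≠ 0) (y : PairCoeffs m) :
    euclidNext (euclidStep b s y) = y := by
  refine Prod.ext rfl (funext fun i => ?_)
  simp [euclidNext, euclidLead_euclidStep, euclidRem_euclidStep, coeff_monicPoly, hs]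

lemma lintegral_euclidStep (c : Fin (m + 1) → ℝ) {f : (Fin (m + 2) → ℝ) → ℝ≥0∞}
    (hf : Measurable f) :
    ∫⁻ p in {p | 0 < euclidLead (p, c)}, f p =
      ∫⁻ b, ∫⁻ s in Set.Ioi (0 : ℝ), ENNReal.ofReal (s ^ m) *
        ∫⁻ d : Fin m → ℝ, f (euclidStep b s (c, d)).1 := by
  have hS : MeasurableSet {p : Fin (m + 2) → ℝ | 0 < euclidLead (p, c)} :=
    measurableSet_lt measurable_const (measurable_euclidLead.comp (by fun_prop))
  rw [← lintegral_indicator hS, lintegral_fin_snoc (hf.indicator hS),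
    ← lintegral_sub_left_eq_self _ (c (Fin.last m))]
  refine lintegral_congr fun b => ?_
  set v : (Fin (m + 1) → ℝ) → Fin (m + 2) → ℝ := fun u => Fin.snoc (α := fun _ => ℝ)
    (coeffVec (m + 1) ((X - C b) * monicPoly c) - u) (c (Fin.last m) - b) with hv
  have hfv : Measurable fun u => f (v u) :=
    hf.comp ((measurable_fin_snoc_left _).comp (measurable_const.sub measurable_id))
  have hmem : ∀ u, {p | 0 < euclidLead (p, c)}.indicator f (v u) =
      {u : Fin (m + 1) → ℝ | 0 < u (Fin.last m)}.indicator (fun u => f (v u)) u := fun u => by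
    simp only [Set.indicator, Set.mem_ofPred_eq, hv, euclidLead_snoc]
  rw [← lintegral_sub_left_eq_self _ (coeffVec (m + 1) ((X - C b) * monicPoly c))]
  simp only [euclidStep_fst_eq_snoc]
  rw [← lintegral_cone hfv,
    ← lintegral_indicator (measurableSet_lt measurable_const (measurable_pi_apply _))]
  exact lintegral_congr hmem

end EuclidStep

/-! ### The law of the pair of characteristic polynomials -/

/-- Coefficient vectors of interlacing pairs. -/
def interlacingSet (m : ℕ) : Set (PairCoeffs m) :=
  {y | Interlaces m (monicPoly y.1) (monicPoly y.2)}

section PairLaw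

variable {m : ℕ}

lemma euclidRem_eq_C_mul_monicPoly {y : PairCoeffs (m + 1)} (hy : euclidLead y ≠ 0) :
    euclidRem y = C (euclidLead y) * monicPoly (euclidNext y).2 := by
  have hdeg : (euclidRem y).degree < ((m + 1 : ℕ) : WithBot ℕ) := by
    have h := degree_X_sub_C_mul_sub_lt (monic_monicPoly y.1) (natDegree_monicPoly y.1)
      (monic_monicPoly y.2) (natDegree_monicPoly y.2)
    rwa [coeff_monicPoly, dif_pos m.lt_succ_self, coeff_monicPoly,
      dif_pos (m + 1).lt_succ_self] at h
  ext k
  rw [coeff_C_mul, coeff_monicPoly]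
  split_ifs with hlt heq
  · rw [euclidNext, mul_div_cancel₀ _ hy]
  · rw [heq, mul_one, euclidLead]
  · rw [mul_zero, (degree_lt_iff_coeff_zero _ _).1 hdeg k (by omega)]

lemma mem_interlacingSet_succ (y : PairCoeffs (m + 1)) :
    y ∈ interlacingSet (m + 1) ↔ 0 < euclidLead y ∧ euclidNext y ∈ interlacingSet m := by
  constructor
  · intro h
    obtain ⟨b, s, d, hs, hp, hd⟩ := Interlaces.euclid h
    have hd_eq := monicPoly_coeffVec hd.monic_right hd.natDegree_right
    have hy : y = euclidStep b s (y.2, coeffVec m d) := by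
      refine Prod.ext ?_ rfl
      rw [← coeffVec_monicPoly y.1, hp, euclidStep, hd_eq]
    have hmem : (y.2, coeffVec m d) ∈ interlacingSet m := by
      rwa [interlacingSet, Set.mem_ofPred_eq, hd_eq]
    rw [hy, euclidLead_euclidStep, euclidNext_euclidStep b hs.ne']
    exact ⟨hs, hmem⟩
  · rintro ⟨hs, hy⟩
    have h := Interlaces.mul_sub hy (y.2 (Fin.last m) - y.1 (Fin.last (m + 1))) hs
    rw [← euclidRem_eq_C_mul_monicPoly hs.ne'] at h
    have hfst : (X - C (y.2 (Fin.last m) - y.1 (Fin.last (m + 1)))) *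
        monicPoly (euclidNext y).1 - euclidRem y = monicPoly y.1 := sub_sub_cancel _ _
    rwa [hfst] at h

lemma interlacingSet_zero : interlacingSet 0 = Set.univ :=
  Set.eq_univ_of_forall fun _ => interlaces_zero_iff.2
    ⟨monic_monicPoly _, natDegree_monicPoly _, by simp [monicPoly]⟩

lemma interlacingSet_succ :
    interlacingSet (m + 1) = {y | 0 < euclidLead y} ∩ euclidNext ⁻¹' interlacingSet m :=
  Set.ext mem_interlacingSet_succ

lemma measurableSet_interlacingSet (m : ℕ) : MeasurableSet (interlacingSet m) := by
  induction m with
  | zero => exact interlacingSet_zero ▸ MeasurableSet.univ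
  | succ m ih =>
    rw [interlacingSet_succ]
    exact (measurableSet_lt measurable_const measurable_euclidLead).inter
      (measurable_euclidNext ih)

/-- The absolute value of the resultant of an interlacing pair, computed by the Euclidean
algorithm. -/
def pairResultant : (m : ℕ) → PairCoeffs m → ℝ
  | 0, _ => 1
  | m + 1, y => euclidLead y ^ (m + 1) * pairResultant m (euclidNext y)

lemma measurable_pairResultant (m : ℕ) : Measurable (pairResultant m) := by
  induction m with
  | zero => exact measurable_const
  | succ m ih => exact (measurable_euclidLead.pow_const _).mul (ih.comp measurable_euclidNext)

/-- The coefficients of the two characteristic polynomials of a Jacobi matrix. -/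
def jacobiCoeffs (m : ℕ) (x : (Fin m → ℝ) × (Fin (m + 1) → ℝ)) : PairCoeffs m :=
  (coeffVec (m + 1) (jacobiPolys m x.1 x.2).1, coeffVec m (jacobiPolys m x.1 x.2).2)

lemma monicPoly_jacobiCoeffs (x : (Fin m → ℝ) × (Fin (m + 1) → ℝ)) :
    (monicPoly (jacobiCoeffs m x).1, monicPoly (jacobiCoeffs m x).2) = jacobiPolys m x.1 x.2 :=
  have h := monic_jacobiPolys m x.1 x.2
  Prod.ext (monicPoly_coeffVec h.1.1 h.1.2) (monicPoly_coeffVec h.2.1 h.2.2)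

lemma jacobiCoeffs_zero (x : (Fin 0 → ℝ) × (Fin 1 → ℝ)) : jacobiCoeffs 0 x = (-x.2, x.1) := by
  refine Prod.ext (funext fun i => ?_) (Subsingleton.elim _ _)
  rw [Fin.eq_zero i]
  simp [jacobiCoeffs, coeffVec, jacobiPolys]

lemma jacobiCoeffs_succ (a0 b0 : ℝ) (x : (Fin m → ℝ) × (Fin (m + 1) → ℝ)) :
    jacobiCoeffs (m + 1) (Fin.cons a0 x.1, Fin.cons b0 x.2) =
      euclidStep b0 (a0 ^ 2) (jacobiCoeffs m x) := by
  obtain ⟨hp, hc⟩ := Prod.ext_iff.1 (monicPoly_jacobiCoeffs x)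
  simp only at hp hc
  simp only [euclidStep, hp, hc]
  rfl

lemma pairResultant_jacobiCoeffs (a : Fin m → ℝ) (b : Fin (m + 1) → ℝ) (ha : ∀ j, 0 < a j) :
    pairResultant m (jacobiCoeffs m (a, b)) = ∏ j, a j ^ (2 * ((j.rev : ℕ) + 1)) := by
  induction m with
  | zero => simp [pairResultant]
  | succ m ih =>
    rw [← Fin.cons_self_tail a, ← Fin.cons_self_tail b,
      jacobiCoeffs_succ _ _ (Fin.tail a, Fin.tail b), pairResultant, euclidLead_euclidStep,
      euclidNext_euclidStep _ (pow_pos (ha 0) 2).ne',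
      ih (Fin.tail a) (Fin.tail b) fun j => ha _, Fin.prod_univ_succ]
    simp only [Fin.cons_zero, Fin.cons_succ, Fin.rev_zero, Fin.val_last, Fin.rev_succ,
      Fin.val_castSucc, pow_mul]

lemma measurable_jacobiCoeffs (m : ℕ) : Measurable (jacobiCoeffs m) := by
  induction m with
  | zero => exact funext jacobiCoeffs_zero ▸ measurable_snd.neg.prodMk measurable_fst
  | succ m ih =>
    have h : jacobiCoeffs (m + 1) = fun x =>
        euclidStep (x.2 0) (x.1 0 ^ 2) (jacobiCoeffs m (Fin.tail x.1, Fin.tail x.2)) := by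
      funext x
      rw [← jacobiCoeffs_succ, Fin.cons_self_tail, Fin.cons_self_tail]
    have htail (k : ℕ) : Measurable (Fin.tail : (Fin (k + 1) → ℝ) → Fin k → ℝ) :=
      measurable_pi_iff.2 fun _ => measurable_pi_apply _
    rw [h]
    exact measurable_euclidStep (by fun_prop) (by fun_prop)
      (ih.comp (((htail _).comp measurable_fst).prodMk ((htail _).comp measurable_snd)))

lemma exists_jacobiCoeffs_eq {y : PairCoeffs m} (hy : y ∈ interlacingSet m) :
    ∃ x : (Fin m → ℝ) × (Fin (m + 1) → ℝ), (∀ j, 0 < x.1 j) ∧ jacobiCoeffs m x = y := by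
  obtain ⟨a, b, ha, hab⟩ := Interlaces.exists_jacobiPolys hy
  refine ⟨(a, b), ha, ?_⟩
  simp only [jacobiCoeffs, hab, coeffVec_monicPoly]

/-- The absolute value of the Jacobian determinant of `jacobiCoeffs`, which does not depend on the
diagonal entries. -/
def jacobiJacobian (a : Fin m → ℝ) : ℝ := ∏ j, 2 * a j ^ (2 * (j.rev : ℕ) + 1)

lemma jacobiJacobian_cons (a0 : ℝ) (a : Fin m → ℝ) :
    jacobiJacobian (Fin.cons (α := fun _ => ℝ) a0 a) = 2 * a0 ^ (2 * m + 1) * jacobiJacobian a := by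
  rw [jacobiJacobian, Fin.prod_univ_succ]
  simp [Fin.rev_succ, jacobiJacobian]

lemma measurable_jacobiJacobian : Measurable (jacobiJacobian (m := m)) := by
  unfold jacobiJacobian
  fun_prop

/-- The parameters of Jacobi matrices of size `m + 1`. -/
abbrev jacobiParamSet (m : ℕ) : Set ((Fin m → ℝ) × (Fin (m + 1) → ℝ)) := {x | ∀ j, 0 < x.1 j}

lemma measurableSet_jacobiParamSet (m : ℕ) : MeasurableSet (jacobiParamSet m) := by
  simp only [jacobiParamSet, Set.ofPred_forall]
  exact MeasurableSet.iInter fun j => measurableSet_lt measurable_const (by fun_prop)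

lemma setLIntegral_jacobiParamSet_succ
    {f : (Fin (m + 1) → ℝ) × (Fin (m + 2) → ℝ) → ℝ≥0∞} (hf : Measurable f) :
    ∫⁻ x in jacobiParamSet (m + 1), f x = ∫⁻ a in Set.Ioi 0, ∫⁻ b, ∫⁻ x in jacobiParamSet m,
      f (Fin.cons a x.1, Fin.cons b x.2) := by
  have hS := measurableSet_jacobiParamSet
  rw [← lintegral_indicator (hS (m + 1)), lintegral_prod_fin_cons (hf.indicator (hS (m + 1))),
    ← lintegral_indicator measurableSet_Ioi]
  refine lintegral_congr fun a => ?_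
  simp only [← lintegral_indicator (hS m)]
  by_cases ha : 0 < a <;> simp [Set.indicator, Fin.forall_fin_succ, ha]

lemma setLIntegral_euclidLead_pos {f : PairCoeffs (m + 1) → ℝ≥0∞} (hf : Measurable f) :
    ∫⁻ y in {y | 0 < euclidLead y}, f y =
      ∫⁻ s in Set.Ioi (0 : ℝ), ENNReal.ofReal (s ^ m) *
        ∫⁻ b, ∫⁻ y : PairCoeffs m, f (euclidStep b s y) := by
  have hstep : Measurable fun q : ((Fin (m + 1) → ℝ) × ℝ × ℝ) × (Fin m → ℝ) =>
      f (euclidStep q.1.2.1 q.1.2.2 (q.1.1, q.2)) :=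
    hf.comp (by fun_prop)
  have hweight : Measurable fun q : (Fin (m + 1) → ℝ) × ℝ × ℝ => ENNReal.ofReal (q.2.2 ^ m) *
      ∫⁻ d : Fin m → ℝ, f (euclidStep q.2.1 q.2.2 (q.1, d)) :=
    Measurable.mul (by fun_prop) hstep.lintegral_prod_right'
  calc ∫⁻ y in {y | 0 < euclidLead y}, f y
      = ∫⁻ c, ∫⁻ p in {p | 0 < euclidLead (p, c)}, f (p, c) := by
        rw [Measure.volume_eq_prod, setLIntegral_prod_slices_symm _ _
          (measurableSet_lt measurable_const measurable_euclidLead) hf]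
        rfl
    _ = ∫⁻ c, ∫⁻ b, ∫⁻ s in Set.Ioi (0 : ℝ), ENNReal.ofReal (s ^ m) *
          ∫⁻ d : Fin m → ℝ, f (euclidStep b s (c, d)) :=
        lintegral_congr fun c => lintegral_euclidStep c (hf.comp measurable_prodMk_right)
    _ = ∫⁻ s in Set.Ioi (0 : ℝ), ∫⁻ b, ∫⁻ c, ENNReal.ofReal (s ^ m) *
          ∫⁻ d : Fin m → ℝ, f (euclidStep b s (c, d)) := lintegral_rotate _ _ _ hweight
    _ = _ := by
      simp only [lintegral_const_mul' _ _ ENNReal.ofReal_ne_top]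
      refine lintegral_congr fun s => congrArg _ (lintegral_congr fun b => ?_)
      exact (lintegral_prod _ (hf.comp (by fun_prop :
        Measurable fun y : PairCoeffs m => euclidStep b s y)).aemeasurable).symm

lemma setLIntegral_interlacingSet_succ {f : PairCoeffs (m + 1) → ℝ≥0∞} (hf : Measurable f) :
    ∫⁻ y in interlacingSet (m + 1), f y =
      ∫⁻ s in Set.Ioi (0 : ℝ), ENNReal.ofReal (s ^ m) *
        ∫⁻ b, ∫⁻ y in interlacingSet m, f (euclidStep b s y) := by
  have hR := measurableSet_interlacingSet m
  rw [interlacingSet_succ, Set.inter_comm, ← setLIntegral_indicator (measurable_euclidNext hR),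
    setLIntegral_euclidLead_pos (hf.indicator (measurable_euclidNext hR))]
  refine setLIntegral_congr_fun measurableSet_Ioi fun s hs =>
    congrArg _ (lintegral_congr fun b => ?_)
  rw [← lintegral_indicator hR]
  refine lintegral_congr fun y => ?_
  have hmem : euclidStep b s y ∈ euclidNext ⁻¹' interlacingSet m ↔ y ∈ interlacingSet m := by
    rw [Set.mem_preimage, euclidNext_euclidStep b (ne_of_gt hs)]
  classical simp only [Set.indicator_apply, hmem]

lemma setLIntegral_jacobiCoeffs (m : ℕ) {g : PairCoeffs m → ℝ≥0∞} (hg : Measurable g) :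
    ∫⁻ x in jacobiParamSet m, ENNReal.ofReal (jacobiJacobian x.1) * g (jacobiCoeffs m x) =
      ∫⁻ y in interlacingSet m, g y := by
  induction m with
  | zero =>
    have huniv : jacobiParamSet 0 = Set.univ := Set.eq_univ_of_forall fun _ j => j.elim0
    have hpres : MeasurePreserving fun x : (Fin 0 → ℝ) × (Fin 1 → ℝ) => (-x.2, x.1) :=
      ((Measure.measurePreserving_neg volume).prod (.id volume)).comp Measure.measurePreserving_swap
    simp only [huniv, interlacingSet_zero, Measure.restrict_univ, jacobiCoeffs_zero,
      jacobiJacobian, Finset.univ_eq_empty, Finset.prod_empty, ENNReal.ofReal_one, one_mul]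
    exact hpres.lintegral_comp hg
  | succ m ih =>
    have hint : Measurable fun x : (Fin (m + 1) → ℝ) × (Fin (m + 2) → ℝ) =>
        ENNReal.ofReal (jacobiJacobian x.1) * g (jacobiCoeffs (m + 1) x) :=
      (measurable_jacobiJacobian.comp measurable_fst).ennreal_ofReal.mul
        (hg.comp (measurable_jacobiCoeffs _))
    rw [setLIntegral_jacobiParamSet_succ hint, setLIntegral_interlacingSet_succ hg,
      setLIntegral_Ioi_eq_setLIntegral_sq fun s => ENNReal.ofReal (s ^ m) * _]
    refine setLIntegral_congr_fun measurableSet_Ioi fun a0 ha0 => ?_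
    have hpos : 0 < a0 := ha0
    dsimp only
    rw [← mul_assoc, ← ENNReal.ofReal_mul (by positivity),
      ← lintegral_const_mul' _ _ ENNReal.ofReal_ne_top]
    refine lintegral_congr fun b0 => ?_
    have hgstep : Measurable fun y : PairCoeffs m => g (euclidStep b0 (a0 ^ 2) y) :=
      hg.comp (by fun_prop)
    rw [← ih hgstep, ← lintegral_const_mul' _ _ ENNReal.ofReal_ne_top]
    refine lintegral_congr fun x => ?_
    rw [jacobiCoeffs_succ, jacobiJacobian_cons, ← mul_assoc, ENNReal.ofReal_mul (by positivity)]
    congr 3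
    ring

end PairLaw

/-! ### From the pair and the perturbation size to the perturbed polynomial -/

section Perturb

variable {m : ℕ}

/-- The imaginary parts of the coefficients of the perturbed characteristic polynomial
`(1 + i l) p - i l X c`, whose real part is `p`. -/
def perturbCoeffs (l : ℝ) (y : PairCoeffs m) : Fin (m + 1) → ℝ :=
  coeffVec (m + 1) (C l * (monicPoly y.1 - X * monicPoly y.2))

lemma perturbCoeffs_eq_cons (l : ℝ) (y : PairCoeffs m) :
    perturbCoeffs l y = Fin.cons (α := fun _ => ℝ) (l * y.1 0) (l • (Fin.tail y.1 - y.2)) := by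
  ext i
  refine Fin.cases ?_ (fun i => ?_) i
  · simp [perturbCoeffs, coeffVec, coeff_monicPoly]
  · rw [Fin.cons_succ]
    simp [perturbCoeffs, coeffVec, coeff_monicPoly, Fin.tail, Fin.succ]

@[fun_prop]
lemma measurable_perturbCoeffs {α : Type*} [MeasurableSpace α] {l : α → ℝ} {y : α → PairCoeffs m}
    (hl : Measurable l) (hy : Measurable y) : Measurable fun x => perturbCoeffs (l x) (y x) := by
  simp only [perturbCoeffs_eq_cons]
  refine measurable_fin_cons.comp
    (Measurable.prodMk (by fun_prop) (measurable_pi_iff.2 fun i => ?_))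
  simp only [Pi.smul_apply, Pi.sub_apply, Fin.tail]
  fun_prop

lemma lintegral_perturbCoeffs_right {p : Fin (m + 1) → ℝ} (hp : p 0 ≠ 0)
    {f : (Fin (m + 1) → ℝ) → ℝ≥0∞} (hf : Measurable f) :
    ∫⁻ h in {h : Fin (m + 1) → ℝ | 0 < h 0 / p 0}, f h =
      ∫⁻ l in Set.Ioi (0 : ℝ), ENNReal.ofReal (|p 0| * l ^ m) *
        ∫⁻ c : Fin m → ℝ, f (perturbCoeffs l (p, c)) := by
  have hS : MeasurableSet {h : Fin (m + 1) → ℝ | 0 < h 0 / p 0} :=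
    measurableSet_lt measurable_const (by fun_prop)
  rw [← lintegral_indicator hS, lintegral_fin_cons (hf.indicator hS),
    lintegral_eq_mul_lintegral_smul volume _ hp, Module.finrank_self, pow_one,
    ← lintegral_const_mul' _ _ ENNReal.ofReal_ne_top, ← lintegral_indicator measurableSet_Ioi]
  refine lintegral_congr fun l => ?_
  have hmem (w : Fin m → ℝ) : (Fin.cons (α := fun _ => ℝ) (p 0 • l) w : Fin (m + 1) → ℝ) ∈
      {h : Fin (m + 1) → ℝ | 0 < h 0 / p 0} ↔ 0 < l := by
    rw [Set.mem_ofPred_eq, Fin.cons_zero, smul_eq_mul, mul_div_cancel_left₀ _ hp]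
  classical simp only [Set.indicator_apply, hmem, Set.mem_Ioi]
  split_ifs with hl
  · rw [lintegral_eq_mul_lintegral_smul volume _ hl.ne', Module.finrank_fin_fun, abs_of_pos hl,
      ← lintegral_sub_left_eq_self _ (Fin.tail p), ← mul_assoc,
      ← ENNReal.ofReal_mul (abs_nonneg _)]
    simp only [perturbCoeffs_eq_cons, smul_eq_mul, mul_comm l]
  · rw [lintegral_zero, mul_zero]

/-- The second member of the pair, recovered from the real and imaginary coefficients of the
perturbed polynomial; the perturbation size is the quotient of the constant coefficients. -/
def companionCoeffs (q : (Fin (m + 1) → ℝ) × (Fin (m + 1) → ℝ)) : Fin m → ℝ :=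
  fun i => q.1 i.succ - q.2 i.succ / (q.2 0 / q.1 0)

lemma measurable_companionCoeffs : Measurable (companionCoeffs (m := m)) := by
  unfold companionCoeffs
  fun_prop

lemma perturbCoeffs_zero_div {y : PairCoeffs m} (hp : y.1 0 ≠ 0) (l : ℝ) :
    perturbCoeffs l y 0 / y.1 0 = l := by
  rw [perturbCoeffs_eq_cons, Fin.cons_zero, mul_div_cancel_right₀ _ hp]

lemma companionCoeffs_perturbCoeffs {y : PairCoeffs m} (hp : y.1 0 ≠ 0) {l : ℝ} (hl : l ≠ 0) :
    companionCoeffs (y.1, perturbCoeffs l y) = y.2 := by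
  ext i
  simp only [companionCoeffs, perturbCoeffs_zero_div hp]
  rw [perturbCoeffs_eq_cons, Fin.cons_succ, Pi.smul_apply, smul_eq_mul, mul_div_cancel_left₀ _ hl,
    Pi.sub_apply, Fin.tail, sub_sub_cancel]

/-- Real and imaginary parts of the coefficients of perturbed characteristic polynomials. -/
def perturbedSet (m : ℕ) : Set ((Fin (m + 1) → ℝ) × (Fin (m + 1) → ℝ)) :=
  {q | 0 < q.2 0 / q.1 0 ∧ (q.1, companionCoeffs q) ∈ interlacingSet m}

lemma measurableSet_div_zero_pos :
    MeasurableSet {q : (Fin (m + 1) → ℝ) × (Fin (m + 1) → ℝ) | 0 < q.2 0 / q.1 0} :=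
  measurableSet_lt measurable_const (by fun_prop)

lemma measurableSet_companionCoeffs_mem :
    MeasurableSet {q : (Fin (m + 1) → ℝ) × (Fin (m + 1) → ℝ) |
      (q.1, companionCoeffs q) ∈ interlacingSet m} :=
  (measurable_fst.prodMk measurable_companionCoeffs) (measurableSet_interlacingSet m)

lemma measurableSet_perturbedSet (m : ℕ) : MeasurableSet (perturbedSet m) :=
  measurableSet_div_zero_pos.inter measurableSet_companionCoeffs_mem

lemma ae_apply_zero_ne_zero (m : ℕ) : ∀ᵐ p : Fin (m + 1) → ℝ, p 0 ≠ 0 :=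
  (Measure.quasiMeasurePreserving_eval (fun _ : Fin (m + 1) => (volume : Measure ℝ)) 0).ae
    (Measure.ae_ne volume 0)

lemma setLIntegral_div_zero_pos {f : (Fin (m + 1) → ℝ) × (Fin (m + 1) → ℝ) → ℝ≥0∞}
    (hf : Measurable f) :
    ∫⁻ q in {q | 0 < q.2 0 / q.1 0}, f q =
      ∫⁻ y : PairCoeffs m, ∫⁻ l in Set.Ioi (0 : ℝ), ENNReal.ofReal (|y.1 0| * l ^ m) *
        f (y.1, perturbCoeffs l y) := by
  have hint : Measurable fun q : PairCoeffs m × ℝ =>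
      ENNReal.ofReal (|q.1.1 0| * q.2 ^ m) * f (q.1.1, perturbCoeffs q.2 q.1) :=
    Measurable.mul (by fun_prop) (hf.comp (by fun_prop))
  rw [Measure.volume_eq_prod, setLIntegral_prod_slices _ _ measurableSet_div_zero_pos hf,
    Measure.volume_eq_prod, lintegral_prod _ hint.lintegral_prod_right'.aemeasurable]
  refine lintegral_congr_ae ?_
  filter_upwards [ae_apply_zero_ne_zero m] with p hp
  calc ∫⁻ h in {h | 0 < h 0 / p 0}, f (p, h)
      = ∫⁻ l in Set.Ioi (0 : ℝ), ENNReal.ofReal (|p 0| * l ^ m) *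
          ∫⁻ c : Fin m → ℝ, f (p, perturbCoeffs l (p, c)) :=
        lintegral_perturbCoeffs_right hp (hf.comp measurable_prodMk_left)
    _ = ∫⁻ l in Set.Ioi (0 : ℝ), ∫⁻ c : Fin m → ℝ, ENNReal.ofReal (|p 0| * l ^ m) *
          f (p, perturbCoeffs l (p, c)) := by
        simp only [lintegral_const_mul' _ _ ENNReal.ofReal_ne_top]
    _ = _ := lintegral_lintegral_swap (hint.comp (by fun_prop :
        Measurable fun q : ℝ × (Fin m → ℝ) => ((p, q.2), q.1))).aemeasurable

lemma setLIntegral_perturbCoeffs {f : (Fin (m + 1) → ℝ) × (Fin (m + 1) → ℝ) → ℝ≥0∞}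
    (hf : Measurable f) :
    ∫⁻ y in interlacingSet m, ∫⁻ l in Set.Ioi (0 : ℝ), ENNReal.ofReal (|y.1 0| * l ^ m) *
      f (y.1, perturbCoeffs l y) = ∫⁻ q in perturbedSet m, f q := by
  have hR := measurableSet_interlacingSet m
  have hC := measurableSet_companionCoeffs_mem (m := m)
  have hset : perturbedSet m =
      {q | (q.1, companionCoeffs q) ∈ interlacingSet m} ∩ {q | 0 < q.2 0 / q.1 0} :=
    Set.inter_comm _ _
  rw [hset, ← setLIntegral_indicator hC, setLIntegral_div_zero_pos (hf.indicator hC),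
    ← lintegral_indicator hR]
  have hae : ∀ᵐ y : PairCoeffs m, y.1 0 ≠ 0 :=
    Measure.quasiMeasurePreserving_fst.ae (ae_apply_zero_ne_zero m)
  refine lintegral_congr_ae ?_
  filter_upwards [hae] with y hy0
  have hmem : ∀ l ∈ Set.Ioi (0 : ℝ), (y.1, perturbCoeffs l y) ∈
      {q | (q.1, companionCoeffs q) ∈ interlacingSet m} ↔ y ∈ interlacingSet m := fun l hl => by
    rw [Set.mem_ofPred_eq, companionCoeffs_perturbCoeffs hy0 (ne_of_gt hl)]
  by_cases hy : y ∈ interlacingSet m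
  · rw [Set.indicator_of_mem hy]
    refine setLIntegral_congr_fun measurableSet_Ioi fun l hl => ?_
    rw [Set.indicator_of_mem ((hmem l hl).2 hy)]
  · rw [Set.indicator_of_notMem hy]
    refine ((setLIntegral_congr_fun measurableSet_Ioi fun l hl => ?_).trans lintegral_zero).symm
    rw [Set.indicator_of_notMem (mt (hmem l hl).1 hy), mul_zero]

end Perturb

/-! ### From roots to coefficients -/

section Roots

variable {n : ℕ}

/-- The lower coefficients of the monic polynomial with given roots. -/
def rootCoeffs (z : Fin n → ℂ) : Fin n → ℂ := coeffVec n (∏ j, (X - C (z j)))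

/-- The roots of the monic polynomial with given lower coefficients. -/
def rootConfig (c : Fin n → ℂ) : Sym ℂ n :=
  ⟨(monicPoly c).roots, by
    rw [IsAlgClosed.card_roots_eq_natDegree, natDegree_monicPoly]⟩

/-- The square of the absolute value of the Vandermonde determinant. -/
def vandermondeSq (z : Fin n → ℂ) : ℝ :=
  ∏ j, ∏ k ∈ Finset.univ.filter (fun k => j < k), ‖z j - z k‖ ^ 2

/-- Tuples whose real parts are strictly increasing: almost every configuration has exactly one
such enumeration. -/
def sortedTuples (n : ℕ) : Set (Fin n → ℂ) := {z | StrictMono fun i => (z i).re}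

lemma monicPoly_rootCoeffs (z : Fin n → ℂ) : monicPoly (rootCoeffs z) = ∏ j, (X - C (z j)) :=
  monicPoly_coeffVec (monic_prod_X_sub_C _ _) (by
    rw [natDegree_finsetProd_X_sub_C_eq_card, Finset.card_univ, Fintype.card_fin])

lemma roots_prod_X_sub_C_univ (z : Fin n → ℂ) :
    (∏ j, (X - C (z j))).roots = Finset.univ.val.map z := by
  rw [← roots_multiset_prod_X_sub_C (Finset.univ.val.map z), Multiset.map_map]
  rfl

lemma rootConfig_rootCoeffs (z : Fin n → ℂ) : rootConfig (rootCoeffs z) = toConfig z := by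
  refine Subtype.ext ?_
  change (monicPoly (rootCoeffs z)).roots = Finset.univ.val.map z
  rw [monicPoly_rootCoeffs, roots_prod_X_sub_C_univ]

lemma rootConfig_injective : Function.Injective (rootConfig (n := n)) := fun c d h => by
  have hroots : (monicPoly c).roots = (monicPoly d).roots := congrArg Subtype.val h
  rw [← coeffVec_monicPoly c, ← coeffVec_monicPoly d,
    (IsAlgClosed.splits (monicPoly c)).eq_prod_roots_of_monic (monic_monicPoly c), hroots,
    ← (IsAlgClosed.splits (monicPoly d)).eq_prod_roots_of_monic (monic_monicPoly d)]

lemma toConfig_surjective : Function.Surjective (toConfig (n := n)) := by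
  rintro ⟨s, rfl⟩
  obtain ⟨l, rfl⟩ := Quot.exists_rep s
  exact ⟨l.get, Subtype.ext ((Fin.univ_val_map _).trans (congrArg _ (List.ofFn_get l)))⟩

lemma toConfig_comp_perm (z : Fin n → ℂ) (σ : Equiv.Perm (Fin n)) :
    toConfig (z ∘ σ) = toConfig z := by
  refine Subtype.ext ?_
  change Finset.univ.val.map (z ∘ σ) = Finset.univ.val.map z
  rw [← Multiset.map_map, Multiset.map_univ_val_equiv]

lemma rootCoeffs_eq_iff {z w : Fin n → ℂ} :
    rootCoeffs z = rootCoeffs w ↔ toConfig z = toConfig w := by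
  rw [← rootConfig_injective.eq_iff, rootConfig_rootCoeffs, rootConfig_rootCoeffs]

lemma rootCoeffs_surjective : Function.Surjective (rootCoeffs (n := n)) := fun c =>
  (toConfig_surjective (rootConfig c)).imp fun z hz =>
    rootConfig_injective ((rootConfig_rootCoeffs z).trans hz)

lemma rootCoeffs_comp_perm (z : Fin n → ℂ) (σ : Equiv.Perm (Fin n)) :
    rootCoeffs (z ∘ σ) = rootCoeffs z :=
  rootCoeffs_eq_iff.2 (toConfig_comp_perm z σ)

lemma range_eq_of_toConfig_eq {z w : Fin n → ℂ} (h : toConfig z = toConfig w) :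
    Set.range z = Set.range w := by
  have hmap : Finset.univ.val.map z = Finset.univ.val.map w := congrArg Subtype.val h
  ext x
  simpa using congrArg (x ∈ ·) hmap

lemma injOn_rootCoeffs (n : ℕ) : Set.InjOn (rootCoeffs (n := n)) (sortedTuples n) := by
  intro z hz w hw h
  have hrange : Set.range z = Set.range w := range_eq_of_toConfig_eq (rootCoeffs_eq_iff.1 h)
  have hre : (fun i => (z i).re) = fun i => (w i).re := by
    refine (StrictMono.range_inj hz hw).1 ?_
    rw [Set.range_comp' Complex.re z, Set.range_comp' Complex.re w, hrange]
  ext i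
  obtain ⟨k, hk⟩ : z i ∈ Set.range w := hrange ▸ Set.mem_range_self i
  have hki : k = i := StrictMono.injective hw ((congrArg Complex.re hk).trans (congrFun hre i))
  rw [← hk, hki]

lemma differentiable_rootCoeffs (n : ℕ) : Differentiable ℂ (rootCoeffs (n := n)) := by
  have hcoeff (s : Finset (Fin n)) (k : ℕ) :
      Differentiable ℂ fun z : Fin n → ℂ => (∏ j ∈ s, (X - C (z j))).coeff k := by
    induction s using Finset.induction_on generalizing k with
    | empty => simp
    | insert i s hi ih =>
      simp only [Finset.prod_insert hi, coeff_X_sub_C_mul']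
      refine Differentiable.sub ?_ (Differentiable.mul (by fun_prop) (ih k))
      split_ifs
      · exact differentiable_const _
      · exact ih _
  exact differentiable_pi.2 fun i => hcoeff Finset.univ i

lemma measurable_rootCoeffs (n : ℕ) : Measurable (rootCoeffs (n := n)) :=
  (differentiable_rootCoeffs n).continuous.measurable

/-! ### The Jacobian of the coefficients as functions of the roots -/

lemma hasFDerivAt_prod_sub (z : Fin n → ℂ) (x : ℂ) :
    HasFDerivAt (fun z : Fin n → ℂ => ∏ j, (x - z j))
      (∑ j, (∏ k ∈ Finset.univ.erase j, (x - z k)) •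
        (-(ContinuousLinearMap.proj j : (Fin n → ℂ) →L[ℂ] ℂ))) z :=
  HasFDerivAt.finsetProd fun j _ =>
    (ContinuousLinearMap.proj (R := ℂ) (φ := fun _ : Fin n => ℂ) j).hasFDerivAt.const_sub x

lemma sum_fderiv_rootCoeffs (z h : Fin n → ℂ) (x : ℂ) :
    ∑ i : Fin n, x ^ (i : ℕ) * fderiv ℂ rootCoeffs z h i =
      -∑ j, (∏ k ∈ Finset.univ.erase j, (x - z k)) * h j := by
  have heval : (fun z : Fin n → ℂ => x ^ n + ∑ i, rootCoeffs z i * x ^ (i : ℕ)) =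
      fun z => ∏ j, (x - z j) := by
    funext z
    simpa [monicPoly, eval_finsetSum, eval_prod] using congrArg (eval x) (monicPoly_rootCoeffs z)
  have hcoeff (i : Fin n) : HasFDerivAt (fun z => rootCoeffs z i)
      ((ContinuousLinearMap.proj i).comp (fderiv ℂ rootCoeffs z)) z :=
    hasFDerivAt_pi'.1 (differentiable_rootCoeffs n z).hasFDerivAt i
  have hsum : HasFDerivAt (fun z : Fin n → ℂ => x ^ n + ∑ i, rootCoeffs z i * x ^ (i : ℕ))
      (∑ i : Fin n, x ^ (i : ℕ) • (ContinuousLinearMap.proj i).comp (fderiv ℂ rootCoeffs z)) z :=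
    (HasFDerivAt.fun_sum fun i _ => (hcoeff i).mul_const (x ^ (i : ℕ))).const_add _
  rw [heval] at hsum
  simpa using DFunLike.congr_fun (hsum.unique (hasFDerivAt_prod_sub z x)) h

lemma vandermonde_mul_fderiv_rootCoeffs (z : Fin n → ℂ) :
    Matrix.vandermonde z * LinearMap.toMatrix' (fderiv ℂ rootCoeffs z).toLinearMap =
      Matrix.diagonal fun k => -∏ l ∈ Finset.univ.erase k, (z k - z l) := by
  ext k j
  have hsum := sum_fderiv_rootCoeffs z (Pi.single j 1) (z k)
  simp only [Pi.single_apply, mul_ite, mul_one, mul_zero, Finset.sum_ite_eq', Finset.mem_univ,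
    if_true] at hsum
  rw [Matrix.mul_apply, Matrix.diagonal_apply]
  simp only [Matrix.vandermonde_apply, LinearMap.toMatrix'_apply]
  refine hsum.trans ?_
  split_ifs with hkj
  · rw [hkj]
  · rw [Finset.prod_eq_zero (Finset.mem_erase.2 ⟨hkj, Finset.mem_univ k⟩) (sub_self _), neg_zero]

lemma vandermondeSq_eq_prod_erase (z : Fin n → ℂ) :
    vandermondeSq z = ∏ k, ∏ l ∈ Finset.univ.erase k, ‖z k - z l‖ := by
  simp only [vandermondeSq, Finset.filter_lt_eq_Ioi, sq, ← Finset.compl_singleton]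
  refine .trans ?_ <|
    Finset.prod_prod_Ioi_mul_eq_prod_prod_off_diag fun l k : Fin n => ‖z k - z l‖
  exact Finset.prod_congr rfl fun k _ => Finset.prod_congr rfl fun l _ => by rw [norm_sub_rev (z l)]

lemma vandermondeSq_eq_norm_det_sq (z : Fin n → ℂ) :
    vandermondeSq z = ‖(Matrix.vandermonde z).det‖ ^ 2 := by
  simp only [vandermondeSq, Finset.filter_lt_eq_Ioi, Matrix.det_vandermonde, norm_prod,
    ← Finset.prod_pow, norm_sub_rev]

lemma vandermondeSq_nonneg (z : Fin n → ℂ) : 0 ≤ vandermondeSq z := by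
  rw [vandermondeSq_eq_norm_det_sq]
  positivity

lemma vandermondeSq_comp_perm (z : Fin n → ℂ) (σ : Equiv.Perm (Fin n)) :
    vandermondeSq (z ∘ σ) = vandermondeSq z := by
  have hdet : (Matrix.vandermonde (z ∘ σ)).det =
      Equiv.Perm.sign σ * (Matrix.vandermonde z).det :=
    Matrix.det_permute σ (Matrix.vandermonde z)
  rw [vandermondeSq_eq_norm_det_sq, vandermondeSq_eq_norm_det_sq, hdet, norm_mul]
  rcases Int.units_eq_one_or (Equiv.Perm.sign σ) with h | h <;> simp [h]

@[fun_prop]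
lemma measurable_vandermondeSq (n : ℕ) : Measurable (vandermondeSq (n := n)) := by
  unfold vandermondeSq
  fun_prop

lemma normSq_det_fderiv_rootCoeffs {z : Fin n → ℂ} (hz : Function.Injective z) :
    Complex.normSq (fderiv ℂ rootCoeffs z).det = vandermondeSq z := by
  have hV : ‖(Matrix.vandermonde z).det‖ ≠ 0 :=
    norm_ne_zero_iff.2 (Matrix.det_vandermonde_ne_zero_iff.2 hz)
  have hdet : ‖(Matrix.vandermonde z).det‖ * ‖(fderiv ℂ rootCoeffs z).det‖ =
      ‖(Matrix.vandermonde z).det‖ * ‖(Matrix.vandermonde z).det‖ := by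
    rw [← sq, ← vandermondeSq_eq_norm_det_sq, vandermondeSq_eq_prod_erase,
      ContinuousLinearMap.det, ← LinearMap.det_toMatrix', ← norm_mul, ← Matrix.det_mul,
      vandermonde_mul_fderiv_rootCoeffs, Matrix.det_diagonal]
    simp only [norm_prod, norm_neg]
  rw [Complex.normSq_eq_norm_sq, mul_left_cancel₀ hV hdet, vandermondeSq_eq_norm_det_sq]

lemma measurableSet_sortedTuples (n : ℕ) : MeasurableSet (sortedTuples n) := by
  simp only [sortedTuples, StrictMono, Set.ofPred_forall]
  exact MeasurableSet.iInter fun i => MeasurableSet.iInter fun j => MeasurableSet.iInter fun _ =>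
    measurableSet_lt (by fun_prop) (by fun_prop)

lemma setLIntegral_image_rootCoeffs (g : (Fin n → ℂ) → ℝ≥0∞) :
    ∫⁻ c in rootCoeffs '' sortedTuples n, g c =
      ∫⁻ z in sortedTuples n, ENNReal.ofReal (vandermondeSq z) * g (rootCoeffs z) := by
  rw [lintegral_image_eq_lintegral_abs_det_fderiv_mul volume (measurableSet_sortedTuples n)
    (f' := fun z => (fderiv ℂ rootCoeffs z).restrictScalars ℝ)
    (fun z _ => ((differentiable_rootCoeffs n z).hasFDerivAt.restrictScalars ℝ).hasFDerivWithinAt)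
    (injOn_rootCoeffs n)]
  refine setLIntegral_congr_fun (measurableSet_sortedTuples n) fun z hz => ?_
  have hinj : Function.Injective z := fun i j hij => StrictMono.injective hz (by simp [hij])
  have hdet : ((fderiv ℂ rootCoeffs z).restrictScalars ℝ).det = vandermondeSq z := by
    rw [← normSq_det_fderiv_rootCoeffs hinj, ← Algebra.norm_complex_apply,
      ContinuousLinearMap.det, ContinuousLinearMap.det, ← LinearMap.det_restrictScalars]
    rfl
  simp only [hdet, abs_of_nonneg (vandermondeSq_nonneg z)]

/-! ### Sorting the roots -/

/-- Tuples with distinct real parts. -/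
def separatedTuples (n : ℕ) : Set (Fin n → ℂ) := {z | Function.Injective fun i => (z i).re}

lemma volume_re_eq {i j : Fin n} (hij : i ≠ j) :
    volume {z : Fin n → ℂ | (z i).re = (z j).re} = 0 := by
  let f : (Fin n → ℂ) →ₗ[ℝ] ℝ :=
    Complex.reLm ∘ₗ LinearMap.proj i - Complex.reLm ∘ₗ LinearMap.proj j
  have hker : {z : Fin n → ℂ | (z i).re = (z j).re} = (LinearMap.ker f : Set (Fin n → ℂ)) := by
    ext z
    simp [f, sub_eq_zero]
  rw [hker]
  refine Measure.addHaar_submodule _ _ fun htop => ?_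
  have hsingle : f (Pi.single i (1 : ℂ)) = 0 := LinearMap.mem_ker.1 (htop ▸ Submodule.mem_top)
  simp [f, Pi.single_eq_of_ne hij.symm] at hsingle

lemma ae_mem_separatedTuples (n : ℕ) : ∀ᵐ z : Fin n → ℂ, z ∈ separatedTuples n := by
  have hne : ∀ᵐ z : Fin n → ℂ, ∀ i j, i ≠ j → (z i).re ≠ (z j).re :=
    ae_all_iff.2 fun i => ae_all_iff.2 fun j => Filter.eventually_all.2 fun hij => by
      simpa [ae_iff] using volume_re_eq hij
  filter_upwards [hne] with z hz i j hij
  by_contra h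
  exact hz i j h hij

lemma exists_perm_mem_sortedTuples {z : Fin n → ℂ} (hz : z ∈ separatedTuples n) :
    ∃ σ : Equiv.Perm (Fin n), z ∘ σ ∈ sortedTuples n :=
  ⟨Tuple.sort fun i => (z i).re, (Tuple.monotone_sort fun i => (z i).re).strictMono_of_injective
    (Function.Injective.comp hz (Equiv.injective _))⟩

lemma volume_compl_image_rootCoeffs (n : ℕ) : volume (rootCoeffs '' sortedTuples n)ᶜ = 0 := by
  have hsub : (rootCoeffs '' sortedTuples n)ᶜ ⊆ rootCoeffs '' (separatedTuples n)ᶜ := fun c hc => by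
    obtain ⟨z, rfl⟩ := rootCoeffs_surjective c
    refine ⟨z, fun hz => hc ?_, rfl⟩
    obtain ⟨σ, hσ⟩ := exists_perm_mem_sortedTuples hz
    exact ⟨z ∘ σ, hσ, rootCoeffs_comp_perm z σ⟩
  exact measure_mono_null hsub <|
    addHaar_image_eq_zero_of_differentiableOn_of_addHaar_eq_zero volume
      ((differentiable_rootCoeffs n).restrictScalars ℝ).differentiableOn (ae_mem_separatedTuples n)

lemma restrict_image_rootCoeffs (n : ℕ) :
    (volume : Measure (Fin n → ℂ)).restrict (rootCoeffs '' sortedTuples n) = volume :=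
  Measure.restrict_eq_self_of_ae_mem (volume_compl_image_rootCoeffs n)

lemma measurePreserving_comp_perm (σ : Equiv.Perm (Fin n)) :
    MeasurePreserving (fun z : Fin n → ℂ => z ∘ σ) :=
  volume_preserving_arrowCongr' σ.symm (MeasurableEquiv.refl ℂ) (.id _)

lemma ae_eq_sum_perm_indicator {g : (Fin n → ℂ) → ℝ≥0∞}
    (hsymm : ∀ (z : Fin n → ℂ) (σ : Equiv.Perm (Fin n)), g (z ∘ σ) = g z) :
    ∀ᵐ z : Fin n → ℂ, g z = ∑ σ : Equiv.Perm (Fin n), (sortedTuples n).indicator g (z ∘ σ) := by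
  filter_upwards [ae_mem_separatedTuples n] with z hz
  obtain ⟨σ, hσ⟩ := exists_perm_mem_sortedTuples hz
  rw [Finset.sum_eq_single_of_mem σ (Finset.mem_univ σ), Set.indicator_of_mem hσ, hsymm]
  refine fun τ _ hτσ => Set.indicator_of_notMem (fun hτ => hτσ ?_) _
  have hcomp : z ∘ τ = z ∘ σ :=
    injOn_rootCoeffs n hτ hσ (by rw [rootCoeffs_comp_perm, rootCoeffs_comp_perm])
  have hinj : Function.Injective z := fun i j hij => hz (by simp [hij])
  exact Equiv.ext fun i => hinj (congrFun hcomp i)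

lemma lintegral_eq_factorial_mul {g : (Fin n → ℂ) → ℝ≥0∞} (hg : Measurable g)
    (hsymm : ∀ (z : Fin n → ℂ) (σ : Equiv.Perm (Fin n)), g (z ∘ σ) = g z) :
    ∫⁻ z, g z = (n.factorial : ℝ≥0∞) * ∫⁻ z in sortedTuples n, g z := by
  have hT := measurableSet_sortedTuples n
  have hperm (σ : Equiv.Perm (Fin n)) : ∫⁻ z, (sortedTuples n).indicator g (z ∘ σ) =
      ∫⁻ z in sortedTuples n, g z := by
    rw [(measurePreserving_comp_perm σ).lintegral_comp (hg.indicator hT), lintegral_indicator hT]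
  rw [lintegral_congr_ae (ae_eq_sum_perm_indicator hsymm),
    lintegral_finsetSum (f := fun (σ : Equiv.Perm (Fin n)) z =>
      (sortedTuples n).indicator g (z ∘ σ)) _ fun σ _ =>
      (hg.indicator hT).comp (measurePreserving_comp_perm σ).measurable]
  simp only [hperm, Finset.sum_const, Finset.card_univ, Fintype.card_perm, Fintype.card_fin,
    nsmul_eq_mul]

lemma measurable_toConfig (n : ℕ) : Measurable (toConfig (n := n)) := fun _ hA => hA

lemma measurableSet_image_rootCoeffs {S : Set (Fin n → ℂ)} (hS : MeasurableSet S) :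
    MeasurableSet (rootCoeffs '' (sortedTuples n ∩ S)) :=
  ((measurableSet_sortedTuples n).inter hS).image_of_continuousOn_injOn
    (differentiable_rootCoeffs n).continuous.continuousOn
    ((injOn_rootCoeffs n).mono Set.inter_subset_left)

lemma aemeasurable_rootConfig (n : ℕ) :
    AEMeasurable (rootConfig (n := n)) (volume : Measure (Fin n → ℂ)) := by
  have himage : MeasurableSet (rootCoeffs '' sortedTuples n) := by
    simpa using measurableSet_image_rootCoeffs (n := n) MeasurableSet.univ
  rw [← restrict_image_rootCoeffs n]
  refine aemeasurable_restrict_of_measurable_subtype himage fun A hA =>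
    ⟨_, measurableSet_image_rootCoeffs (measurable_toConfig n hA), ?_⟩
  ext ⟨_, z, hz, rfl⟩
  simp only [Set.mem_preimage, rootConfig_rootCoeffs]
  refine ⟨?_, fun hzA => ⟨z, ⟨hz, hzA⟩, rfl⟩⟩
  rintro ⟨w, ⟨-, hwA⟩, hwz⟩
  rwa [← rootCoeffs_eq_iff.1 hwz]

lemma lintegral_eq_lintegral_rootCoeffs {g : (Fin n → ℂ) → ℝ≥0∞}
    (hg : Measurable fun z : Fin n → ℂ => g (rootCoeffs z)) :
    ∫⁻ c, g c =
      ∫⁻ z : Fin n → ℂ, (n.factorial : ℝ≥0∞)⁻¹ *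
        (ENNReal.ofReal (vandermondeSq z) * g (rootCoeffs z)) := by
  have hfact : (n.factorial : ℝ≥0∞) ≠ 0 := Nat.cast_ne_zero.2 n.factorial_ne_zero
  have hmeas : Measurable fun z : Fin n → ℂ =>
      ENNReal.ofReal (vandermondeSq z) * g (rootCoeffs z) :=
    (measurable_vandermondeSq n).ennreal_ofReal.mul hg
  rw [← restrict_image_rootCoeffs n, setLIntegral_image_rootCoeffs, restrict_image_rootCoeffs,
    lintegral_const_mul' _ _ (ENNReal.inv_ne_top.2 hfact),
    lintegral_eq_factorial_mul hmeas fun z σ => ?_, ← mul_assoc,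
    ENNReal.inv_mul_cancel hfact (ENNReal.natCast_ne_top _), one_mul]
  rw [vandermondeSq_comp_perm, rootCoeffs_comp_perm]

lemma map_rootConfig_withDensity {ρ : (Fin n → ℂ) → ℝ≥0∞} (hρ : Measurable ρ) :
    (volume.withDensity ρ).map rootConfig =
      (volume.withDensity fun z : Fin n → ℂ => (n.factorial : ℝ≥0∞)⁻¹ *
        (ENNReal.ofReal (vandermondeSq z) * ρ (rootCoeffs z))).map toConfig := by
  ext A hA
  have hA' : MeasurableSet (toConfig (n := n) ⁻¹' A) := measurable_toConfig n hA
  have hnull := (aemeasurable_rootConfig n).nullMeasurableSet_preimage hA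
  have hmem (z : Fin n → ℂ) : rootCoeffs z ∈ rootConfig ⁻¹' A ↔ z ∈ toConfig ⁻¹' A := by
    rw [Set.mem_preimage, rootConfig_rootCoeffs, Set.mem_preimage]
  have hind (z : Fin n → ℂ) : (rootConfig ⁻¹' A).indicator ρ (rootCoeffs z) =
      (toConfig ⁻¹' A).indicator (fun z => ρ (rootCoeffs z)) z := by
    classical simp only [Set.indicator_apply, hmem]
  rw [Measure.map_apply_of_aemeasurable
      ((aemeasurable_rootConfig n).mono_ac (withDensity_absolutelyContinuous _ _)) hA,
    Measure.map_apply (measurable_toConfig n) hA, withDensity_apply _ hA',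
    withDensity_apply₀ _ hnull, ← lintegral_indicator₀ hnull, ← lintegral_indicator hA',
    lintegral_eq_lintegral_rootCoeffs]
  · simp only [hind, Set.indicator_const_mul, Set.indicator_mul_right]
  · simp only [hind]
    exact (hρ.comp (measurable_rootCoeffs n)).indicator hA'

end Roots

/-! ### The normalization -/

/-- The total mass of `coefficientMeasure β (m + 1)`. -/
def totalMass (β : ℝ) (m : ℕ) : ℝ :=
  (∏ j ∈ Finset.Icc 1 m, 1 / 2 * Real.Gamma (β * j / 2)) * (2 * Real.pi) ^ (((m : ℝ) + 1) / 2)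

lemma totalMass_pos {β : ℝ} (hβ : 0 < β) (m : ℕ) : 0 < totalMass β m := by
  refine mul_pos (Finset.prod_pos fun j hj => ?_) (by positivity)
  have hj' : (0 : ℝ) < j := Nat.cast_pos.2 (Finset.mem_Icc.1 hj).1
  exact mul_pos one_half_pos (Real.Gamma_pos_of_pos (by positivity))

lemma restrict_jacobiParamSet (m : ℕ) :
    volume.restrict (jacobiParamSet m) =
      (Measure.pi fun _ : Fin m => volume.restrict (Set.Ioi (0 : ℝ))).prod
        (Measure.pi fun _ : Fin (m + 1) => (volume : Measure ℝ)) := by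
  have hset : jacobiParamSet m = Set.univ.pi (fun _ => Set.Ioi (0 : ℝ)) ×ˢ Set.univ := by
    ext x
    simp
  rw [hset, Measure.volume_eq_prod, ← Measure.prod_restrict, volume_pi, volume_pi,
    Measure.restrict_pi_pi, Measure.restrict_univ]

lemma coefficientWeight_eq_prod (β : ℝ) (m : ℕ) (x : (Fin m → ℝ) × (Fin (m + 1) → ℝ)) :
    coefficientWeight β (m + 1) x =
      (∏ j : Fin m, x.1 j ^ (β * (m - (j : ℕ) : ℕ) - 1) * Real.exp (-x.1 j ^ (2 : ℝ))) *
        ∏ i, Real.exp (-(1 / 2) * x.2 i ^ 2) := by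
  have hcast (j : Fin m) : (((m + 1 : ℕ) : ℝ) - ((j : ℕ) + 1)) = (m - (j : ℕ) : ℕ) := by
    rw [Nat.cast_sub j.2.le]
    push_cast
    ring
  simp only [coefficientWeight, hcast, Real.rpow_two, Finset.prod_mul_distrib,
    ← Real.exp_sum, Finset.sum_neg_distrib, ← Finset.mul_sum, mul_assoc, ← Real.exp_add]
  congr 2
  exact (sub_eq_add_neg _ _).trans (congrArg _ (neg_mul _ _).symm)

lemma prod_fin_sub_eq_prod_Icc {M : Type*} [CommMonoid M] (f : ℕ → M) (m : ℕ) :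
    ∏ j : Fin m, f (m - j) = ∏ j ∈ Finset.Icc 1 m, f j := by
  rw [← Finset.prod_range fun j => f (m - j), Finset.range_eq_Ico,
    Finset.prod_Ico_reflect f 0 m.le_succ, Nat.add_sub_cancel_left, Nat.sub_zero,
    Finset.Ico_add_one_right_eq_Icc]

lemma integrableOn_coefficientWeight {β : ℝ} (hβ : 0 < β) (m : ℕ) :
    IntegrableOn (fun x : (Fin m → ℝ) × (Fin (m + 1) → ℝ) => coefficientWeight β (m + 1) x)
      (jacobiParamSet m) := by
  have hpos (j : Fin m) : 0 < β * (m - (j : ℕ) : ℕ) :=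
    mul_pos hβ (Nat.cast_pos.2 (Nat.sub_pos_of_lt j.2))
  have hIoi (j : Fin m) : IntegrableOn
      (fun t : ℝ => t ^ (β * (m - (j : ℕ) : ℕ) - 1) * Real.exp (-t ^ (2 : ℝ))) (Set.Ioi 0) :=
    integrableOn_rpow_mul_exp_neg_rpow (by linarith [hpos j]) two_pos
  simp only [IntegrableOn, restrict_jacobiParamSet, coefficientWeight_eq_prod]
  exact (Integrable.fintype_prod hIoi).mul_prod
    (.fintype_prod fun _ => integrable_exp_neg_mul_sq one_half_pos)

lemma setIntegral_coefficientWeight {β : ℝ} (hβ : 0 < β) (m : ℕ) :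
    ∫ x in jacobiParamSet m, coefficientWeight β (m + 1) x = totalMass β m := by
  have hpos (j : Fin m) : 0 < β * (m - (j : ℕ) : ℕ) :=
    mul_pos hβ (Nat.cast_pos.2 (Nat.sub_pos_of_lt j.2))
  have hIoi (j : Fin m) :
      ∫ t in Set.Ioi (0 : ℝ), t ^ (β * (m - (j : ℕ) : ℕ) - 1) * Real.exp (-t ^ (2 : ℝ)) =
        1 / 2 * Real.Gamma (β * (m - (j : ℕ) : ℕ) / 2) := by
    rw [integral_rpow_mul_exp_neg_rpow two_pos (by linarith [hpos j]), sub_add_cancel]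
  have hgauss : ∫ t : ℝ, Real.exp (-(1 / 2) * t ^ 2) = (2 * Real.pi) ^ (1 / 2 : ℝ) := by
    rw [integral_gaussian, ← Real.sqrt_eq_rpow, div_div_eq_mul_div, div_one, mul_comm]
  let f (j : Fin m) (t : ℝ) := t ^ (β * (m - (j : ℕ) : ℕ) - 1) * Real.exp (-t ^ (2 : ℝ))
  let g (t : ℝ) := Real.exp (-(1 / 2) * t ^ 2)
  simp only [restrict_jacobiParamSet, coefficientWeight_eq_prod]
  refine (integral_prod_mul (fun a : Fin m → ℝ => ∏ j, f j (a j))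
    (fun b : Fin (m + 1) → ℝ => ∏ i, g (b i))).trans ?_
  rw [integral_fintype_prod_eq_prod f, integral_fintype_prod_eq_pow g, hgauss, Fintype.card_fin,
    Finset.prod_congr rfl fun j _ => hIoi j,
    prod_fin_sub_eq_prod_Icc fun j : ℕ => 1 / 2 * Real.Gamma (β * j / 2), totalMass,
    ← Real.rpow_mul_natCast (by positivity)]
  congr 2
  push_cast
  ring

lemma coefficientMeasure_univ {β : ℝ} (hβ : 0 < β) (m : ℕ) :
    coefficientMeasure β (m + 1) Set.univ = ENNReal.ofReal (totalMass β m) := by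
  have hnonneg : ∀ᵐ x ∂volume.restrict (jacobiParamSet m), 0 ≤ coefficientWeight β (m + 1) x := by
    filter_upwards [ae_restrict_mem (measurableSet_jacobiParamSet m)] with x hx
    exact mul_nonneg (Finset.prod_nonneg fun j _ => Real.rpow_nonneg (hx j).le _)
      (Real.exp_nonneg _)
  rw [coefficientMeasure, withDensity_apply _ MeasurableSet.univ, Measure.restrict_univ,
    ← setIntegral_coefficientWeight hβ]
  exact (ofReal_integral_eq_lintegral_ofReal (integrableOn_coefficientWeight hβ m) hnonneg).symm

lemma Gamma_one_add_mul_div {x : ℝ} (hx : 0 < x) {j : ℕ} (hj : 0 < j) :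
    Real.Gamma (1 + x * j) / Real.Gamma (1 + x) = j * (Real.Gamma (x * j) / Real.Gamma x) := by
  have hxj : x * j ≠ 0 := by positivity
  have hΓ := (Real.Gamma_pos_of_pos hx).ne'
  rw [add_comm, Real.Gamma_add_one hxj, add_comm, Real.Gamma_add_one hx.ne']
  field_simp

lemma normConst_eq {β : ℝ} (hβ : 0 < β) (m : ℕ) :
    normConst β (m + 1) = (m + 1).factorial * 2 ^ m * 2 ^ (((m : ℝ) + 1) * (β / 2 - 1)) *
      totalMass β m := by
  have hΓm : Real.Gamma (β * (m + 1 : ℕ) / 2) ≠ 0 := (Real.Gamma_pos_of_pos (by positivity)).ne'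
  have hprod : ∏ j ∈ Finset.Icc 1 (m + 1), Real.Gamma (1 + β * j / 2) / Real.Gamma (1 + β / 2) =
      (m + 1).factorial * ((∏ j ∈ Finset.Icc 1 m, Real.Gamma (β * j / 2)) *
        Real.Gamma (β * (m + 1 : ℕ) / 2) / Real.Gamma (β / 2) ^ (m + 1)) := by
    rw [← Finset.prod_Icc_succ_top (by omega) fun j : ℕ => Real.Gamma (β * j / 2),
      ← Finset.prod_Ico_id_eq_factorial, Finset.Ico_add_one_right_eq_Icc, Nat.cast_prod]
    calc _ = ∏ j ∈ Finset.Icc 1 (m + 1),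
          (j : ℝ) * (Real.Gamma (β * j / 2) / Real.Gamma (β / 2)) := by
          refine Finset.prod_congr rfl fun j hj => ?_
          simpa only [div_mul_eq_mul_div] using
            Gamma_one_add_mul_div (half_pos hβ) (Finset.mem_Icc.1 hj).1
      _ = _ := by
          rw [Finset.prod_mul_distrib, Finset.prod_div_distrib, Finset.prod_const, Nat.card_Icc,
            Nat.add_sub_cancel]
  rw [normConst, gConst, cConst, totalMass, hprod, Finset.prod_mul_distrib, Finset.prod_const,
    Nat.card_Icc, Nat.add_sub_cancel]
  have hΓ := (Real.Gamma_pos_of_pos (half_pos hβ)).ne'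
  push_cast at hΓm ⊢
  field_simp [hΓ]
  rw [mul_assoc, ← mul_pow, mul_one_div_cancel two_ne_zero, one_pow, mul_one]

/-! ### Resultants -/

/-- The product of the absolute values of `g` over the roots of `f`; for monic `f` this is the
absolute value of the resultant of `f` and `g`. -/
def rootProdNorm (f g : ℂ[X]) : ℝ := (f.roots.map fun x => ‖g.eval x‖).prod

lemma rootProdNorm_eq_prod_roots (f : ℂ[X]) {g : ℂ[X]} (hg : g.Monic) :
    rootProdNorm f g = (f.roots.map fun x => (g.roots.map fun y => ‖x - y‖).prod).prod := by
  refine congrArg _ (Multiset.map_congr rfl fun x _ => ?_)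
  rw [(IsAlgClosed.splits g).eval_eq_prod_roots_of_monic hg]
  exact (map_multiset_prod (normHom : ℂ →*₀ ℝ) _).trans (by rw [Multiset.map_map]; rfl)

lemma rootProdNorm_comm {f g : ℂ[X]} (hf : f.Monic) (hg : g.Monic) :
    rootProdNorm f g = rootProdNorm g f := by
  simp only [rootProdNorm_eq_prod_roots f hg, rootProdNorm_eq_prod_roots g hf, norm_sub_rev,
    Multiset.prod_map_prod_map f.roots]

lemma rootProdNorm_eq_mul_of_eval_eq {f g h : ℂ[X]} (s : ℂ)
    (hs : ∀ x, f.eval x = 0 → g.eval x = s * h.eval x) :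
    rootProdNorm f g = ‖s‖ ^ f.natDegree * rootProdNorm f h := by
  rw [rootProdNorm, rootProdNorm, ← IsAlgClosed.card_roots_eq_natDegree (p := f),
    ← Multiset.prod_replicate, ← Multiset.map_const', ← Multiset.prod_map_mul]
  refine congrArg _ (Multiset.map_congr rfl fun x hx => ?_)
  rw [hs x (isRoot_of_mem_roots hx), norm_mul]

lemma rootProdNorm_prod_X_sub_C {n : ℕ} (z : Fin n → ℂ) (g : ℂ[X]) :
    rootProdNorm (∏ j, (X - C (z j))) g = ∏ j, ‖g.eval (z j)‖ := by
  rw [rootProdNorm, roots_prod_X_sub_C_univ, Multiset.map_map]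
  rfl

lemma rootProdNorm_jacobiPolys (m : ℕ) (a : Fin m → ℝ) (b : Fin (m + 1) → ℝ) :
    rootProdNorm ((jacobiPolys m a b).2.map (algebraMap ℝ ℂ))
      ((jacobiPolys m a b).1.map (algebraMap ℝ ℂ)) =
      ∏ j, a j ^ (2 * ((j.rev : ℕ) + 1)) := by
  induction m with
  | zero => simp [rootProdNorm, jacobiPolys]
  | succ m ih =>
    obtain ⟨⟨hp, hpd⟩, hc, -⟩ := monic_jacobiPolys m (Fin.tail a) (Fin.tail b)
    set p := (jacobiPolys m (Fin.tail a) (Fin.tail b)).1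
    set c := (jacobiPolys m (Fin.tail a) (Fin.tail b)).2
    have heval (x : ℂ) (hx : (p.map (algebraMap ℝ ℂ)).eval x = 0) :
        ((jacobiPolys (m + 1) a b).1.map (algebraMap ℝ ℂ)).eval x =
          -((a 0 : ℂ) ^ 2) * (c.map (algebraMap ℝ ℂ)).eval x := by
      rw [jacobiPolys, Polynomial.map_sub, Polynomial.map_mul, eval_sub, eval_mul, hx]
      simp [c]
    calc _ = (a 0 ^ 2) ^ (m + 1) *
          rootProdNorm (p.map (algebraMap ℝ ℂ)) (c.map (algebraMap ℝ ℂ)) := by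
          have hstep := rootProdNorm_eq_mul_of_eval_eq _ heval
          rwa [natDegree_map, hpd, norm_neg, norm_pow, Complex.norm_real, Real.norm_eq_abs,
            sq_abs] at hstep
      _ = _ := by
          rw [rootProdNorm_comm (hp.map _) (hc.map _), ih, Fin.prod_univ_succ, ← pow_mul,
            Fin.rev_zero, Fin.val_last]
          simp only [Fin.tail, Fin.rev_succ, Fin.val_castSucc]

lemma map_conj_map_ofReal (p : ℝ[X]) :
    (p.map (algebraMap ℝ ℂ)).map (starRingEnd ℂ) = p.map (algebraMap ℝ ℂ) := by
  rw [Polynomial.map_map]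
  congr 1
  ext x
  exact Complex.conj_ofReal x

lemma prod_X_sub_C_conj {n : ℕ} {p r : ℝ[X]} {z : Fin n → ℂ}
    (hχ : ∏ j, (X - C (z j)) =
      p.map (algebraMap ℝ ℂ) + C Complex.I * r.map (algebraMap ℝ ℂ)) :
    ∏ j, (X - C ((starRingEnd ℂ) (z j))) =
      p.map (algebraMap ℝ ℂ) - C Complex.I * r.map (algebraMap ℝ ℂ) := by
  have hconj := congrArg (Polynomial.map (starRingEnd ℂ)) hχ
  simpa only [Polynomial.map_prod, Polynomial.map_sub, Polynomial.map_add, Polynomial.map_mul,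
    map_X, map_C, map_conj_map_ofReal, Complex.conj_I, C_neg, neg_mul, ← sub_eq_add_neg] using hconj

lemma prod_norm_sub_conj_eq_rootProdNorm {n : ℕ} {p r : ℝ[X]} {z : Fin n → ℂ}
    (hχ : ∏ j, (X - C (z j)) =
      p.map (algebraMap ℝ ℂ) + C Complex.I * r.map (algebraMap ℝ ℂ)) :
    ∏ j, ∏ k, ‖z j - (starRingEnd ℂ) (z k)‖ =
      2 ^ n * rootProdNorm (∏ j, (X - C (z j))) (p.map (algebraMap ℝ ℂ)) := by
  have heval (x : ℂ) : ∏ k, (x - (starRingEnd ℂ) (z k)) =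
      2 * (p.map (algebraMap ℝ ℂ)).eval x - ∏ k, (x - z k) := by
    have hz := congrArg (eval x) hχ
    have hconj := congrArg (eval x) (prod_X_sub_C_conj hχ)
    simp only [eval_prod, eval_sub, eval_X, eval_C, eval_add, eval_mul] at hz hconj
    rw [hz, hconj]
    ring
  rw [rootProdNorm_prod_X_sub_C, ← Fin.prod_const, ← Finset.prod_mul_distrib]
  refine Finset.prod_congr rfl fun j _ => ?_
  rw [← norm_prod, heval, Finset.prod_eq_zero (Finset.mem_univ j) (sub_self (z j)), sub_zero,
    norm_mul, Complex.norm_ofNat]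

lemma prod_norm_sub_conj {m : ℕ} {p c : ℝ[X]} (hc : c.Monic) (hcd : c.natDegree = m)
    {l : ℝ} (hl : 0 < l) {z : Fin (m + 1) → ℂ}
    (hχ : ∏ j, (X - C (z j)) = p.map (algebraMap ℝ ℂ) +
      C Complex.I * (C l * (p - X * c)).map (algebraMap ℝ ℂ)) :
    ∏ j, ∏ k, ‖z j - (starRingEnd ℂ) (z k)‖ = (2 * l) ^ (m + 1) * |p.eval 0| *
      rootProdNorm (c.map (algebraMap ℝ ℂ)) (p.map (algebraMap ℝ ℂ)) := by
  rw [prod_norm_sub_conj_eq_rootProdNorm hχ]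
  set s : ℂ := 1 + Complex.I * l with hs
  have hs0 : s ≠ 0 := fun h => by simpa [hs] using congrArg Complex.re h
  set P := p.map (algebraMap ℝ ℂ) with hP
  set Q := c.map (algebraMap ℝ ℂ)
  set K := ∏ j, (X - C (z j)) with hK
  have hKd : K.natDegree = m + 1 := by
    rw [hK, natDegree_finsetProd_X_sub_C_eq_card, Finset.card_univ, Fintype.card_fin]
  have heval (x : ℂ) : K.eval x = s * P.eval x - Complex.I * l * (X * Q).eval x := by
    simp only [hχ, Polynomial.map_mul, Polynomial.map_sub, map_C, map_X, eval_add, eval_mul,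
      eval_sub, eval_C, eval_X, hs, P, Q, Complex.coe_algebraMap]
    ring
  have hKP : rootProdNorm K P = (l / ‖s‖) ^ (m + 1) * rootProdNorm K (X * Q) := by
    rw [rootProdNorm_eq_mul_of_eval_eq (Complex.I * l / s) fun x hx => ?_, hKd, norm_div, norm_mul,
      Complex.norm_I, one_mul, Complex.norm_of_nonneg hl.le]
    rw [div_mul_eq_mul_div, eq_div_iff hs0]
    linear_combination hx - heval x
  have hKXQ : rootProdNorm K (X * Q) = (∏ j, ‖z j‖) * rootProdNorm K Q := by
    simp only [hK, rootProdNorm_prod_X_sub_C, ← Finset.prod_mul_distrib, eval_mul, eval_X, norm_mul]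
  have hprod : ∏ j, ‖z j‖ = ‖s‖ * |p.eval 0| := by
    have hP0 : ‖P.eval 0‖ = |p.eval 0| := by
      rw [hP, ← Complex.ofReal_zero, eval_map_algebraMap_ofReal, Complex.norm_real,
        Real.norm_eq_abs]
    simpa only [hK, eval_prod, norm_prod, eval_sub, eval_mul, eval_X, eval_C, zero_sub, norm_neg,
      zero_mul, mul_zero, sub_zero, norm_mul, hP0] using congrArg norm (heval 0)
  have hKQ : rootProdNorm K Q = ‖s‖ ^ m * rootProdNorm Q P := by
    rw [rootProdNorm_comm (monic_prod_X_sub_C _ _) (hc.map _),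
      rootProdNorm_eq_mul_of_eval_eq s fun x hx => ?_, natDegree_map, hcd]
    rw [heval, eval_mul, hx, mul_zero, mul_zero, sub_zero]
  rw [hKP, hKXQ, hprod, hKQ, div_pow, mul_pow]
  field_simp [norm_ne_zero_iff.2 hs0]
  ring

/-! ### Real and imaginary parts of the coefficients -/

/-- The real parts of a vector of coefficients. -/
def reVec {n : ℕ} (c : Fin n → ℂ) : Fin n → ℝ := fun i => (c i).re

/-- The imaginary parts of a vector of coefficients. -/
def imVec {n : ℕ} (c : Fin n → ℂ) : Fin n → ℝ := fun i => (c i).im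

/-- The polynomial of degree less than `n` with given coefficients. -/
def lowerPoly {n : ℕ} (v : Fin n → ℝ) : ℝ[X] := ∑ i, C (v i) * X ^ (i : ℕ)

lemma coeff_lowerPoly {n : ℕ} (v : Fin n → ℝ) (k : ℕ) :
    (lowerPoly v).coeff k = if h : k < n then v ⟨k, h⟩ else 0 := by
  simp only [lowerPoly, finsetSum_coeff, coeff_C_mul, coeff_X_pow, mul_ite, mul_one, mul_zero]
  split_ifs with hk
  · rw [Finset.sum_eq_single ⟨k, hk⟩ (fun i _ hi => if_neg fun hki => hi (Fin.ext hki.symm))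
      (fun hmem => absurd (Finset.mem_univ _) hmem), if_pos rfl]
  · exact Finset.sum_eq_zero fun i _ => if_neg fun hki : k = i => hk (hki ▸ i.2)

lemma monicPoly_eq_re_add_im {n : ℕ} (c : Fin n → ℂ) :
    monicPoly c = (monicPoly (reVec c)).map (algebraMap ℝ ℂ) +
      C Complex.I * (lowerPoly (imVec c)).map (algebraMap ℝ ℂ) := by
  ext k
  rw [coeff_add, coeff_C_mul, coeff_map, coeff_map, coeff_monicPoly, coeff_monicPoly,
    coeff_lowerPoly]
  split_ifs with h h'
  · rw [reVec, imVec, mul_comm]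
    exact (Complex.re_add_im _).symm
  · simp
  · simp

lemma natDegree_lowerPoly {m : ℕ} (v : Fin (m + 1) → ℝ) : (lowerPoly v).natDegree < m + 1 := by
  rw [Nat.lt_succ_iff, natDegree_le_iff_coeff_eq_zero]
  intro k hk
  rw [coeff_lowerPoly, dif_neg (by omega)]

lemma coeffVec_lowerPoly {n : ℕ} (v : Fin n → ℝ) : coeffVec n (lowerPoly v) = v := by
  ext i
  rw [coeffVec, coeff_lowerPoly, dif_pos i.2]

lemma lowerPoly_coeffVec {n : ℕ} {p : ℝ[X]} (hp : ∀ k, n ≤ k → p.coeff k = 0) :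
    lowerPoly (coeffVec n p) = p := by
  ext k
  rw [coeff_lowerPoly]
  split_ifs with hk
  · rfl
  · exact (hp k (not_lt.1 hk)).symm

lemma eval_zero_monicPoly {R : Type*} [CommRing R] {m : ℕ} (v : Fin (m + 1) → R) :
    (monicPoly v).eval 0 = v 0 := by
  rw [← coeff_zero_eq_eval_zero, coeff_monicPoly, dif_pos (Nat.succ_pos m)]
  rfl

lemma re_coeff_X_sq_mul_prod_X_sub_C {n : ℕ} (z : Fin n → ℂ) (k : ℕ) :
    ((X ^ 2 * ∏ j, (X - C (z j))).coeff k).re =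
      (X ^ 2 * monicPoly (reVec (rootCoeffs z))).coeff k := by
  rw [← monicPoly_rootCoeffs, monicPoly_eq_re_add_im, coeff_X_pow_mul', coeff_X_pow_mul']
  split_ifs <;> simp

lemma sum_sum_ne_mul {R : Type*} [CommRing R] {n : ℕ} (z : Fin n → R) :
    ∑ j, ∑ k ∈ Finset.univ.filter (fun k => k ≠ j), z j * z k =
      (∑ j, z j) ^ 2 - ∑ j, z j ^ 2 := by
  have hrow (j : Fin n) : ∑ k ∈ Finset.univ.filter (fun k => k ≠ j), z j * z k =
      z j * ∑ k, z k - z j ^ 2 := by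
    rw [Finset.filter_ne', ← Finset.sum_erase_add _ _ (Finset.mem_univ j), mul_add, Finset.mul_sum,
      ← sq, add_sub_cancel_right]
  simp only [hrow, Finset.sum_sub_distrib, ← Finset.sum_mul, sq]

lemma rootSquareSum_reVec {n : ℕ} (z : Fin n → ℂ) :
    rootSquareSum n (monicPoly (reVec (rootCoeffs z))) = (∑ j, (z j).re) ^ 2 -
      ∑ j, ∑ k ∈ Finset.univ.filter (fun k => k ≠ j), (z j * z k).re := by
  have hsum := coeff_X_sq_mul_prod_X_sub_C Finset.univ z
  have hsq := rootSquareSum_prod_X_sub_C Finset.univ z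
  rw [Finset.card_univ, Fintype.card_fin] at hsum hsq
  have hpair : ∑ j, ∑ k ∈ Finset.univ.filter (fun k => k ≠ j), z j * z k =
      2 * (X ^ 2 * ∏ j, (X - C (z j))).coeff n := by
    rw [sum_sum_ne_mul, ← hsq, rootSquareSum, hsum]
    ring
  have hsum_re := congrArg Complex.re hsum
  have hpair_re := congrArg Complex.re hpair
  rw [Complex.neg_re, Complex.re_sum, re_coeff_X_sq_mul_prod_X_sub_C] at hsum_re
  simp only [Complex.re_sum] at hpair_re
  rw [hpair_re, rootSquareSum, hsum_re, neg_sq, ← re_coeff_X_sq_mul_prod_X_sub_C]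
  simp

lemma abs_re_prod {m : ℕ} (z : Fin (m + 1) → ℂ) :
    |(∏ j, z j).re| = |reVec (rootCoeffs z) 0| := by
  have hzero := eval_zero_monicPoly (rootCoeffs z)
  simp only [monicPoly_rootCoeffs, eval_prod, eval_sub, eval_X, eval_C, zero_sub] at hzero
  rw [Finset.prod_neg] at hzero
  rw [reVec, ← hzero]
  rcases neg_one_pow_eq_or ℂ (Finset.univ : Finset (Fin (m + 1))).card with h | h <;>
    rw [h] <;> simp

/-! ### The density in terms of the coefficients -/

/-- The real and imaginary parts of a vector of coefficients. -/
def reIm {n : ℕ} (c : Fin n → ℂ) : (Fin n → ℝ) × (Fin n → ℝ) := (reVec c, imVec c)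

/-- The density, on `interlacingSet m`, of the coefficients of the characteristic polynomials of
a matrix of the Gaussian `β`-ensemble and of its truncation. -/
def interlacingDensity (β : ℝ) (m : ℕ) (y : PairCoeffs m) : ℝ :=
  (totalMass β m)⁻¹ * (2 ^ m)⁻¹ * pairResultant m y ^ (β / 2 - 1) *
    Real.exp (-(1 / 2) * rootSquareSum (m + 1) (monicPoly y.1))

/-- The density, on `perturbedSet m`, of the real and imaginary parts `q` of the coefficients of
the perturbed characteristic polynomial; the perturbation size is `q.2 0 / q.1 0`. -/
def pairDensity (β : ℝ) (m : ℕ) (F : ℝ → ℝ) (q : (Fin (m + 1) → ℝ) × (Fin (m + 1) → ℝ)) : ℝ :=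
  interlacingDensity β m (q.1, companionCoeffs q) * F (q.2 0 / q.1 0) /
    (|q.1 0| * (q.2 0 / q.1 0) ^ m)

section Density

variable {m : ℕ}

lemma lowerPoly_perturbCoeffs (l : ℝ) (y : PairCoeffs m) :
    lowerPoly (perturbCoeffs l y) = C l * (monicPoly y.1 - X * monicPoly y.2) := by
  refine lowerPoly_coeffVec fun k hk => ?_
  obtain ⟨k, rfl⟩ : ∃ j, k = j + 1 := ⟨k - 1, by omega⟩
  rw [coeff_C_mul, coeff_sub, coeff_X_mul, coeff_monicPoly, coeff_monicPoly, dif_neg (by omega),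
    dif_neg (by omega)]
  split_ifs <;> first | omega | simp

variable {q : (Fin (m + 1) → ℝ) × (Fin (m + 1) → ℝ)}

lemma apply_zero_ne_zero_of_div_pos (hq : 0 < q.2 0 / q.1 0) : q.1 0 ≠ 0 :=
  fun h => by simp [h] at hq

lemma perturbCoeffs_companionCoeffs (hq : 0 < q.2 0 / q.1 0) :
    perturbCoeffs (q.2 0 / q.1 0) (q.1, companionCoeffs q) = q.2 := by
  rw [perturbCoeffs_eq_cons]
  ext i
  refine Fin.cases ?_ (fun i => ?_) i
  · rw [Fin.cons_zero, div_mul_cancel₀ _ (apply_zero_ne_zero_of_div_pos hq)]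
  · simp only [Fin.cons_succ, Pi.smul_apply, Pi.sub_apply, Fin.tail, companionCoeffs, smul_eq_mul,
      sub_sub_cancel]
    rw [mul_div_cancel₀ _ hq.ne']

lemma pairResultant_eq_rootProdNorm {y : PairCoeffs m} (hy : y ∈ interlacingSet m) :
    pairResultant m y = rootProdNorm ((monicPoly y.2).map (algebraMap ℝ ℂ))
      ((monicPoly y.1).map (algebraMap ℝ ℂ)) := by
  obtain ⟨⟨a, b⟩, ha, rfl⟩ := exists_jacobiCoeffs_eq hy
  obtain ⟨hp, hc⟩ := Prod.ext_iff.1 (monicPoly_jacobiCoeffs (a, b))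
  dsimp only at hp hc
  rw [hp, hc, rootProdNorm_jacobiPolys, pairResultant_jacobiCoeffs _ _ ha]

lemma pairResultant_pos {y : PairCoeffs m} (hy : y ∈ interlacingSet m) :
    0 < pairResultant m y := by
  obtain ⟨⟨a, b⟩, ha, rfl⟩ := exists_jacobiCoeffs_eq hy
  rw [pairResultant_jacobiCoeffs _ _ ha]
  exact Finset.prod_pos fun j _ => pow_pos (ha j) _

variable {z : Fin (m + 1) → ℂ}

lemma prod_X_sub_C_of_mem_perturbedSet (hq : reIm (rootCoeffs z) = q) (hmem : q ∈ perturbedSet m) :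
    ∏ j, (X - C (z j)) = (monicPoly q.1).map (algebraMap ℝ ℂ) + C Complex.I *
      (C (q.2 0 / q.1 0) * (monicPoly q.1 - X * monicPoly (companionCoeffs q))).map
        (algebraMap ℝ ℂ) := by
  have hlower := lowerPoly_perturbCoeffs (q.2 0 / q.1 0) (q.1, companionCoeffs q)
  rw [perturbCoeffs_companionCoeffs hmem.1] at hlower
  rw [← hlower, ← monicPoly_rootCoeffs, monicPoly_eq_re_add_im, ← hq]
  rfl

lemma configuration_of_mem_perturbedSet (hq : reIm (rootCoeffs z) = q)
    (hmem : q ∈ perturbedSet m) :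
    (∀ j, (z j).im ≠ 0) ∧ argSum z < Real.pi / 2 ∧ Real.tan (argSum z) = q.2 0 / q.1 0 := by
  refine configuration_of_interlaces hmem.2 ?_ hmem.1 (prod_X_sub_C_of_mem_perturbedSet hq hmem)
  rw [eval_zero_monicPoly]
  exact apply_zero_ne_zero_of_div_pos hmem.1

lemma mem_perturbedSet_of_configuration (hq : reIm (rootCoeffs z) = q)
    (hz : ∀ j, (z j).im ≠ 0) (hsum : argSum z < Real.pi / 2) : q ∈ perturbedSet m := by
  have hχ : ∏ j, (X - C (z j)) = (monicPoly q.1).map (algebraMap ℝ ℂ) +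
      C Complex.I * (lowerPoly q.2).map (algebraMap ℝ ℂ) := by
    rw [← monicPoly_rootCoeffs, monicPoly_eq_re_add_im, ← hq]
    rfl
  obtain ⟨htan, hp0, c, hI, hlower⟩ := exists_interlaces_of_configuration hz hsum
    (monic_monicPoly _) (natDegree_monicPoly _) (natDegree_lowerPoly _) hχ
  rw [eval_zero_monicPoly] at hp0
  have hc := monicPoly_coeffVec hI.monic_right hI.natDegree_right
  have hq2 : q.2 = perturbCoeffs (Real.tan (argSum z)) (q.1, coeffVec m c) := by
    rw [← coeffVec_lowerPoly q.2, hlower, perturbCoeffs, hc]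
  obtain ⟨p, h⟩ := q
  dsimp only at hp0 hI hq2
  subst hq2
  constructor
  · rwa [perturbCoeffs_zero_div (y := (p, coeffVec m c)) hp0]
  · rw [companionCoeffs_perturbCoeffs (y := (p, coeffVec m c)) hp0 htan.ne']
    change Interlaces m (monicPoly p) (monicPoly (coeffVec m c))
    rwa [hc]

lemma prod_norm_sub_conj_of_mem_perturbedSet (hq : reIm (rootCoeffs z) = q)
    (hmem : q ∈ perturbedSet m) :
    ∏ j, ∏ k, ‖z j - (starRingEnd ℂ) (z k)‖ = (2 * (q.2 0 / q.1 0)) ^ (m + 1) * |q.1 0| *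
      pairResultant m (q.1, companionCoeffs q) := by
  rw [prod_norm_sub_conj (monic_monicPoly _) (natDegree_monicPoly _) hmem.1
    (prod_X_sub_C_of_mem_perturbedSet hq hmem), eval_zero_monicPoly,
    pairResultant_eq_rootProdNorm hmem.2]

lemma prod_prod_norm_sub_conj_rpow (z : Fin m → ℂ) (s : ℝ) :
    ∏ j, ∏ k, ‖z j - (starRingEnd ℂ) (z k)‖ ^ s =
      (∏ j, ∏ k, ‖z j - (starRingEnd ℂ) (z k)‖) ^ s := by
  rw [← Real.finsetProd_rpow _ _ fun j _ => Finset.prod_nonneg fun k _ => norm_nonneg _]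
  exact Finset.prod_congr rfl fun j _ => Real.finsetProd_rpow _ _ (fun k _ => norm_nonneg _) _

lemma rpow_mul_rpow_mul_rpow_eq {x t r : ℝ} (hx : 0 < x) (ht : 0 < t) (hr : 0 ≤ r) (β : ℝ)
    (m : ℕ) :
    1 / x ^ (β / 2) * ((2 * t) ^ (m + 1) * x * r) ^ (β / 2 - 1) *
        t ^ (1 - β * (m + 1 : ℕ) / 2) =
      2 ^ (((m : ℝ) + 1) * (β / 2 - 1)) * r ^ (β / 2 - 1) / (x * t ^ m) := by
  have ht_pow : t ^ (((m + 1 : ℕ) : ℝ) * (β / 2 - 1)) * t ^ (1 - β * (m + 1 : ℕ) / 2) =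
      (t ^ m)⁻¹ := by
    rw [← Real.rpow_add ht, ← Real.rpow_natCast t m, ← Real.rpow_neg ht.le]
    congr 1
    push_cast
    ring
  have hx_pow : 1 / x ^ (β / 2) * x ^ (β / 2 - 1) = x⁻¹ := by
    rw [← Real.rpow_neg_one, one_div, ← Real.rpow_neg hx.le, ← Real.rpow_add hx]
    ring_nf
  rw [Real.mul_rpow (by positivity) hr, Real.mul_rpow (by positivity) hx.le,
    ← Real.rpow_natCast (2 * t), ← Real.rpow_mul (by positivity),
    Real.mul_rpow two_pos.le ht.le, ← Nat.cast_add_one, div_eq_mul_inv _ (x * _), mul_inv,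
    ← ht_pow, ← hx_pow]
  ring

lemma vandermondeSq_mul_pairDensity {β : ℝ} (hβ : 0 < β) (F : ℝ → ℝ)
    (hq : reIm (rootCoeffs z) = q) (hmem : q ∈ perturbedSet m) :
    ((m + 1).factorial : ℝ)⁻¹ * (vandermondeSq z * pairDensity β m F q) =
      jointDensity β (m + 1) F z := by
  obtain ⟨-, -, htan⟩ := configuration_of_mem_perturbedSet hq hmem
  have hre : reVec (rootCoeffs z) = q.1 := congrArg Prod.fst hq
  have hrpow := rpow_mul_rpow_mul_rpow_eq
    (abs_pos.2 (apply_zero_ne_zero_of_div_pos hmem.1)) hmem.1 (pairResultant_pos hmem.2).le β m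
  rw [pairDensity, interlacingDensity]
  set t := q.2 0 / q.1 0
  set r := pairResultant m (q.1, companionCoeffs q)
  set E := Real.exp (-(1 / 2) * rootSquareSum (m + 1) (monicPoly q.1))
  symm
  calc jointDensity β (m + 1) F z
    _ = (normConst β (m + 1))⁻¹ * E * (1 / |q.1 0| ^ (β / 2)) *
        ((2 * t) ^ (m + 1) * |q.1 0| * r) ^ (β / 2 - 1) * vandermondeSq z *
        (t ^ (1 - β * (m + 1 : ℕ) / 2) * F t) := by
      rw [jointDensity, ← rootSquareSum_reVec, abs_re_prod, hre, htan,
        prod_prod_norm_sub_conj_rpow, prod_norm_sub_conj_of_mem_perturbedSet hq hmem]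
      rfl
    _ = (normConst β (m + 1))⁻¹ * E * vandermondeSq z * F t *
        (1 / |q.1 0| ^ (β / 2) * ((2 * t) ^ (m + 1) * |q.1 0| * r) ^ (β / 2 - 1) *
          t ^ (1 - β * (m + 1 : ℕ) / 2)) := by ring
    _ = _ := by
      rw [hrpow, normConst_eq hβ]
      clear_value t E
      field_simp

end Density

/-! ### Integration against the ensemble -/

section Integration

variable {m : ℕ} {β : ℝ}

lemma measurable_rootSquareSum_monicPoly {n : ℕ} :
    Measurable fun v : Fin n → ℝ => rootSquareSum n (monicPoly v) := by
  have hcoeff (k : ℕ) : Measurable fun v : Fin n → ℝ => (X ^ 2 * monicPoly v).coeff k := by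
    simp only [coeff_X_pow_mul']
    split_ifs
    · exact measurable_coeff_monicPoly _
    · exact measurable_const
  exact ((hcoeff _).pow_const 2).sub ((hcoeff _).const_mul 2)

lemma measurable_interlacingDensity (β : ℝ) (m : ℕ) : Measurable (interlacingDensity β m) := by
  have hsum : Measurable fun y : PairCoeffs m => rootSquareSum (m + 1) (monicPoly y.1) :=
    measurable_rootSquareSum_monicPoly.comp measurable_fst
  exact (((measurable_pairResultant m).pow_const _).const_mul _).mul (hsum.const_mul _).exp

lemma interlacingDensity_nonneg (hβ : 0 < β) {y : PairCoeffs m} (hy : y ∈ interlacingSet m) :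
    0 ≤ interlacingDensity β m y := by
  have hmass := totalMass_pos hβ m
  have hres := pairResultant_pos hy
  rw [interlacingDensity]
  positivity

lemma measurable_coefficientWeight (β : ℝ) (n : ℕ) : Measurable (coefficientWeight β n) := by
  unfold coefficientWeight
  fun_prop

lemma prod_rpow_eq_jacobiJacobian_mul {a : Fin m → ℝ} (ha : ∀ j, 0 < a j) (β : ℝ) :
    ∏ j, a j ^ (β * (((m + 1 : ℕ) : ℝ) - ((j : ℝ) + 1)) - 1) =
      (2 ^ m)⁻¹ * jacobiJacobian a * (∏ j, a j ^ (2 * ((j.rev : ℕ) + 1))) ^ (β / 2 - 1) := by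
  rw [jacobiJacobian, Finset.prod_mul_distrib, Finset.prod_const, Finset.card_univ,
    Fintype.card_fin, ← Real.finsetProd_rpow _ _ fun j _ => (pow_pos (ha j) _).le, ← mul_assoc,
    inv_mul_cancel₀ (by positivity), one_mul, ← Finset.prod_mul_distrib]
  refine Finset.prod_congr rfl fun j _ => ?_
  have hrev : ((j.rev : ℕ) : ℝ) = (m : ℝ) - ((j : ℕ) + 1) := by
    rw [Fin.val_rev, Nat.cast_sub j.2]
    push_cast
    ring
  rw [← Real.rpow_natCast, ← Real.rpow_natCast (a j), ← Real.rpow_mul (ha j).le,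
    ← Real.rpow_add (ha j)]
  congr 1
  push_cast
  rw [hrev]
  ring

lemma coefficientWeight_eq {x : (Fin m → ℝ) × (Fin (m + 1) → ℝ)} (hx : x ∈ jacobiParamSet m) :
    coefficientWeight β (m + 1) x = (2 ^ m)⁻¹ * jacobiJacobian x.1 *
      pairResultant m (jacobiCoeffs m x) ^ (β / 2 - 1) *
        Real.exp (-(1 / 2) * rootSquareSum (m + 1) (monicPoly (jacobiCoeffs m x).1)) := by
  have hp : monicPoly (jacobiCoeffs m x).1 = (jacobiPolys m x.1 x.2).1 :=
    congrArg Prod.fst (monicPoly_jacobiCoeffs x)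
  rw [hp, rootSquareSum_jacobiPolys, pairResultant_jacobiCoeffs _ _ hx, coefficientWeight,
    ← prod_rpow_eq_jacobiJacobian_mul hx]
  have hexp : -(∑ j, x.1 j ^ 2) - 1 / 2 * ∑ j, x.2 j ^ 2 =
      -(1 / 2) * (2 * ∑ j, x.1 j ^ 2 + ∑ j, x.2 j ^ 2) := by ring
  exact congrArg (_ * Real.exp ·) hexp

lemma lintegral_coefficientMeasure (hβ : 0 < β) {g : PairCoeffs m → ℝ≥0∞} (hg : Measurable g) :
    ∫⁻ x, g (jacobiCoeffs m x) ∂((coefficientMeasure β (m + 1) Set.univ)⁻¹ •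
      coefficientMeasure β (m + 1)) =
      ∫⁻ y in interlacingSet m, ENNReal.ofReal (interlacingDensity β m y) * g y := by
  have hmass := totalMass_pos hβ m
  have hint : Measurable fun y => ENNReal.ofReal (interlacingDensity β m y) * g y :=
    (measurable_interlacingDensity β m).ennreal_ofReal.mul hg
  have hgj : Measurable fun x => g (jacobiCoeffs m x) :=
    hg.comp (measurable_jacobiCoeffs m)
  rw [← setLIntegral_jacobiCoeffs m hint, lintegral_smul_measure, coefficientMeasure_univ hβ,
    coefficientMeasure,
    lintegral_withDensity_eq_lintegral_mul _
      (measurable_coefficientWeight β (m + 1)).ennreal_ofReal hgj, smul_eq_mul,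
    ← ENNReal.ofReal_inv_of_pos hmass, ← lintegral_const_mul' _ _ ENNReal.ofReal_ne_top]
  refine setLIntegral_congr_fun (measurableSet_jacobiParamSet m) fun x hx => ?_
  have hx : x ∈ jacobiParamSet m := hx
  have hJ : 0 ≤ jacobiJacobian x.1 := Finset.prod_nonneg fun j _ => by
    have := hx j
    positivity
  simp only [Pi.mul_apply]
  rw [← mul_assoc, ← mul_assoc, ← ENNReal.ofReal_mul (inv_nonneg.2 hmass.le),
    ← ENNReal.ofReal_mul hJ, coefficientWeight_eq hx, interlacingDensity]
  congr 2
  ring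

lemma lintegral_withDensity_of_ae_mem {α : Type*} [MeasurableSpace α] {μ : Measure α}
    {f g : α → ℝ≥0∞} {s : Set α} (hs : MeasurableSet s) (hf : Measurable f) (hg : Measurable g)
    (hmem : ∀ᵐ x ∂μ.withDensity f, x ∈ s) :
    ∫⁻ x, g x ∂μ.withDensity f = ∫⁻ x in s, f x * g x ∂μ := by
  rw [← Measure.restrict_eq_self_of_ae_mem hmem, restrict_withDensity hs,
    lintegral_withDensity_eq_lintegral_mul _ hf hg]
  rfl

lemma measurable_pairDensity (β : ℝ) (m : ℕ) {F : ℝ → ℝ} (hF : Measurable F) :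
    Measurable (pairDensity β m F) := by
  have hdens : Measurable fun q : (Fin (m + 1) → ℝ) × (Fin (m + 1) → ℝ) =>
      interlacingDensity β m (q.1, companionCoeffs q) :=
    (measurable_interlacingDensity β m).comp (measurable_fst.prodMk measurable_companionCoeffs)
  unfold pairDensity
  fun_prop

lemma abs_mul_pow_mul_pairDensity_perturbCoeffs {y : PairCoeffs m} (hy : y.1 0 ≠ 0) {l : ℝ}
    (hl : l ≠ 0) (F : ℝ → ℝ) :
    |y.1 0| * l ^ m * pairDensity β m F (y.1, perturbCoeffs l y) =
      interlacingDensity β m y * F l := by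
  simp only [pairDensity, companionCoeffs_perturbCoeffs hy hl, perturbCoeffs_zero_div hy]
  exact mul_div_cancel₀ _ (mul_ne_zero (abs_ne_zero.2 hy) (pow_ne_zero _ hl))

lemma lintegral_perturbCoeffs_jacobiCoeffs (hβ : 0 < β) {F : ℝ → ℝ} (hF : Measurable F)
    {ν : Measure ℝ} (hν : ν = volume.withDensity fun x => ENNReal.ofReal (F x))
    (hpos : ∀ᵐ l ∂ν, 0 < l) {g : (Fin (m + 1) → ℝ) × (Fin (m + 1) → ℝ) → ℝ≥0∞}
    (hg : Measurable g) :
    ∫⁻ x, ∫⁻ l, g ((jacobiCoeffs m x).1, perturbCoeffs l (jacobiCoeffs m x)) ∂ν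
      ∂((coefficientMeasure β (m + 1) Set.univ)⁻¹ • coefficientMeasure β (m + 1)) =
      ∫⁻ q in perturbedSet m, ENNReal.ofReal (pairDensity β m F q) * g q := by
  have : SFinite ν := hν ▸ inferInstance
  have hgm : Measurable fun p : PairCoeffs m × ℝ => g (p.1.1, perturbCoeffs p.2 p.1) :=
    hg.comp (by fun_prop)
  have hint : Measurable fun q => ENNReal.ofReal (pairDensity β m F q) * g q :=
    (measurable_pairDensity β m hF).ennreal_ofReal.mul hg
  rw [lintegral_coefficientMeasure hβ (g := fun y => ∫⁻ l, g (y.1, perturbCoeffs l y) ∂ν)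
      hgm.lintegral_prod_right',
    ← setLIntegral_perturbCoeffs hint]
  have hy0 : ∀ᵐ y : PairCoeffs m ∂volume.restrict (interlacingSet m), y.1 0 ≠ 0 :=
    ae_restrict_of_ae (Measure.quasiMeasurePreserving_fst.ae (ae_apply_zero_ne_zero m))
  refine lintegral_congr_ae ?_
  filter_upwards [hy0, ae_restrict_mem (measurableSet_interlacingSet m)] with y hy0 hy
  have hgy : Measurable fun l => g (y.1, perturbCoeffs l y) :=
    hgm.comp measurable_prodMk_left
  subst hν
  rw [lintegral_withDensity_of_ae_mem measurableSet_Ioi hF.ennreal_ofReal hgy hpos,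
    ← lintegral_const_mul' _ _ ENNReal.ofReal_ne_top]
  refine setLIntegral_congr_fun measurableSet_Ioi fun l hl => ?_
  have hl : 0 < l := hl
  rw [← mul_assoc, ← mul_assoc, ← ENNReal.ofReal_mul (interlacingDensity_nonneg hβ hy),
    ← abs_mul_pow_mul_pairDensity_perturbCoeffs hy0 hl.ne', ENNReal.ofReal_mul (by positivity)]

end Integration

/-! ### The law of the eigenvalues -/

/-- The complex vector with given real and imaginary parts. -/
def ofReIm {n : ℕ} (q : (Fin n → ℝ) × (Fin n → ℝ)) : Fin n → ℂ := fun i => ⟨q.1 i, q.2 i⟩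

lemma measurable_ofReIm {n : ℕ} : Measurable (ofReIm (n := n)) := by
  refine measurable_pi_iff.2 fun i => ?_
  change Measurable fun q : (Fin n → ℝ) × (Fin n → ℝ) =>
    Complex.measurableEquivRealProd.symm (q.1 i, q.2 i)
  fun_prop

lemma measurePreserving_reIm (n : ℕ) : MeasurePreserving (reIm (n := n)) volume volume :=
  (volume_measurePreserving_arrowProdEquivProdArrow ℝ ℝ (Fin n)).comp
    (volume_preserving_pi fun _ : Fin n => Complex.volume_preserving_equiv_real_prod)

/-- The off-diagonal and diagonal entries of a Jacobi matrix; a left inverse of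
`jacobiMatrix`. -/
def jacobiParams {m : ℕ} (M : Matrix (Fin (m + 1)) (Fin (m + 1)) ℝ) :
    (Fin m → ℝ) × (Fin (m + 1) → ℝ) :=
  (fun j => M j.castSucc j.succ, fun i => M i i)

/-- The lower coefficients of the characteristic polynomial of the multiplicative perturbation of
size `p.2` of the Jacobi matrix `p.1`. -/
def perturbedCoeffs {m : ℕ} (p : Matrix (Fin (m + 1)) (Fin (m + 1)) ℝ × ℝ) : Fin (m + 1) → ℂ :=
  ofReIm ((jacobiCoeffs m (jacobiParams p.1)).1,
    perturbCoeffs p.2 (jacobiCoeffs m (jacobiParams p.1)))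

/-- The coefficients of the polynomials `∏ j, (X - C (z j))` with `z ∈ configurations (m + 1) ν`,
where `S` stands for the support of `ν`. -/
def coeffRegion (m : ℕ) (S : Set ℝ) : Set (Fin (m + 1) → ℂ) :=
  {c | reIm c ∈ perturbedSet m ∧ (reIm c).2 0 / (reIm c).1 0 ∈ S}

section Law

variable {m : ℕ} {β : ℝ} {F : ℝ → ℝ} {ν : Measure ℝ}

lemma jacobiParams_jacobiMatrix (x : (Fin m → ℝ) × (Fin (m + 1) → ℝ)) :
    jacobiParams (jacobiMatrix (n := m + 1) x.1 x.2) = x := by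
  refine Prod.ext (funext fun j => ?_) (funext fun i => ?_)
  · simp [jacobiParams, jacobiMatrix, Fin.ext_iff]
  · simp [jacobiParams, jacobiMatrix]

lemma measurable_matrix_apply {n : ℕ} (i j : Fin n) :
    Measurable fun M : Matrix (Fin n) (Fin n) ℝ => M i j :=
  (measurable_pi_apply j).comp (measurable_pi_apply (X := fun _ => Fin n → ℝ) i)

lemma measurable_jacobiParams : Measurable (jacobiParams (m := m)) :=
  (measurable_pi_iff.2 fun _ => measurable_matrix_apply _ _).prodMk
    (measurable_pi_iff.2 fun _ => measurable_matrix_apply _ _)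

lemma measurable_jacobiMatrix {n : ℕ} :
    Measurable fun x : (Fin (n - 1) → ℝ) × (Fin n → ℝ) => jacobiMatrix x.1 x.2 := by
  refine measurable_pi_iff.2 fun i => measurable_pi_iff.2 fun j => ?_
  simp only [jacobiMatrix, Matrix.of_apply]
  split_ifs <;> fun_prop

lemma measurableSet_jacobiMatrix_jacobiParams (m : ℕ) :
    MeasurableSet {M : Matrix (Fin (m + 1)) (Fin (m + 1)) ℝ |
      jacobiMatrix (n := m + 1) (jacobiParams M).1 (jacobiParams M).2 = M} := by
  simp only [← Matrix.ext_iff, Set.ofPred_forall]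
  exact MeasurableSet.iInter fun i => MeasurableSet.iInter fun j => measurableSet_eq_fun
    ((measurable_matrix_apply i j).comp (measurable_jacobiMatrix.comp measurable_jacobiParams))
    (measurable_matrix_apply i j)

lemma ae_jacobiMatrix_jacobiParams (β : ℝ) (m : ℕ) :
    ∀ᵐ M : Matrix (Fin (m + 1)) (Fin (m + 1)) ℝ ∂gaussianBetaEnsemble β (m + 1),
      jacobiMatrix (n := m + 1) (jacobiParams M).1 (jacobiParams M).2 = M := by
  rw [gaussianBetaEnsemble, ae_map_iff measurable_jacobiMatrix.aemeasurable
    (measurableSet_jacobiMatrix_jacobiParams m)]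
  exact ae_of_all _ fun x => by rw [jacobiParams_jacobiMatrix (m := m) x]

lemma measurable_perturbedCoeffs : Measurable (perturbedCoeffs (m := m)) := by
  have hcoeffs : Measurable fun p : Matrix (Fin (m + 1)) (Fin (m + 1)) ℝ × ℝ =>
      jacobiCoeffs m (jacobiParams p.1) :=
    (measurable_jacobiCoeffs m).comp (measurable_jacobiParams.comp measurable_fst)
  exact measurable_ofReIm.comp
    (hcoeffs.fst.prodMk (measurable_perturbCoeffs measurable_snd hcoeffs))

lemma eigenvalues_multPerturbation [NeZero (m + 1)] {M : Matrix (Fin (m + 1)) (Fin (m + 1)) ℝ}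
    (hM : jacobiMatrix (n := m + 1) (jacobiParams M).1 (jacobiParams M).2 = M) (l : ℝ) :
    eigenvalues (multPerturbation M l) = rootConfig (perturbedCoeffs (M, l)) := by
  obtain ⟨hchar, hchar'⟩ := charpoly_jacobiMatrix m (jacobiParams M).1 (jacobiParams M).2
  obtain ⟨hp, hc⟩ := Prod.ext_iff.1 (monicPoly_jacobiCoeffs (jacobiParams M))
  dsimp only at hp hc
  rw [hM] at hchar hchar'
  have hre : reVec (perturbedCoeffs (M, l)) = (jacobiCoeffs m (jacobiParams M)).1 := rfl
  have him : imVec (perturbedCoeffs (M, l)) =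
    perturbCoeffs l (jacobiCoeffs m (jacobiParams M)) := rfl
  apply Subtype.ext
  change (multPerturbation M l).charpoly.roots = (monicPoly (perturbedCoeffs (M, l))).roots
  congr 1
  rw [charpoly_multPerturbation, hchar, hchar', monicPoly_eq_re_add_im, hre, him,
    lowerPoly_perturbCoeffs, hp, hc]
  simp only [Polynomial.map_mul, Polynomial.map_sub, map_C, map_X, map_add, map_mul, map_one,
    Complex.coe_algebraMap]
  ring

lemma ae_eigenvalues_multPerturbation [NeZero (m + 1)] (β : ℝ) (ν : Measure ℝ) :
    ∀ᵐ p ∂(gaussianBetaEnsemble β (m + 1)).prod ν,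
      eigenvalues (multPerturbation p.1 p.2) = rootConfig (perturbedCoeffs p) :=
  (Measure.quasiMeasurePreserving_fst.ae (ae_jacobiMatrix_jacobiParams β m)).mono
    fun p hp => eigenvalues_multPerturbation hp p.2

lemma measurableSet_preimage_perturbedSet (m : ℕ) :
    MeasurableSet (reIm ⁻¹' perturbedSet m) :=
  measurableSet_preimage (measurePreserving_reIm (m + 1)).measurable (measurableSet_perturbedSet m)

lemma measurableSet_coeffRegion (m : ℕ) {S : Set ℝ} (hS : MeasurableSet S) :
    MeasurableSet (coeffRegion m S) :=
  measurableSet_preimage (measurePreserving_reIm (m + 1)).measurable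
    ((measurableSet_perturbedSet m).inter
      (measurableSet_preimage (f := fun q : (Fin (m + 1) → ℝ) × (Fin (m + 1) → ℝ) =>
        q.2 0 / q.1 0) (by fun_prop) hS))

lemma map_perturbedCoeffs (hβ : 0 < β) (hF : Measurable F)
    (hν : ν = volume.withDensity fun x => ENNReal.ofReal (F x)) (hpos : ∀ᵐ l ∂ν, 0 < l) :
    ((gaussianBetaEnsemble β (m + 1)).prod ν).map perturbedCoeffs =
      (volume.restrict (reIm ⁻¹' perturbedSet m)).withDensity
        fun c => ENNReal.ofReal (pairDensity β m F (reIm c)) := by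
  have : SFinite ν := hν ▸ inferInstance
  have hdens := (measurable_pairDensity β m hF).ennreal_ofReal
  have hdensc : Measurable fun c => ENNReal.ofReal (pairDensity β m F (reIm c)) :=
    hdens.comp (measurePreserving_reIm (m + 1)).measurable
  refine Measure.ext_of_lintegral _ fun g hg => ?_
  have hgm : Measurable fun p => g (perturbedCoeffs (m := m) p) :=
    hg.comp measurable_perturbedCoeffs
  have hgo : Measurable fun q => g (ofReIm q) := hg.comp measurable_ofReIm
  calc ∫⁻ c, g c ∂((gaussianBetaEnsemble β (m + 1)).prod ν).map perturbedCoeffs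
    _ = ∫⁻ x, ∫⁻ l, g (perturbedCoeffs (jacobiMatrix (n := m + 1) x.1 x.2, l)) ∂ν
        ∂((coefficientMeasure β (m + 1) Set.univ)⁻¹ • coefficientMeasure β (m + 1)) := by
      rw [lintegral_map hg measurable_perturbedCoeffs, lintegral_prod _ hgm.aemeasurable,
        gaussianBetaEnsemble, lintegral_map hgm.lintegral_prod_right' measurable_jacobiMatrix]
    _ = ∫⁻ q in perturbedSet m, ENNReal.ofReal (pairDensity β m F q) * g (ofReIm q) := by
      rw [← lintegral_perturbCoeffs_jacobiCoeffs hβ hF hν hpos hgo]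
      refine lintegral_congr fun x => lintegral_congr fun l => ?_
      rw [perturbedCoeffs, jacobiParams_jacobiMatrix (m := m) x]
    _ = _ := by
      rw [← (measurePreserving_reIm (m + 1)).setLIntegral_comp_preimage
          (measurableSet_perturbedSet m) (f := fun q =>
            ENNReal.ofReal (pairDensity β m F q) * g (ofReIm q)) (hdens.mul hgo),
        lintegral_withDensity_eq_lintegral_mul _ hdensc hg]
      rfl

lemma ae_perturbedCoeffs_mem_coeffRegion (hβ : 0 < β) (hF : Measurable F)
    (hν : ν = volume.withDensity fun x => ENNReal.ofReal (F x)) (hpos : ∀ᵐ l ∂ν, 0 < l) :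
    ∀ᵐ p ∂(gaussianBetaEnsemble β (m + 1)).prod ν, perturbedCoeffs p ∈ coeffRegion m ν.support ∧
      (reIm (perturbedCoeffs p)).2 0 / (reIm (perturbedCoeffs p)).1 0 = p.2 := by
  have hmem : ∀ᵐ p ∂(gaussianBetaEnsemble β (m + 1)).prod ν,
      reIm (perturbedCoeffs p) ∈ perturbedSet m := by
    refine ae_of_ae_map (p := fun c => reIm c ∈ perturbedSet m)
      measurable_perturbedCoeffs.aemeasurable ?_
    rw [map_perturbedCoeffs hβ hF hν hpos]
    exact (withDensity_absolutelyContinuous _ _).ae_le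
      (ae_restrict_mem (measurableSet_preimage_perturbedSet m))
  have hsupp : ∀ᵐ p ∂(gaussianBetaEnsemble β (m + 1)).prod ν, p.2 ∈ ν.support :=
    Measure.quasiMeasurePreserving_snd.ae Measure.support_mem_ae
  filter_upwards [hmem, hsupp] with p hp hp2
  have hratio : (reIm (perturbedCoeffs p)).2 0 / (reIm (perturbedCoeffs p)).1 0 = p.2 :=
    perturbCoeffs_zero_div (apply_zero_ne_zero_of_div_pos hp.1) _
  exact ⟨⟨hp, by rwa [hratio]⟩, hratio⟩

lemma hasLaw_perturbedCoeffs (hβ : 0 < β) (hF : Measurable F)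
    (hν : ν = volume.withDensity fun x => ENNReal.ofReal (F x)) (hpos : ∀ᵐ l ∂ν, 0 < l) :
    HasLaw perturbedCoeffs
      ((volume.restrict (coeffRegion m ν.support)).withDensity
        fun c => ENNReal.ofReal (pairDensity β m F (reIm c)))
      ((gaussianBetaEnsemble β (m + 1)).prod ν) where
  aemeasurable := measurable_perturbedCoeffs.aemeasurable
  map_eq := by
    have hR := measurableSet_coeffRegion m (S := ν.support) Measure.isClosed_support.measurableSet
    have hmem : ∀ᵐ c ∂((gaussianBetaEnsemble β (m + 1)).prod ν).map perturbedCoeffs,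
        c ∈ coeffRegion m ν.support :=
      (ae_map_iff measurable_perturbedCoeffs.aemeasurable hR).2
        ((ae_perturbedCoeffs_mem_coeffRegion hβ hF hν hpos).mono fun _ h => h.1)
    rw [← Measure.restrict_eq_self_of_ae_mem hmem, map_perturbedCoeffs hβ hF hν hpos,
      restrict_withDensity hR, Measure.restrict_restrict_of_subset fun c hc => hc.1]

lemma mem_configurations_iff {z : Fin (m + 1) → ℂ} :
    z ∈ configurations (m + 1) ν ↔ rootCoeffs z ∈ coeffRegion m ν.support := by
  constructor
  · rintro ⟨him, hsum, htan⟩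
    have hmem := mem_perturbedSet_of_configuration rfl him hsum
    exact ⟨hmem, (configuration_of_mem_perturbedSet rfl hmem).2.2 ▸ htan⟩
  · rintro ⟨hmem, hratio⟩
    obtain ⟨him, hsum, htan⟩ := configuration_of_mem_perturbedSet rfl hmem
    exact ⟨him, hsum, htan ▸ hratio⟩

lemma mem_configurations_of_toConfig_eq {z c : Fin (m + 1) → ℂ}
    (hc : c ∈ coeffRegion m ν.support) (hz : toConfig z = rootConfig c) :
    z ∈ configurations (m + 1) ν ∧ Real.tan (argSum z) = (reIm c).2 0 / (reIm c).1 0 := by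
  rw [← rootConfig_rootCoeffs] at hz
  obtain rfl := rootConfig_injective hz
  exact ⟨mem_configurations_iff.2 hc, (configuration_of_mem_perturbedSet rfl hc.1).2.2⟩

lemma measurableSet_configurations (m : ℕ) (ν : Measure ℝ) :
    MeasurableSet (configurations (m + 1) ν) := by
  have hpre : configurations (m + 1) ν = rootCoeffs ⁻¹' coeffRegion m ν.support :=
    Set.ext fun _ => mem_configurations_iff
  rw [hpre]
  exact measurableSet_preimage (measurable_rootCoeffs _)
    (measurableSet_coeffRegion m Measure.isClosed_support.measurableSet)

lemma factorial_inv_mul_indicator_pairDensity (hβ : 0 < β) (F : ℝ → ℝ) (ν : Measure ℝ)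
    (z : Fin (m + 1) → ℂ) :
    ((m + 1).factorial : ℝ≥0∞)⁻¹ * (ENNReal.ofReal (vandermondeSq z) *
      (coeffRegion m ν.support).indicator
        (fun c => ENNReal.ofReal (pairDensity β m F (reIm c))) (rootCoeffs z)) =
      (configurations (m + 1) ν).indicator
        (fun z => ENNReal.ofReal (jointDensity β (m + 1) F z)) z := by
  by_cases hz : z ∈ configurations (m + 1) ν
  · have hmem := mem_configurations_iff.1 hz
    rw [Set.indicator_of_mem hz, Set.indicator_of_mem hmem,
      ← vandermondeSq_mul_pairDensity hβ F rfl hmem.1, ENNReal.ofReal_mul (by positivity),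
      ENNReal.ofReal_mul (vandermondeSq_nonneg z), ENNReal.ofReal_inv_of_pos (by positivity),
      ENNReal.ofReal_natCast]
  · rw [Set.indicator_of_notMem hz, Set.indicator_of_notMem (mt mem_configurations_iff.2 hz),
      mul_zero, mul_zero]

lemma hasLaw_rootConfig (hβ : 0 < β) (hF : Measurable F) (ν : Measure ℝ) :
    HasLaw rootConfig
      (((volume.restrict (configurations (m + 1) ν)).withDensity
        fun z => ENNReal.ofReal (jointDensity β (m + 1) F z)).map toConfig)
      ((volume.restrict (coeffRegion m ν.support)).withDensity
        fun c => ENNReal.ofReal (pairDensity β m F (reIm c))) := by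
  have hR := measurableSet_coeffRegion m (S := ν.support) Measure.isClosed_support.measurableSet
  have hdens : Measurable fun c : Fin (m + 1) → ℂ => ENNReal.ofReal (pairDensity β m F (reIm c)) :=
    ((measurable_pairDensity β m hF).comp (measurePreserving_reIm _).measurable).ennreal_ofReal
  rw [← withDensity_indicator hR, ← withDensity_indicator (measurableSet_configurations m ν)]
  refine ⟨(aemeasurable_rootConfig (m + 1)).mono_ac (withDensity_absolutelyContinuous _ _), ?_⟩
  rw [map_rootConfig_withDensity (hdens.indicator hR)]
  congr 2
  exact funext (factorial_inv_mul_indicator_pairDensity hβ F ν)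

end Law

end MultPert

end

theorem theorem2p1 {Ω : Type*} [MeasurableSpace Ω] (P : Measure Ω) [IsProbabilityMeasure P]
    (n : ℕ) [NeZero n] (β : ℝ) (hβ : 0 < β)
    (J : Ω → Matrix (Fin n) (Fin n) ℝ) (hJ : HasLaw J (MultPert.gaussianBetaEnsemble β n) P)
    (l : Ω → ℝ) (hl : ∀ᵐ ω ∂P, 0 < l ω)
    (F : ℝ → ℝ) (hF : Measurable F) (hF0 : ∀ x, 0 ≤ F x)
    (ν : Measure ℝ) (hν : ν = volume.withDensity fun x => ENNReal.ofReal (F x))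
    (hlν : HasLaw l ν P) (hJl : IndepFun J l P) :
    (∀ᵐ ω ∂P, ∀ z : Fin n → ℂ,
      MultPert.toConfig z = MultPert.eigenvalues (MultPert.multPerturbation (J ω) (l ω)) →
        z ∈ MultPert.configurations n ν ∧ l ω = Real.tan (MultPert.argSum z)) ∧
    HasLaw (fun ω => MultPert.eigenvalues (MultPert.multPerturbation (J ω) (l ω)))
      (((volume.restrict (MultPert.configurations n ν)).withDensity fun z =>
        ENNReal.ofReal (MultPert.jointDensity β n F z)).map MultPert.toConfig) P := by
  obtain ⟨m, rfl⟩ : ∃ m, n = m + 1 := Nat.exists_eq_succ_of_ne_zero (NeZero.ne n)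
  have : IsProbabilityMeasure ν := hlν.isProbabilityMeasure_iff.1 ‹_›
  have hpos : ∀ᵐ x ∂ν, 0 < x := (hlν.ae_iff (measurableSet_setOfPred.1 measurableSet_Ioi)).1 hl
  have hpair := (indepFun_iff_hasLaw_prodMk_prod hJ hlν).1 hJl
  have hev := ae_of_ae_map hpair.aemeasurable
    (hpair.map_eq ▸ MultPert.ae_eigenvalues_multPerturbation β ν)
  have hmem := ae_of_ae_map hpair.aemeasurable
    (hpair.map_eq ▸ MultPert.ae_perturbedCoeffs_mem_coeffRegion hβ hF hν hpos)
  refine ⟨?_, ((MultPert.hasLaw_rootConfig hβ hF ν).comp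
    ((MultPert.hasLaw_perturbedCoeffs hβ hF hν hpos).comp hpair)).congr hev⟩
  filter_upwards [hev, hmem] with ω hω ⟨hmem, hratio⟩ z hz
  obtain ⟨hz', htan⟩ := MultPert.mem_configurations_of_toConfig_eq hmem (hz.trans hω)
  exact ⟨hz', (htan.trans hratio).symm⟩
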